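/- Let $n\ge 1$. Let $\mathcal D^n$ be the set of $n$-tuples $f=(f_1,\dots,f_n)$ of cadlag functions $f_i:[0,\infty)\to\mathbb R$ all of whose jumps are positive and with $f_i(0)\ge 0$; by convention $f_i(0^-)=0$. Let $df$ be the finitely additive signed measure on $[0,\infty)\times\{1,\dots,n\}$ with $df([a,b]\times\{i\})=f_i(b)-f_i(a^-)$. For $0\le x\le y$, a path from $(x,n)$ to $(y,1)$ is a set $\bigcup_{i=1}^n[t_i,t_{i-1}]\times\{i\}$ with $x=t_n\le t_{n-1}\le\dots\le t_1\le t_0=y$; the $t_i$ are its jump times. A path $\pi$ is to the left of a path $\rho$ if for all $(z,\ell)\in\pi$, $(w,m)\in\rho$ at least one of $\ell\le m$, $z\le w$ holds. A disjoint $k$-tuple from $(x,n)^k$ to $(y,1)^k$ is a tuple $(\pi_1,\dots,\pi_k)$ of paths from $(x,n)$ to $(y,1)$ such that $\pi_i$ is to the left of $\pi_j$ for $i<j$ and $\pi_i\cap\pi_j$ is finite for $i\ne j$. Let $f[(x,n)^k\to(y,1)^k]$ be the supremum of $df(\pi_1\cup\dots\cup\pi_k)$ over these tuples (equal to $0$ for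 $k=0$), and write $f[(x,n)\to(y,1)]$ for $k=1$. A tuple attaining the supremum is called a $k$-disjoint optimizer. The melon map is $Wf_k(y)=f[(0,n)^k\to(y,1)^k]-f[(0,n)^{k-1}\to(y,1)^{k-1}]$ for $1\le k\le n$, $y\ge0$. For $t>0$ let $R_t$ be the 180-degree rotation of $[0,t]\times\{1,\dots,n\}$, acting on the measures $df$ restricted to this set, i.e. $R_tf_i(x)=f_{n+1-i}(t)-f_{n+1-i}((t-x)^-)$ for $0\le x\le t$. The lemon map is $Mf=\lim_{t\to\infty}R_tWR_tf$. Let $\mathcal D^n_\uparrow$ be the set of $f\in\mathcal D^n$ with $f_{i-1}(y^-)\ge f_i(y)$ for all $2\le i\le n$ and $y\ge 0$. Let $\mathcal D^n_{\downarrow-}$ be the set of $f\in\mathcal D^n$ such that for every $k\in\{1,\dots,n\}$ there are $s_m\to\infty$ and $k$-disjoint optimizers $(\pi^m_1,\dots,\pi^m_k)$ from $(0,n)^k$ to $(s_m,1)^k$ which converge to the $k$ lowest constant paths: for each $j$, the jump times $t_i$ of $\pi^m_j$ tend to $0$ if $i\ge n-k+j$ and to $\infty$ if $i<n-k+j$,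 as $m\to\infty$. Let $\mathcal D^n_\downarrow$ be the closure of $\mathcal D^n_{\downarrow-}$ in $\mathcal D^n$ in the topology of uniform convergence on $[0,\infty)\times\{1,\dots,n\}$. Theorem. $W$ maps $\mathcal D^n$ to $\mathcal D^n$. For every $f\in\mathcal D^n$ the limit defining $Mf$ exists uniformly on compact sets and $Mf\in\mathcal D^n$. Moreover: (i) (Isometry) $f[(x,n)\to(y,1)]=Mf[(x,n)\to(y,1)]$ for all $f\in\mathcal D^n$ and $0\le x\le y$. (ii) (Idempotence) $MM=M$ on $\mathcal D^n$. (iii) (Image) $M(\mathcal D^n)=\mathcal D^n_\downarrow$. (iv) (Bijection) $M$ is a bijection from $\mathcal D^n_\uparrow$ onto $\mathcal D^n_\downarrow$ with inverse $W$. (v) $MW=M$ and $WM=W$ on $\mathcal D^n$. -/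

import Mathlib

open Set Filter Topology

namespace LemonMap

noncomputable section

/-- The space `𝒟ⁿ` of `n`-tuples of cadlag functions on `[0, ∞)` all of whose jumps are positive,
with the convention `f_i(0⁻) = 0`. A function on `[0, ∞)` is represented by its extension by `0` to
the negative half-line; in this way the left limit at `0` is `0`, and the condition on jumps at `0`
says `f_i(0) ≥ 0`. The lines `1, …, n` (from top to bottom) are indexed by `0, …, n - 1 : Fin n`. -/
def cadlagSpace (n : ℕ) : Set (Fin n → ℝ → ℝ) :=
  {f | ∀ i,
    (∀ x < 0, f i x = 0) ∧
    (∀ x, ContinuousWithinAt (f i) (Ici x) x) ∧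
    (∀ x, ∃ l, Tendsto (f i) (𝓝[<] x) (𝓝 l)) ∧
    (∀ x, Function.leftLim (f i) x ≤ f i x)}

/-- The finitely additive signed measure `dg` of a function `g`, evaluated at a set `A` which is a
finite union of compact intervals (points allowed): each connected component `[a, b]` of `A`
contributes `g(b) - g(a⁻)`. The right (left) endpoints of the components are the points of `A` with
no points of `A` immediately to their right (left). -/
def mass (g : ℝ → ℝ) (A : Set ℝ) : ℝ :=
  (∑ᶠ b ∈ {b | b ∈ A ∧ ∀ᶠ z in 𝓝[>] b, z ∉ A}, g b) -
    ∑ᶠ a ∈ {a | a ∈ A ∧ ∀ᶠ z in 𝓝[<] a, z ∉ A}, Function.leftLim g a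

/-- Sanity check: `dg([a, b]) = g(b) - g(a⁻)`. -/
theorem mass_Icc (g : ℝ → ℝ) {a b : ℝ} (hab : a ≤ b) :
    mass g (Icc a b) = g b - Function.leftLim g a := by
  have hR : {c | c ∈ Icc a b ∧ ∀ᶠ z in 𝓝[>] c, z ∉ Icc a b} = {b} := by
    ext c
    simp only [mem_ofPred_eq, mem_singleton_iff]
    constructor
    · rintro ⟨⟨h1, h2⟩, h3⟩
      by_contra hne
      have hlt : c < b := lt_of_le_of_ne h2 hne
      obtain ⟨z, hz, hz'⟩ := (h3.and (Ioo_mem_nhdsGT hlt)).exists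
      exact hz ⟨h1.trans hz'.1.le, hz'.2.le⟩
    · rintro rfl
      refine ⟨⟨hab, le_rfl⟩, ?_⟩
      filter_upwards [self_mem_nhdsWithin] with z hz hz'
      exact absurd hz'.2 (not_le.2 hz)
  have hL : {c | c ∈ Icc a b ∧ ∀ᶠ z in 𝓝[<] c, z ∉ Icc a b} = {a} := by
    ext c
    simp only [mem_ofPred_eq, mem_singleton_iff]
    constructor
    · rintro ⟨⟨h1, h2⟩, h3⟩
      by_contra hne
      have hlt : a < c := lt_of_le_of_ne h1 (Ne.symm hne)
      obtain ⟨z, hz, hz'⟩ := (h3.and (Ioo_mem_nhdsLT hlt)).exists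
      exact hz ⟨hz'.1.le, hz'.2.le.trans h2⟩
    · rintro rfl
      refine ⟨⟨le_rfl, hab⟩, ?_⟩
      filter_upwards [self_mem_nhdsWithin] with z hz hz'
      exact absurd hz'.1 (not_le.2 hz)
  unfold mass
  rw [hR, hL]
  simp

/-- The finitely additive signed measure `df` on `[0, ∞) × {1, …, n}`. -/
def measureOf {n : ℕ} (f : Fin n → ℝ → ℝ) (A : Set (ℝ × Fin n)) : ℝ :=
  ∑ i, mass (f i) {x | (x, i) ∈ A}

/-- `t` is the sequence of jump times `x = t_n ≤ t_{n-1} ≤ ⋯ ≤ t_1 ≤ t_0 = y` of a path from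
`(x, n)` to `(y, 1)`. -/
def IsPath {n : ℕ} (x y : ℝ) (t : Fin (n + 1) → ℝ) : Prop :=
  Antitone t ∧ t (Fin.last n) = x ∧ t 0 = y

/-- The path with jump times `t`: on line `i` (counted from `1`) it is the interval
`[t_i, t_{i-1}]`. -/
def pathSet {n : ℕ} (t : Fin (n + 1) → ℝ) : Set (ℝ × Fin n) :=
  {p | p.1 ∈ Icc (t p.2.succ) (t p.2.castSucc)}

/-- Sanity check: the length `df(π) = ∑ i, f_i(t_{i-1}) - f_i(t_i⁻)` of a single path. -/
theorem measureOf_pathSet {n : ℕ} (f : Fin n → ℝ → ℝ) {x y : ℝ} {t : Fin (n + 1) → ℝ}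
    (ht : IsPath x y t) :
    measureOf f (pathSet t) =
      ∑ i, (f i (t i.castSucc) - Function.leftLim (f i) (t i.succ)) :=
  Finset.sum_congr rfl fun i _ => mass_Icc (f i) (ht.1 (Fin.castSucc_le_succ i))

/-- The last passage value `f[(x, n) → (y, 1)]`. -/
def lastPassage {n : ℕ} (f : Fin n → ℝ → ℝ) (x y : ℝ) : ℝ :=
  sSup {r | ∃ t, IsPath x y t ∧ r = measureOf f (pathSet t)}

/-- `π` is to the left of `ρ`. -/
def IsLeftOf {n : ℕ} (π ρ : Set (ℝ × Fin n)) : Prop :=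
  ∀ p ∈ π, ∀ q ∈ ρ, p.2 ≤ q.2 ∨ p.1 ≤ q.1

/-- The rows of `t` are the jump times of a disjoint `k`-tuple of paths from `(x, n)^k` to
`(y, 1)^k`. -/
def IsDisjointTuple {n k : ℕ} (x y : ℝ) (t : Fin k → Fin (n + 1) → ℝ) : Prop :=
  (∀ j, IsPath x y (t j)) ∧
  (∀ i j, i < j → IsLeftOf (pathSet (t i)) (pathSet (t j))) ∧
  (∀ i j, i ≠ j → (pathSet (t i) ∩ pathSet (t j)).Finite)

/-- The length `df(π_1 ∪ ⋯ ∪ π_k)` of a `k`-tuple of paths. -/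
def tupleLength {n k : ℕ} (f : Fin n → ℝ → ℝ) (t : Fin k → Fin (n + 1) → ℝ) : ℝ :=
  measureOf f (⋃ j, pathSet (t j))

/-- The multi-point last passage value `f[(x, n)^k → (y, 1)^k]`. It is `0` for `k = 0`. -/
def multiLastPassage {n : ℕ} (f : Fin n → ℝ → ℝ) (k : ℕ) (x y : ℝ) : ℝ :=
  sSup {r | ∃ t : Fin k → Fin (n + 1) → ℝ, IsDisjointTuple x y t ∧ r = tupleLength f t}

/-- `t` is a `k`-disjoint optimizer for `f` from `(x, n)` to `(y, 1)`. -/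
def IsOptimizer {n k : ℕ} (f : Fin n → ℝ → ℝ) (x y : ℝ) (t : Fin k → Fin (n + 1) → ℝ) : Prop :=
  IsDisjointTuple x y t ∧ tupleLength f t = multiLastPassage f k x y

/-- The melon map `W`: `Wf_k(y) = f[(0, n)^k → (y, 1)^k] - f[(0, n)^{k-1} → (y, 1)^{k-1}]` for
`y ≥ 0` (with line `k` represented by the index `k - 1`). -/
def melon {n : ℕ} (f : Fin n → ℝ → ℝ) : Fin n → ℝ → ℝ := fun k y =>
  if y < 0 then 0 else multiLastPassage f (k.val + 1) 0 y - multiLastPassage f k.val 0 y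

/-- The rotation `R_t`: the restriction of `df` to `[0, t] × {1, …, n}` is rotated by 180 degrees,
so that `R_t f_i(x) = df([t - x, t] × {n + 1 - i}) = f_{n+1-i}(t) - f_{n+1-i}((t - x)⁻)` for
`0 ≤ x ≤ t`. After time `t` the function `R_t f` is constant. -/
def rotate {n : ℕ} (t : ℝ) (f : Fin n → ℝ → ℝ) : Fin n → ℝ → ℝ := fun i x =>
  if x < 0 then 0 else f i.rev t - Function.leftLim (f i.rev) (t - x)

/-- `M_t = R_t W R_t`. -/
def lemonUpTo {n : ℕ} (t : ℝ) (f : Fin n → ℝ → ℝ) : Fin n → ℝ → ℝ :=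
  rotate t (melon (rotate t f))

/-- The lemon map `Mf = lim_{t → ∞} R_t W R_t f`. -/
def lemon {n : ℕ} (f : Fin n → ℝ → ℝ) : Fin n → ℝ → ℝ := fun i x =>
  limUnder atTop fun t : ℝ => lemonUpTo t f i x

/-- `𝒟ⁿ_↑`: the `f ∈ 𝒟ⁿ` with `f_{i-1}(y⁻) ≥ f_i(y)` for all lines `i - 1, i` and all `y`. -/
def upSpace (n : ℕ) : Set (Fin n → ℝ → ℝ) :=
  {f | f ∈ cadlagSpace n ∧ ∀ i j : Fin n, j.val = i.val + 1 →
    ∀ y, 0 ≤ y → f j y ≤ Function.leftLim (f i) y}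

/-- `𝒟ⁿ_{↓-}`: the `f ∈ 𝒟ⁿ` such that for every `k = 1, …, n` the `k` lowest constant paths are a
limit of `k`-disjoint optimizers from `(0, n)` to `(s_m, 1)` for some sequence `s_m → ∞`. The limit
is taken in the jump times: the `j`-th path converges to `[0, ∞) × {n - k + j}`, i.e. its jump
times up to the arrival at this line tend to `0`, and those after the arrival tend to `∞`. -/
def downMinusSpace (n : ℕ) : Set (Fin n → ℝ → ℝ) :=
  {f | f ∈ cadlagSpace n ∧ ∀ k : ℕ, 1 ≤ k → k ≤ n →
    ∃ (s : ℕ → ℝ) (t : ℕ → Fin k → Fin (n + 1) → ℝ),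
      Tendsto s atTop atTop ∧
      (∀ m, IsOptimizer f 0 (s m) (t m)) ∧
      ∀ (j : Fin k) (i : Fin (n + 1)),
        (i.val ≤ n - k + j.val → Tendsto (fun m => t m j i) atTop atTop) ∧
        (n - k + j.val < i.val → Tendsto (fun m => t m j i) atTop (𝓝 0))}

/-- `𝒟ⁿ_↓`: the closure of `𝒟ⁿ_{↓-}` in `𝒟ⁿ` in the topology of uniform convergence. -/
def downSpace (n : ℕ) : Set (Fin n → ℝ → ℝ) :=
  {f | f ∈ cadlagSpace n ∧ ∀ ε > 0, ∃ g ∈ downMinusSpace n, ∀ i x, |f i x - g i x| ≤ ε}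

end

end LemonMap

/-! The whole argument rests on multi-point last passage values: `W` preserves them between all
pairs of times, so does `M`, and both maps can be read off from them.

A disjoint tuple is encoded by its interlacing array of jump times (`IsArray`). Its length is a sum
of minus the increments over the gaps between consecutive paths (`arrayLength`). This function is
upper semicontinuous because jumps are positive, so optimizers exist. It is also supermodular for
entrywise minima and maxima of arrays, which gives the quadrangle inequality `lpp_quadrangle`.

Melon: the Pitman transform of two neighbouring lines preserves every last passage value
(`lpp_pitman`), since the jump times between these lines can be re-chosen path by path and the
corrections telescope. Finitely many such transforms sort the lines (`exists_isSorted`). For sorted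
lines the value from time `0` is the sum of the top `k` lines (`IsSorted.lpp_eq`), so the sorted
lines are `Wf`. Hence `W` is an isometry, lands in `upSpace` and is the identity there.

Lemon: rotations carry last passage values to last passage values, so `R_t W R_t` is an isometry as
well. The left limits of `R_t W R_t f` are differences in `k` of `lppLoss`, the value lost by
starting at `x` instead of `0`. By the quadrangle inequality this loss decreases in `t`, with
decrements increasing in `x`; it is bounded below by the value of the `k` lowest constant paths. So
it converges locally uniformly to a Busemann function, and `Mf` exists, has the same last passage
values as `f`, and depends only on them (`lemon_congr`). This yields `MM = M`, `MW = M` and `WM =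
W`.

Image: `Mf = f` exactly when the Busemann functions equal the sums of the lowest lines
(`lemon_eq_self_iff`). This holds on `downMinusSpace`, and on its closure by uniform continuity.
Conversely, a fixed point is perturbed by a small bounded reward for low lines; optimizers are then
forced onto the lowest constant paths (`le_of_isOptimal`), so the perturbation lies in
`downMinusSpace`. The bijection follows from `MW = M`, `WM = W` and the two sets of fixed points. -/

namespace LemonMap

noncomputable section

/-! ### Single lines: cadlag functions with positive jumps -/

section

/-- The property of a single line of an element of `𝒟ⁿ`. -/
structure IsLine (g : ℝ → ℝ) : Prop where
  zero_of_neg : ∀ x < 0, g x = 0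
  right_cont : ∀ x, ContinuousWithinAt g (Ici x) x
  exists_left : ∀ x, ∃ l, Tendsto g (𝓝[<] x) (𝓝 l)
  left_le : ∀ x, Function.leftLim g x ≤ g x

theorem mem_cadlagSpace {n : ℕ} {f : Fin n → ℝ → ℝ} :
    f ∈ cadlagSpace n ↔ ∀ i, IsLine (f i) :=
  ⟨fun h i => ⟨(h i).1, (h i).2.1, (h i).2.2.1, (h i).2.2.2⟩,
    fun h i => ⟨(h i).1, (h i).2, (h i).3, (h i).4⟩⟩

theorem isLine_zero : IsLine fun _ => 0 where
  zero_of_neg _ _ := rfl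
  right_cont _ := continuousWithinAt_const
  exists_left _ := ⟨0, tendsto_const_nhds⟩
  left_le _ := (leftLim_eq_of_tendsto tendsto_const_nhds).le

namespace IsLine

variable {g : ℝ → ℝ}

theorem tendsto_left (hg : IsLine g) (x : ℝ) :
    Tendsto g (𝓝[<] x) (𝓝 (Function.leftLim g x)) :=
  tendsto_leftLim_of_tendsto (hg.exists_left x)

theorem tendsto_right (hg : IsLine g) (x : ℝ) : Tendsto g (𝓝[>] x) (𝓝 (g x)) :=
  (hg.right_cont x).mono_left (nhdsWithin_mono _ Ioi_subset_Ici_self)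

theorem leftLim_tendsto_left (hg : IsLine g) (x : ℝ) :
    Tendsto (Function.leftLim g) (𝓝[<] x) (𝓝 (Function.leftLim g x)) :=
  (continuousWithinAt_leftLim_Iic (hg.tendsto_left x)).mono_left
    (nhdsWithin_mono _ Iio_subset_Iic_self)

theorem leftLim_tendsto_right (hg : IsLine g) (x : ℝ) :
    Tendsto (Function.leftLim g) (𝓝[>] x) (𝓝 (g x)) := by
  rw [tendsto_order]
  have key : ∀ s : Set ℝ, IsClosed s → s ∈ 𝓝 (g x) → ∀ᶠ y in 𝓝[>] x,
      Function.leftLim g y ∈ s := by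
    intro s hs hx
    have h1 : ∀ᶠ y in 𝓝[>] x, g y ∈ s := (hg.tendsto_right x) hx
    obtain ⟨u, hu, hsub⟩ := (mem_nhdsGT_iff_exists_Ioo_subset).1 h1
    filter_upwards [Ioo_mem_nhdsGT hu] with y hy
    refine hs.mem_of_tendsto (hg.tendsto_left y) ?_
    filter_upwards [Ioo_mem_nhdsLT hy.1] with z hz
    exact hsub ⟨hz.1, hz.2.trans hy.2⟩
  constructor
  · intro a ha
    obtain ⟨c, hac, hc⟩ := exists_between ha
    filter_upwards [key (Ici c) isClosed_Ici (Ici_mem_nhds hc)] with y hy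
    exact hac.trans_le hy
  · intro a ha
    obtain ⟨c, hc, hac⟩ := exists_between ha
    filter_upwards [key (Iic c) isClosed_Iic (Iic_mem_nhds hc)] with y hy
    exact lt_of_le_of_lt hy hac

theorem leftLim_of_nonpos (hg : IsLine g) {x : ℝ} (hx : x ≤ 0) : Function.leftLim g x = 0 := by
  refine leftLim_eq_of_tendsto (Tendsto.congr' ?_ tendsto_const_nhds)
  filter_upwards [self_mem_nhdsWithin] with y hy
  exact (hg.zero_of_neg y (lt_of_lt_of_le hy hx)).symm

/-- Right limits of the left limits recover the function. This matters because rotated functions,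
and hence the lemon map, have explicit left limits rather than explicit values. -/
theorem ext_leftLim {h : ℝ → ℝ} (hg : IsLine g) (hh : IsLine h)
    (H : ∀ x, 0 ≤ x → Function.leftLim g x = Function.leftLim h x) : g = h := by
  have H' : Function.leftLim g = Function.leftLim h := by
    funext x
    rcases le_total 0 x with hx | hx
    · exact H x hx
    · rw [hg.leftLim_of_nonpos hx, hh.leftLim_of_nonpos hx]
  funext x
  have h1 := hg.leftLim_tendsto_right x
  rw [H'] at h1
  exact tendsto_nhds_unique h1 (hh.leftLim_tendsto_right x)

/-- Upper semicontinuity: the only other limit value at `x` is the left limit, which is smaller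
because jumps go up. The next lemma is the matching lower semicontinuity of left limits. -/
theorem eventually_lt (hg : IsLine g) {x y : ℝ} (h : g x < y) : ∀ᶠ z in 𝓝 x, g z < y := by
  rw [← nhdsLT_sup_nhdsGE, eventually_sup]
  exact ⟨(hg.tendsto_left x).eventually_lt_const ((hg.left_le x).trans_lt h),
    Tendsto.eventually_lt_const h (hg.right_cont x)⟩

theorem eventually_lt_leftLim (hg : IsLine g) {x y : ℝ} (h : y < Function.leftLim g x) :
    ∀ᶠ z in 𝓝 x, y < Function.leftLim g z := by
  rw [← nhdsLE_sup_nhdsGT, eventually_sup]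
  exact ⟨Tendsto.eventually_const_lt h (continuousWithinAt_leftLim_Iic (hg.tendsto_left x)),
    (hg.leftLim_tendsto_right x).eventually_const_lt (h.trans_le (hg.left_le x))⟩

theorem add {h : ℝ → ℝ} (hg : IsLine g) (hh : IsLine h) : IsLine fun x => g x + h x where
  zero_of_neg x hx := by simp [hg.zero_of_neg x hx, hh.zero_of_neg x hx]
  right_cont x := (hg.right_cont x).add (hh.right_cont x)
  exists_left x := ⟨_, (hg.tendsto_left x).add (hh.tendsto_left x)⟩
  left_le x := by
    rw [leftLim_eq_of_tendsto ((hg.tendsto_left x).add (hh.tendsto_left x))]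
    exact add_le_add (hg.left_le x) (hh.left_le x)

theorem leftLim_add {h : ℝ → ℝ} (hg : IsLine g) (hh : IsLine h) (x : ℝ) :
    Function.leftLim (fun x => g x + h x) x = Function.leftLim g x + Function.leftLim h x :=
  leftLim_eq_of_tendsto ((hg.tendsto_left x).add (hh.tendsto_left x))

/-- An element of `𝒟ⁿ` on a line which is close to another one has close left limits. -/
theorem abs_leftLim_sub_le {h : ℝ → ℝ} (hg : IsLine g) (hh : IsLine h) {ε x : ℝ}
    (H : ∀ y < x, |g y - h y| ≤ ε) : |Function.leftLim g x - Function.leftLim h x| ≤ ε := by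
  refine le_of_tendsto ((hg.tendsto_left x).sub (hh.tendsto_left x)).abs ?_
  filter_upwards [self_mem_nhdsWithin] with y hy using H y hy

end IsLine

/-! ### Gap terms: semicontinuity and supermodularity -/

/-- Minus the increment of `g` over the open interval `(b, a)`. -/
def gapTerm (g : ℝ → ℝ) (b a : ℝ) : ℝ := if b < a then g b - Function.leftLim g a else 0

theorem gapTerm_of_lt {g : ℝ → ℝ} {b a : ℝ} (h : b < a) :
    gapTerm g b a = g b - Function.leftLim g a := if_pos h

theorem gapTerm_of_le {g : ℝ → ℝ} {b a : ℝ} (h : a ≤ b) : gapTerm g b a = 0 := if_neg h.not_gt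

theorem IsLine.gapTerm_le {g : ℝ → ℝ} (hg : IsLine g) {b a : ℝ} (h : b ≤ a) :
    gapTerm g b a ≤ g b - Function.leftLim g a := by
  rcases h.lt_or_eq with h | rfl
  · rw [gapTerm_of_lt h]
  · rw [gapTerm_of_le le_rfl]
    linarith [hg.left_le b]

theorem IsLine.gapTerm_of_neg {g : ℝ → ℝ} (hg : IsLine g) {b a : ℝ} (hb : b < 0) (ha : 0 ≤ a) :
    gapTerm g b a = -Function.leftLim g a := by
  rw [gapTerm_of_lt (by linarith), hg.zero_of_neg b hb]
  simp

/-- Off the diagonal this is semicontinuity of `g` and of its left limits. Near `(u, u)` the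
dangerous limit `g u - g(u⁻) > 0` would need `p.1 ≥ u` and `p.2 ≤ u`, which is impossible when `p.1
< p.2`; for `p.2 ≤ p.1` the term is `0`. -/
theorem IsLine.upperSemicontinuous_gapTerm {g : ℝ → ℝ} (hg : IsLine g) :
    UpperSemicontinuous fun p : ℝ × ℝ => gapTerm g p.1 p.2 := by
  rintro ⟨u, v⟩ y hy
  simp only at hy
  rcases lt_trichotomy u v with huv | rfl | huv
  · rw [gapTerm_of_lt huv] at hy
    set e := (y - (g u - Function.leftLim g v)) / 2 with he
    have he0 : 0 < e := by rw [he]; linarith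
    have h1 : ∀ᶠ z in 𝓝 u, g z < g u + e := hg.eventually_lt (by linarith)
    have h2 : ∀ᶠ z in 𝓝 v, Function.leftLim g v - e < Function.leftLim g z :=
      hg.eventually_lt_leftLim (by linarith)
    have h3 : ∀ᶠ p : ℝ × ℝ in 𝓝 (u, v), p.1 < p.2 :=
      (isOpen_lt continuous_fst continuous_snd).mem_nhds huv
    rw [nhds_prod_eq] at h3 ⊢
    filter_upwards [h3, h1.prod_mk h2] with p hp hp'
    rw [gapTerm_of_lt hp]
    linarith [hp'.1, hp'.2]
  · rw [gapTerm_of_le le_rfl] at hy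
    have h1 := (hg.tendsto_left u).eventually_lt_const
      (show Function.leftLim g u < Function.leftLim g u + y / 2 by linarith)
    have h2 : ∀ᶠ z in 𝓝 u, g z < g u + y / 2 := hg.eventually_lt (by linarith)
    have h3 : ∀ᶠ z in 𝓝 u, Function.leftLim g u - y / 2 < Function.leftLim g z :=
      hg.eventually_lt_leftLim (by linarith)
    have h4 := (hg.leftLim_tendsto_right u).eventually_const_lt
      (show g u - y / 2 < g u by linarith)
    rw [eventually_nhdsWithin_iff] at h1 h4
    rw [nhds_prod_eq]
    filter_upwards [(h1.and h2).prod_mk (h3.and h4)] with p hp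
    obtain ⟨⟨h1, h2⟩, h3, h4⟩ := hp
    rcases lt_or_ge p.1 p.2 with hlt | hge
    · rw [gapTerm_of_lt hlt]
      have hl := hg.left_le u
      rcases lt_or_ge p.1 u with hb | hb
      · have := h1 hb
        linarith
      · have := h4 (lt_of_le_of_lt hb hlt)
        linarith
    · rw [gapTerm_of_le hge]
      exact hy
  · rw [gapTerm_of_le huv.le] at hy
    have h3 : ∀ᶠ p : ℝ × ℝ in 𝓝 (u, v), p.2 < p.1 :=
      (isOpen_lt continuous_snd continuous_fst).mem_nhds huv
    filter_upwards [h3] with p hp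
    rw [gapTerm_of_le hp.le]
    exact hy

/-- Supermodularity of `gapTerm`. -/
theorem IsLine.gapTerm_add_le {g : ℝ → ℝ} (hg : IsLine g) {b a b' a' : ℝ} (h : b ≤ a)
    (h' : b' ≤ a') :
    gapTerm g b a + gapTerm g b' a' ≤
      gapTerm g (min b b') (min a a') + gapTerm g (max b b') (max a a') := by
  have key : ∀ {b a b' a' : ℝ}, b ≤ a → b' ≤ a' → b ≤ b' → gapTerm g b a + gapTerm g b' a' ≤
      gapTerm g (min b b') (min a a') + gapTerm g (max b b') (max a a') := by
    intro b a b' a' h h' hb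
    rw [min_eq_left hb, max_eq_right hb]
    rcases le_total a a' with ha | ha
    · rw [min_eq_left ha, max_eq_right ha]
    · rw [min_eq_right ha, max_eq_left ha]
      rcases hb.eq_or_lt with rfl | hb
      · rw [add_comm]
      rcases ha.eq_or_lt with rfl | ha
      · rfl
      -- Strictly nested intervals: exchanging the right ends preserves the sum of the formulas for
      -- nonempty gaps. Only the inner gap can be degenerate, and then the formula exceeds `gapTerm`
      -- by a positive jump.
      rw [gapTerm_of_lt (g := g) (show b < a by linarith),
        gapTerm_of_lt (g := g) (show b < a' by linarith),
        gapTerm_of_lt (g := g) (show b' < a by linarith)]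
      have := hg.gapTerm_le h'
      linarith
  rcases le_total b b' with hb | hb
  · exact key h h' hb
  · rw [add_comm, min_comm b, min_comm a, max_comm b, max_comm a]
    exact key h' h hb

end

/-! ### The measure of finite unions of intervals -/

section

/-- The right endpoints of the components of a set. -/
def rightEnds (A : Set ℝ) : Set ℝ := {b | b ∈ A ∧ ∀ᶠ z in 𝓝[>] b, z ∉ A}

/-- The left endpoints of the components of a set. -/
def leftEnds (A : Set ℝ) : Set ℝ := {a | a ∈ A ∧ ∀ᶠ z in 𝓝[<] a, z ∉ A}

theorem mass_eq (g : ℝ → ℝ) (A : Set ℝ) :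
    mass g A = (∑ᶠ b ∈ rightEnds A, g b) - ∑ᶠ a ∈ leftEnds A, Function.leftLim g a := rfl

theorem ends_union_of_lt {A : Set ℝ} {c a b : ℝ} (hA : A ⊆ Iic c) (hca : c < a)
    (hab : a ≤ b) :
    rightEnds (A ∪ Icc a b) = insert b (rightEnds A) ∧
      leftEnds (A ∪ Icc a b) = insert a (leftEnds A) := by
  constructor
  · ext x
    simp only [rightEnds, mem_ofPred_eq, mem_union, mem_insert_iff, not_or]
    constructor
    · rintro ⟨hx | hx, h⟩
      · exact Or.inr ⟨hx, h.mono fun z hz => hz.1⟩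
      · left
        by_contra hne
        obtain ⟨z, hz, hz'⟩ :=
          (h.and (Ioo_mem_nhdsGT (lt_of_le_of_ne hx.2 hne))).exists
        exact hz.2 ⟨hx.1.trans hz'.1.le, hz'.2.le⟩
    · rintro (rfl | ⟨hx, h⟩)
      · refine ⟨Or.inr ⟨hab, le_rfl⟩, ?_⟩
        filter_upwards [self_mem_nhdsWithin] with z (hz : x < z)
        refine ⟨fun h => ?_, fun h => absurd h.2 (not_le.2 hz)⟩
        have : z ≤ c := hA h
        linarith
      · refine ⟨Or.inl hx, ?_⟩
        have hxa : x < a := lt_of_le_of_lt (hA hx) hca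
        filter_upwards [h, Ioo_mem_nhdsGT hxa] with z hz hz'
        exact ⟨hz, fun h => absurd h.1 (not_le.2 hz'.2)⟩
  · ext x
    simp only [leftEnds, mem_ofPred_eq, mem_union, mem_insert_iff, not_or]
    constructor
    · rintro ⟨hx | hx, h⟩
      · exact Or.inr ⟨hx, h.mono fun z hz => hz.1⟩
      · left
        by_contra hne
        obtain ⟨z, hz, hz'⟩ :=
          (h.and (Ioo_mem_nhdsLT (lt_of_le_of_ne hx.1 (Ne.symm hne)))).exists
        exact hz.2 ⟨hz'.1.le, hz'.2.le.trans hx.2⟩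
    · rintro (rfl | ⟨hx, h⟩)
      · refine ⟨Or.inr ⟨le_rfl, hab⟩, ?_⟩
        filter_upwards [Ioo_mem_nhdsLT hca] with z hz
        exact ⟨fun h => absurd (hA h) (not_le.2 hz.1), fun h => absurd h.1 (not_le.2 hz.2)⟩
      · refine ⟨Or.inl hx, ?_⟩
        have hxa : x < a := lt_of_le_of_lt (hA hx) hca
        filter_upwards [h, self_mem_nhdsWithin] with z hz (hz' : z < x)
        exact ⟨hz, fun h => absurd h.1 (not_le.2 (hz'.trans hxa))⟩

theorem ends_union_of_eq {A : Set ℝ} {c b : ℝ} (hA : A ⊆ Iic c) (hc : c ∈ A)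
    (hab : c < b) :
    rightEnds (A ∪ Icc c b) = insert b (rightEnds A \ {c}) ∧
      leftEnds (A ∪ Icc c b) = leftEnds A := by
  constructor
  · ext x
    simp only [rightEnds, mem_ofPred_eq, mem_union, mem_insert_iff, not_or, Set.mem_sdiff,
      mem_singleton_iff]
    constructor
    · rintro ⟨hx, h⟩
      by_cases hxb : x = b
      · exact Or.inl hxb
      right
      have hxc : x < c := by
        by_contra hcx
        have hx' : x ∈ Icc c b := by
          rcases hx with hx | hx
          · exact ⟨not_lt.1 hcx, (hA hx).trans hab.le⟩
          · exact hx
        obtain ⟨z, hz, hz'⟩ := (h.and (Ioo_mem_nhdsGT (lt_of_le_of_ne hx'.2 hxb))).exists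
        exact hz.2 ⟨hx'.1.trans hz'.1.le, hz'.2.le⟩
      refine ⟨⟨hx.resolve_right fun h => absurd h.1 (not_le.2 hxc), h.mono fun z hz => hz.1⟩,
        hxc.ne⟩
    · rintro (rfl | ⟨⟨hx, h⟩, hne⟩)
      · refine ⟨Or.inr ⟨hab.le, le_rfl⟩, ?_⟩
        filter_upwards [self_mem_nhdsWithin] with z (hz : x < z)
        exact ⟨fun h => absurd (hA h) (not_le.2 (hab.trans hz)),
          fun h => absurd h.2 (not_le.2 hz)⟩
      · refine ⟨Or.inl hx, ?_⟩
        filter_upwards [h, Ioo_mem_nhdsGT (lt_of_le_of_ne (hA hx) hne)] with z hz hz'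
        exact ⟨hz, fun h => absurd h.1 (not_le.2 hz'.2)⟩
  · ext x
    simp only [leftEnds, mem_ofPred_eq, mem_union, not_or]
    constructor
    · rintro ⟨hx, h⟩
      refine ⟨?_, h.mono fun z hz => hz.1⟩
      rcases hx with hx | hx
      · exact hx
      · rcases hx.1.eq_or_lt with rfl | hlt
        · exact hc
        · obtain ⟨z, hz, hz'⟩ := (h.and (Ioo_mem_nhdsLT hlt)).exists
          exact absurd ⟨hz'.1.le, hz'.2.le.trans hx.2⟩ hz.2
    · rintro ⟨hx, h⟩
      refine ⟨Or.inl hx, ?_⟩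
      filter_upwards [h, self_mem_nhdsWithin] with z hz (hz' : z < x)
      exact ⟨hz, fun h => absurd h.1 (not_le.2 (hz'.trans_le (hA hx)))⟩

/-- A new interval either leaves a gap after `c` or is glued to `A` at `c`. As `gapTerm` vanishes
for an empty gap, one formula covers both cases; finiteness of the end sets is carried along so that
the `finsum`s can be split. -/
theorem mass_union_Icc (g : ℝ → ℝ) {A : Set ℝ} {c a b : ℝ} (hR : (rightEnds A).Finite)
    (hL : (leftEnds A).Finite) (hA : A ⊆ Iic c) (hc : c ∈ A) (hca : c ≤ a) (hab : a ≤ b) :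
    mass g (A ∪ Icc a b) = mass g A - g c + gapTerm g c a + g b ∧
      (rightEnds (A ∪ Icc a b)).Finite ∧ (leftEnds (A ∪ Icc a b)).Finite := by
  rcases hca.lt_or_eq with hlt | rfl
  · obtain ⟨h1, h2⟩ := ends_union_of_lt hA hlt hab
    refine ⟨?_, h1 ▸ hR.insert _, h2 ▸ hL.insert _⟩
    rw [mass_eq, mass_eq, h1, h2, finsum_mem_insert _ _ hR, finsum_mem_insert _ _ hL,
      gapTerm_of_lt hlt]
    · ring
    · exact fun h => absurd (hA h.1) (not_le.2 hlt)
    · exact fun h => absurd (hA h.1) (not_le.2 (hlt.trans_le hab))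
  · rw [gapTerm_of_le le_rfl]
    rcases hab.lt_or_eq with hlt | rfl
    · obtain ⟨h1, h2⟩ := ends_union_of_eq hA hc hlt
      refine ⟨?_, h1 ▸ hR.sdiff.insert _, h2 ▸ hL⟩
      have hcR : c ∈ rightEnds A := by
        refine ⟨hc, ?_⟩
        filter_upwards [self_mem_nhdsWithin] with z (hz : c < z) h
        exact absurd (hA h) (not_le.2 hz)
      have h3 : ∑ᶠ b ∈ rightEnds A, g b = g c + ∑ᶠ b ∈ rightEnds A \ {c}, g b := by
        have hnot : c ∉ rightEnds A \ {c} := fun h => h.2 (mem_singleton c)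
        rw [← finsum_mem_insert _ hnot hR.sdiff, insert_sdiff_singleton, insert_eq_of_mem hcR]
      rw [mass_eq, mass_eq, h1, h2, finsum_mem_insert _ _ hR.sdiff, h3]
      · ring
      · exact fun h => absurd (hA h.1.1) (not_le.2 hlt)
    · have : A ∪ Icc c c = A := by
        rw [Icc_self, union_singleton, insert_eq_of_mem hc]
      rw [this]
      exact ⟨by ring, hR, hL⟩

theorem mass_empty (g : ℝ → ℝ) : mass g ∅ = 0 := by
  simp [mass]

/-- The measure of a finite union of ordered intervals. -/
theorem mass_iUnion_Icc (g : ℝ → ℝ) (a b : ℕ → ℝ) (m : ℕ) (hab : ∀ j ≤ m, a j ≤ b j)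
    (hba : ∀ j < m, b j ≤ a (j + 1)) :
    mass g (⋃ j ≤ m, Icc (a j) (b j)) =
      g (b m) - Function.leftLim g (a 0) + ∑ j ∈ Finset.range m, gapTerm g (b j) (a (j + 1)) := by
  suffices H : mass g (⋃ j ≤ m, Icc (a j) (b j)) =
      g (b m) - Function.leftLim g (a 0) + ∑ j ∈ Finset.range m, gapTerm g (b j) (a (j + 1)) ∧
      (rightEnds (⋃ j ≤ m, Icc (a j) (b j))).Finite ∧
      (leftEnds (⋃ j ≤ m, Icc (a j) (b j))).Finite ∧ (⋃ j ≤ m, Icc (a j) (b j)) ⊆ Iic (b m) from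
    H.1
  induction m with
  | zero =>
    have h : (⋃ j ≤ 0, Icc (a j) (b j)) = Icc (a 0) (b 0) := by simp
    have h0 := hab 0 le_rfl
    have hs : rightEnds (∅ ∪ Icc (a 0) (b 0)) = insert (b 0) (rightEnds ∅) ∧
      leftEnds (∅ ∪ Icc (a 0) (b 0)) = insert (a 0) (leftEnds ∅) :=
      ends_union_of_lt (c := a 0 - 1) (empty_subset _) (by linarith) h0
    rw [empty_union] at hs
    rw [h, mass_Icc g h0, hs.1, hs.2]
    simp [rightEnds, leftEnds, Icc_subset_Iic_self]
  | succ m ih =>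
    obtain ⟨h1, h2, h3, h4⟩ := ih (fun j hj => hab j (by lia)) (fun j hj => hba j (by lia))
    have h : (⋃ j ≤ m + 1, Icc (a j) (b j)) =
        (⋃ j ≤ m, Icc (a j) (b j)) ∪ Icc (a (m + 1)) (b (m + 1)) := by
      simp only [Nat.le_succ_iff, iUnion_or, iUnion_union_distrib, iUnion_iUnion_eq_left]
    have hab' := hab (m + 1) le_rfl
    have hba' := hba m (by lia)
    have hmem : b m ∈ ⋃ j ≤ m, Icc (a j) (b j) :=
      mem_iUnion₂.2 ⟨m, le_rfl, hab m (by lia), le_rfl⟩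
    obtain ⟨h5, h6, h7⟩ := mass_union_Icc g h2 h3 h4 hmem hba' hab'
    rw [h, h5, h1, Finset.sum_range_succ]
    refine ⟨by ring, h6, h7, union_subset (h4.trans (Iic_subset_Iic.2 (hba'.trans hab')))
      Icc_subset_Iic_self⟩

/-! ### Disjoint tuples of paths as interlacing arrays -/

/-- Arrays of jump times of disjoint `k`-tuples of paths on `n` lines from time `x` to time `y`,
indexed by `j = 1, …, k` and padded by constant rows `-1` and `Y` for `j = 0` and `j = k + 1`. -/
structure IsArray (n k : ℕ) (x y Y : ℝ) (T : ℕ → ℕ → ℝ) : Prop where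
  bot : ∀ i ≤ n, T 0 i = -1
  top : ∀ i ≤ n, T (k + 1) i = Y
  start : ∀ j < k, T (j + 1) n = x
  finish : ∀ j < k, T (j + 1) 0 = y
  anti : ∀ j < k, ∀ i < n, T (j + 1) (i + 1) ≤ T (j + 1) i
  interlace : ∀ j ≤ k, ∀ i < n, T j i ≤ T (j + 1) (i + 1)

/-- The length of the tuple of paths with a given padded array of jump times. -/
def arrayLength (F : ℕ → ℝ → ℝ) (n k : ℕ) (Y : ℝ) (T : ℕ → ℕ → ℝ) : ℝ :=
  ∑ i ∈ Finset.range n, (∑ j ∈ Finset.range (k + 1), gapTerm (F i) (T j i) (T (j + 1) (i + 1)) +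
    Function.leftLim (F i) Y)

/-- The padded array of a tuple of paths. -/
def pad {n k : ℕ} (Y : ℝ) (t : Fin k → Fin (n + 1) → ℝ) (j i : ℕ) : ℝ :=
  if j = 0 then -1 else if h : j - 1 < k ∧ i < n + 1 then t ⟨j - 1, h.1⟩ ⟨i, h.2⟩ else Y

section pad

variable {n k : ℕ} {Y : ℝ} {t : Fin k → Fin (n + 1) → ℝ}

theorem pad_zero (i : ℕ) : pad Y t 0 i = -1 := if_pos rfl

theorem pad_succ {j i : ℕ} (hj : j < k) (hi : i < n + 1) :
    pad Y t (j + 1) i = t ⟨j, hj⟩ ⟨i, hi⟩ := by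
  simp [pad, hj, hi]

theorem pad_top (i : ℕ) : pad Y t (k + 1) i = Y := by
  simp [pad]

end pad

/-- Being to the left orders the jump times of different paths; finiteness of intersections
strengthens this to interlacing, that is, each path leaves a line before the next one enters it. -/
theorem IsDisjointTuple.pad {n k : ℕ} {x y Y : ℝ} {t : Fin k → Fin (n + 1) → ℝ}
    (ht : IsDisjointTuple x y t) (hx : 0 ≤ x) (hy : y < Y) (hY : 0 ≤ Y) :
    IsArray n k x y Y (pad Y t) := by
  obtain ⟨hp, hl, hf⟩ := ht
  have hge : ∀ j i, x ≤ t j i := fun j i => by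
    rw [← (hp j).2.1]; exact (hp j).1 (Fin.le_last i)
  have hle : ∀ j i, t j i ≤ y := fun j i => by
    rw [← (hp j).2.2]; exact (hp j).1 (Fin.zero_le i)
  have hmono : ∀ j j', j < j' → ∀ i, t j i ≤ t j' i := by
    intro j j' hj i
    rcases Fin.eq_zero_or_eq_succ i with rfl | ⟨m, rfl⟩
    · rw [(hp j).2.2, (hp j').2.2]
    · rcases Fin.eq_castSucc_or_eq_last m.succ with ⟨m', hm'⟩ | hm'
      -- The two points compared are the moments of the same jump, seen on the lower line for the
      -- left path and on the upper line for the right one. The line alternative then fails, so the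
      -- times are ordered.
      · rcases hl j j' hj (t j m.succ, m')
            ⟨(hp j).1 (by rw [hm']; exact Fin.castSucc_le_succ m'), by rw [hm']⟩
            (t j' m.succ, m) ⟨le_rfl, (hp j').1 (Fin.castSucc_le_succ m)⟩ with h | h
        · exfalso
          have h1 : m'.val = m.val + 1 := by
            have := congrArg Fin.val hm'
            simpa using this.symm
          have h2 : m'.val ≤ m.val := h
          lia
        · exact h
      · rw [hm', (hp j).2.1, (hp j').2.1]
  refine ⟨fun i _ => pad_zero i, fun i _ => pad_top i, ?_, ?_, ?_, ?_⟩
  · intro j hj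
    rw [pad_succ hj (Nat.lt_succ_self n)]
    exact (hp ⟨j, hj⟩).2.1
  · intro j hj
    rw [pad_succ hj (Nat.succ_pos n)]
    exact (hp ⟨j, hj⟩).2.2
  · intro j hj i hi
    rw [pad_succ hj (by lia), pad_succ hj (by lia)]
    exact (hp ⟨j, hj⟩).1 (Fin.mk_le_mk.2 (Nat.le_succ i))
  · intro j hj i hi
    rcases j with _ | j
    · rw [pad_zero]
      rcases Nat.eq_zero_or_pos k with rfl | hk
      · rw [pad_top]; linarith
      · rw [pad_succ hk (by lia)]
        linarith [hge ⟨0, hk⟩ ⟨i + 1, by lia⟩]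
    · rw [pad_succ (show j < k by lia) (by lia)]
      rcases hj.lt_or_eq with hj' | hj'
      · rw [pad_succ hj' (by lia)]
        set s := t ⟨j, by lia⟩ with hs
        set s' := t ⟨j + 1, hj'⟩ with hs'
        by_contra hlt
        rw [not_le] at hlt
        have hjj : (⟨j, by lia⟩ : Fin k) < ⟨j + 1, hj'⟩ := Fin.mk_lt_mk.2 (Nat.lt_succ_self j)
        have h1 := hmono _ _ hjj ⟨i, by lia⟩
        have h2 := hmono _ _ hjj ⟨i + 1, by lia⟩
        -- If interlacing failed, both paths would contain a whole open interval of line `i`.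
        refine ((Ioo_infinite hlt).image (f := fun z => (z, (⟨i, hi⟩ : Fin n)))
          (fun a _ b _ h => (Prod.ext_iff.1 h).1)) ((hf _ _ hjj.ne).subset ?_)
        rintro _ ⟨z, hz, rfl⟩
        exact ⟨⟨h2.trans hz.1.le, hz.2.le⟩, ⟨hz.1.le, hz.2.le.trans h1⟩⟩
      · subst hj'
        rw [pad_top]
        linarith [hle ⟨j, by lia⟩ ⟨i, by lia⟩]

namespace IsArray

variable {n k : ℕ} {x y Y : ℝ} {T : ℕ → ℕ → ℝ}

theorem anti_le (hT : IsArray n k x y Y T) {j i i' : ℕ} (hj : j < k) (h : i ≤ i') (hi : i' ≤ n) :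
    T (j + 1) i' ≤ T (j + 1) i := by
  induction i', h using Nat.le_induction with
  | base => exact le_rfl
  | succ m hm ih => exact (hT.anti j hj m (by lia)).trans (ih (by lia))

theorem mono_succ (hT : IsArray n k x y Y T) {j i : ℕ} (hj : j + 1 < k) (hi : i ≤ n) :
    T (j + 1) i ≤ T (j + 2) i := by
  rcases hi.lt_or_eq with hi | rfl
  · exact (hT.interlace (j + 1) (by lia) i hi).trans (hT.anti (j + 1) hj i hi)
  · rw [hT.start j (by lia), hT.start (j + 1) hj]

theorem mono (hT : IsArray n k x y Y T) {j j' i : ℕ} (h : j ≤ j') (hj : j' < k) (hi : i ≤ n) :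
    T (j + 1) i ≤ T (j' + 1) i := by
  induction j', h using Nat.le_induction with
  | base => exact le_rfl
  | succ m hm ih => exact (ih (by lia)).trans (hT.mono_succ hj hi)

theorem start_le (hT : IsArray n k x y Y T) {j i : ℕ} (hj : j < k) (hi : i ≤ n) :
    x ≤ T (j + 1) i := by
  rw [← hT.start j hj]; exact hT.anti_le hj hi le_rfl

theorem le_finish (hT : IsArray n k x y Y T) {j i : ℕ} (hj : j < k) (hi : i ≤ n) :
    T (j + 1) i ≤ y := by
  rw [← hT.finish j hj]; exact hT.anti_le hj (Nat.zero_le i) hi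

/-- Interlacing and monotonicity in the row leave at most one common point of two paths on each
line, namely the exit time of the left path. -/
theorem isDisjointTuple (hT : IsArray n k x y Y T) :
    IsDisjointTuple x y fun (j : Fin k) (i : Fin (n + 1)) => T (j + 1) i := by
  refine ⟨fun j => ⟨fun i i' h => hT.anti_le j.2 h (by lia), hT.start j j.2, hT.finish j j.2⟩,
    ?_, ?_⟩
  · intro j j' hj p hp q hq
    by_cases h : p.2 ≤ q.2
    · exact Or.inl h
    · right
      rw [not_le] at h
      have h' : q.2.val + 1 ≤ p.2.val := h
      calc p.1 ≤ T (j + 1) p.2 := hp.2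
        _ ≤ T (j + 1) (q.2 + 1) := hT.anti_le j.2 h' (by lia)
        _ ≤ T (j' + 1) (q.2 + 1) := hT.mono hj.le j'.2 (by lia)
        _ ≤ q.1 := hq.1
  · have key : ∀ j j' : Fin k, j < j' →
        (pathSet (fun i : Fin (n + 1) => T (j + 1) i) ∩
          pathSet (fun i : Fin (n + 1) => T (j' + 1) i)).Finite := by
      intro j j' hj
      refine (finite_range fun i : Fin n => (T (j + 1) i, i)).subset ?_
      rintro ⟨z, i⟩ ⟨hz, hz'⟩
      refine ⟨i, Prod.ext ?_ rfl⟩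
      have h1 : z ≤ T (j + 1) i := hz.2
      have h2 : T (j' + 1) (i + 1) ≤ z := hz'.1
      have h3 := hT.interlace (j + 1) j.2 i i.2
      have hj' : j.val + 1 ≤ j'.val := hj
      have h4 := hT.mono hj' j'.2 (show i.val + 1 ≤ n from i.2)
      exact le_antisymm (h3.trans (h4.trans h2)) h1
    intro j j' hne
    rcases lt_or_gt_of_ne hne with h | h
    · exact key j j' h
    · rw [inter_comm]; exact key j' j h

end IsArray

theorem arrayLength_congr (F : ℕ → ℝ → ℝ) {n k : ℕ} (Y : ℝ) {T T' : ℕ → ℕ → ℝ}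
    (h : ∀ j ≤ k + 1, ∀ i ≤ n, T j i = T' j i) :
    arrayLength F n k Y T = arrayLength F n k Y T' := by
  refine Finset.sum_congr rfl fun i hi => ?_
  congr 1
  refine Finset.sum_congr rfl fun j hj => ?_
  rw [Finset.mem_range] at hi hj
  rw [h j (by lia) i (by lia), h (j + 1) (by lia) (i + 1) (by lia)]

/-- The length of a disjoint tuple of paths, in terms of its padded array. -/
theorem tupleLength_eq {F : ℕ → ℝ → ℝ} (hF : ∀ i, IsLine (F i)) {n k : ℕ} {x y Y : ℝ}
    {t : Fin k → Fin (n + 1) → ℝ} (ht : IsDisjointTuple x y t) (hx : 0 ≤ x) (hxy : x ≤ y)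
    (hy : y < Y) :
    tupleLength (fun i : Fin n => F i) t = arrayLength F n k Y (pad Y t) := by
  have hT := ht.pad hx hy (by linarith)
  unfold tupleLength measureOf arrayLength
  rw [← Fin.sum_univ_eq_sum_range (fun i => ∑ j ∈ Finset.range (k + 1),
    gapTerm (F i) (LemonMap.pad Y t j i) (LemonMap.pad Y t (j + 1) (i + 1)) +
      Function.leftLim (F i) Y)]
  refine Finset.sum_congr rfl fun i _ => ?_
  rcases k with _ | k
  · have : {x | (x, i) ∈ ⋃ j : Fin 0, pathSet (t j)} = ∅ := by ext; simp
    rw [this, mass_empty]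
    simp [pad_zero, pad_top, (hF i).gapTerm_of_neg (show (-1 : ℝ) < 0 by norm_num)
      (show 0 ≤ Y by linarith)]
  · have hset : {x | (x, i) ∈ ⋃ j : Fin (k + 1), pathSet (t j)} = ⋃ j ≤ k,
        Icc (LemonMap.pad Y t (j + 1) (i + 1)) (LemonMap.pad Y t (j + 1) i) := by
      ext z
      simp only [mem_ofPred_eq, mem_iUnion, pathSet]
      constructor
      · rintro ⟨j, hj⟩
        refine ⟨j, by lia, ?_⟩
        rw [pad_succ j.2 (by lia), pad_succ j.2 (by lia)]
        exact hj
      · rintro ⟨j, hj, hz⟩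
        rw [pad_succ (by lia) (by lia), pad_succ (by lia) (by lia)] at hz
        exact ⟨⟨j, by lia⟩, hz⟩
    rw [hset, mass_iUnion_Icc (F i) (fun j => LemonMap.pad Y t (j + 1) (i + 1))
      (fun j => LemonMap.pad Y t (j + 1) i) k (fun j hj => hT.anti j (by lia) i i.2)
      (fun j hj => hT.interlace (j + 1) (by lia) i i.2)]
    -- The row `-1` turns the left end of the first interval into a gap, as lines vanish there. The
    -- row `Y` does so for the last right end, at the price of the left limit at `Y` added in
    -- `arrayLength`.
    rw [Finset.sum_range_succ, Finset.sum_range_succ', pad_zero, pad_top,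
      (hF i).gapTerm_of_neg (by norm_num), gapTerm_of_lt (b := LemonMap.pad Y t (k + 1) i)]
    · simp only [zero_add]
      ring
    · exact (hT.le_finish (Nat.lt_succ_self k) i.2.le).trans_lt hy
    · exact hx.trans (hT.start_le (Nat.succ_pos k) i.2)

end

/-! ### Compactness and existence of optimizers -/

section

theorem isArray_iff {n k : ℕ} {x y Y : ℝ} {T : ℕ → ℕ → ℝ} :
    IsArray n k x y Y T ↔ (∀ i ≤ n, T 0 i = -1) ∧ (∀ i ≤ n, T (k + 1) i = Y) ∧
      (∀ j < k, T (j + 1) n = x) ∧ (∀ j < k, T (j + 1) 0 = y) ∧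
      (∀ j < k, ∀ i < n, T (j + 1) (i + 1) ≤ T (j + 1) i) ∧
      ∀ j ≤ k, ∀ i < n, T j i ≤ T (j + 1) (i + 1) :=
  ⟨fun h => ⟨h.1, h.2, h.3, h.4, h.5, h.6⟩, fun h => ⟨h.1, h.2.1, h.2.2.1, h.2.2.2.1,
    h.2.2.2.2.1, h.2.2.2.2.2⟩⟩

theorem continuous_pad {n k : ℕ} (Y : ℝ) (j i : ℕ) :
    Continuous fun t : Fin k → Fin (n + 1) → ℝ => pad Y t j i := by
  unfold pad
  split_ifs with h h'
  · exact continuous_const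
  · exact continuous_apply_apply _ _
  · exact continuous_const

theorem isClosed_isArray (n k : ℕ) (x y Y : ℝ) :
    IsClosed {t : Fin k → Fin (n + 1) → ℝ | IsArray n k x y Y (pad Y t)} := by
  simp only [isArray_iff, ofPred_and, ofPred_forall]
  refine IsClosed.inter ?_ (IsClosed.inter ?_ (IsClosed.inter ?_ (IsClosed.inter ?_
    (IsClosed.inter ?_ ?_))))
  · exact isClosed_biInter fun i _ => isClosed_eq (continuous_pad _ _ _) continuous_const
  · exact isClosed_biInter fun i _ => isClosed_eq (continuous_pad _ _ _) continuous_const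
  · exact isClosed_biInter fun i _ => isClosed_eq (continuous_pad _ _ _) continuous_const
  · exact isClosed_biInter fun i _ => isClosed_eq (continuous_pad _ _ _) continuous_const
  · exact isClosed_biInter fun i _ => isClosed_biInter fun i _ =>
      isClosed_le (continuous_pad _ _ _) (continuous_pad _ _ _)
  · exact isClosed_biInter fun i _ => isClosed_biInter fun i _ =>
      isClosed_le (continuous_pad _ _ _) (continuous_pad _ _ _)

theorem isDisjointTuple_iff {n k : ℕ} {x y Y : ℝ} {t : Fin k → Fin (n + 1) → ℝ}
    (hx : 0 ≤ x) (hxy : x ≤ y) (hy : y < Y) :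
    IsDisjointTuple x y t ↔ IsArray n k x y Y (pad Y t) := by
  refine ⟨fun h => h.pad hx hy (by linarith), fun h => ?_⟩
  have : (fun (j : Fin k) (i : Fin (n + 1)) => pad Y t (j + 1) i) = t := by
    funext j i
    exact pad_succ j.2 i.2
  rw [← this]
  exact h.isDisjointTuple

theorem isCompact_isDisjointTuple (n k : ℕ) {x y : ℝ} (hx : 0 ≤ x) (hxy : x ≤ y) :
    IsCompact {t : Fin k → Fin (n + 1) → ℝ | IsDisjointTuple x y t} := by
  have hset : {t : Fin k → Fin (n + 1) → ℝ | IsDisjointTuple x y t} =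
      {t | IsArray n k x y (y + 1) (pad (y + 1) t)} := by
    ext t
    exact isDisjointTuple_iff hx hxy (lt_add_one y)
  refine (isCompact_Icc (a := fun _ _ => x) (b := fun _ _ => y)).of_isClosed_subset
    (hset ▸ isClosed_isArray n k x y (y + 1)) ?_
  intro t ht
  exact ⟨fun j i => by rw [← (ht.1 j).2.1]; exact (ht.1 j).1 (Fin.le_last i),
    fun j i => by rw [← (ht.1 j).2.2]; exact (ht.1 j).1 (Fin.zero_le i)⟩

theorem upperSemicontinuous_arrayLength_pad {F : ℕ → ℝ → ℝ} (hF : ∀ i, IsLine (F i)) (n k : ℕ)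
    (Y : ℝ) : UpperSemicontinuous fun t : Fin k → Fin (n + 1) → ℝ =>
      arrayLength F n k Y (pad Y t) := by
  unfold arrayLength
  refine upperSemicontinuous_sum fun i _ => UpperSemicontinuous.add
    (upperSemicontinuous_sum fun j _ => ?_) upperSemicontinuous_const
  exact (hF i).upperSemicontinuous_gapTerm.comp
    ((continuous_pad Y j i).prodMk (continuous_pad Y (j + 1) (i + 1)))

/-- The paths which jump immediately. -/
def topArray (k : ℕ) (x y Y : ℝ) (j i : ℕ) : ℝ :=
  if j = 0 then -1 else if k < j then Y else if i < j then y else x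

theorem isArray_topArray {n k : ℕ} {x y Y : ℝ} (hk : k ≤ n) (hx : 0 ≤ x) (hxy : x ≤ y)
    (hy : y < Y) : IsArray n k x y Y (topArray k x y Y) := by
  refine ⟨fun i _ => by simp [topArray], fun i _ => by simp [topArray], fun j hj => ?_,
    fun j hj => ?_, fun j hj i hi => ?_, fun j hj i hi => ?_⟩
  · simp [topArray, show ¬ k < j + 1 by lia, show ¬ n < j + 1 by lia]
  · simp [topArray, show ¬ k < j + 1 by lia]
  · simp only [topArray]
    split_ifs <;> first | lia | linarith
  · simp only [topArray]
    split_ifs <;> first | lia | linarith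

theorem exists_isDisjointTuple {n k : ℕ} {x y : ℝ} (hk : k ≤ n) (hx : 0 ≤ x) (hxy : x ≤ y) :
    ∃ t : Fin k → Fin (n + 1) → ℝ, IsDisjointTuple x y t :=
  ⟨_, (isArray_topArray hk hx hxy (lt_add_one y)).isDisjointTuple⟩

/-- The multi-point last passage value of the first `n` lines of a sequence of functions. -/
def lpp (F : ℕ → ℝ → ℝ) (n k : ℕ) (x y : ℝ) : ℝ :=
  multiLastPassage (fun i : Fin n => F i) k x y

variable {F : ℕ → ℝ → ℝ} {n k : ℕ} {x y Y : ℝ}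

/-- Optimizers exist. -/
theorem exists_isOptimizer (hF : ∀ i, IsLine (F i)) (hk : k ≤ n) (hx : 0 ≤ x) (hxy : x ≤ y) :
    ∃ t : Fin k → Fin (n + 1) → ℝ, IsOptimizer (fun i : Fin n => F i) x y t := by
  obtain ⟨t, ht, hmax⟩ := UpperSemicontinuousOn.exists_isMaxOn
    (exists_isDisjointTuple hk hx hxy) (isCompact_isDisjointTuple n k hx hxy)
    ((upperSemicontinuous_arrayLength_pad hF n k (y + 1)).upperSemicontinuousOn _)
  refine ⟨t, ht, ?_⟩
  symm
  refine IsGreatest.csSup_eq ⟨⟨t, ht, rfl⟩, ?_⟩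
  rintro _ ⟨s, hs, rfl⟩
  rw [tupleLength_eq hF hs hx hxy (lt_add_one y), tupleLength_eq hF ht hx hxy (lt_add_one y)]
  exact hmax hs

theorem tupleLength_le_lpp (hF : ∀ i, IsLine (F i)) (hk : k ≤ n) (hx : 0 ≤ x) (hxy : x ≤ y)
    {t : Fin k → Fin (n + 1) → ℝ} (ht : IsDisjointTuple x y t) :
    tupleLength (fun i : Fin n => F i) t ≤ lpp F n k x y := by
  obtain ⟨s, hs, hmax⟩ := UpperSemicontinuousOn.exists_isMaxOn
    (exists_isDisjointTuple hk hx hxy) (isCompact_isDisjointTuple n k hx hxy)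
    ((upperSemicontinuous_arrayLength_pad hF n k (y + 1)).upperSemicontinuousOn _)
  refine le_csSup ⟨tupleLength (fun i : Fin n => F i) s, ?_⟩ ⟨t, ht, rfl⟩
  rintro _ ⟨r, hr, rfl⟩
  rw [tupleLength_eq hF hr hx hxy (lt_add_one y), tupleLength_eq hF hs hx hxy (lt_add_one y)]
  exact hmax hr

/-- Together with `exists_isArray` this replaces the supremum over tuples by a maximum over arrays;
all later estimates of `lpp` are made by exhibiting arrays. The value of `Y` beyond `y` is
irrelevant. -/
theorem IsArray.length_le_lpp {T : ℕ → ℕ → ℝ} (hT : IsArray n k x y Y T)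
    (hF : ∀ i, IsLine (F i)) (hk : k ≤ n) (hx : 0 ≤ x) (hxy : x ≤ y) (hy : y < Y) :
    arrayLength F n k Y T ≤ lpp F n k x y := by
  have h := tupleLength_le_lpp hF hk hx hxy hT.isDisjointTuple
  rw [tupleLength_eq hF hT.isDisjointTuple hx hxy hy] at h
  refine (arrayLength_congr F Y fun j hj i hi => ?_).trans_le h
  rcases j with _ | j
  · rw [hT.bot i hi, pad_zero]
  · rcases (show j < k ∨ j = k by lia) with hj | rfl
    · rw [pad_succ hj (by lia)]
    · rw [hT.top i hi, pad_top]

theorem exists_isArray (hF : ∀ i, IsLine (F i)) (hk : k ≤ n) (hx : 0 ≤ x) (hxy : x ≤ y)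
    (hy : y < Y) : ∃ T, IsArray n k x y Y T ∧ arrayLength F n k Y T = lpp F n k x y := by
  obtain ⟨t, ht, h⟩ := exists_isOptimizer hF hk hx hxy
  exact ⟨pad Y t, ht.pad hx hy (by linarith), by rw [← tupleLength_eq hF ht hx hxy hy, h, lpp]⟩

theorem multiLastPassage_zero {n : ℕ} (f : Fin n → ℝ → ℝ) (x y : ℝ) :
    multiLastPassage f 0 x y = 0 := by
  refine IsGreatest.csSup_eq ⟨⟨fun j => j.elim0, ⟨fun j => j.elim0, fun j => j.elim0,
    fun j => j.elim0⟩, ?_⟩, ?_⟩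
  · simp [tupleLength, measureOf, mass_empty]
  · rintro _ ⟨t, -, rfl⟩
    simp [tupleLength, measureOf, mass_empty]

theorem lastPassage_eq {n : ℕ} (f : Fin n → ℝ → ℝ) (x y : ℝ) :
    lastPassage f x y = multiLastPassage f 1 x y := by
  unfold lastPassage multiLastPassage
  congr 1
  ext r
  constructor
  · rintro ⟨t, ht, rfl⟩
    refine ⟨fun _ => t, ⟨fun _ => ht, fun i j h => absurd h (by lia), fun i j h =>
      absurd (Subsingleton.elim i j) h⟩, ?_⟩
    simp [tupleLength, iUnion_const]
  · rintro ⟨t, ht, rfl⟩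
    refine ⟨t 0, ht.1 0, ?_⟩
    have h : (⋃ j, pathSet (t j)) = pathSet (t 0) := by
      ext p
      simp [Fin.exists_fin_one]
    rw [tupleLength, h]

end

/-! ### The Pitman transform of two lines -/

section

theorem gapTerm_add {g h : ℝ → ℝ} (hg : IsLine g) (hh : IsLine h) (b a : ℝ) :
    gapTerm (fun x => g x + h x) b a = gapTerm g b a + gapTerm h b a := by
  unfold gapTerm
  split_ifs
  · rw [hg.leftLim_add hh]; ring
  · simp

/-- The running maximum `sup_{0 ≤ t ≤ y} f₂(t) - f₁(t⁻)`. -/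
def runMax (f₁ f₂ : ℝ → ℝ) (y : ℝ) : ℝ :=
  if y < 0 then 0 else sSup ((fun t => f₂ t - Function.leftLim f₁ t) '' Icc 0 y)

section runMax

variable {f₁ f₂ : ℝ → ℝ}

theorem eventually_sub_leftLim_lt (h₁ : IsLine f₁) (h₂ : IsLine f₂) {t y : ℝ}
    (h : f₂ t - Function.leftLim f₁ t < y) : ∀ᶠ s in 𝓝 t, f₂ s - Function.leftLim f₁ s < y := by
  set e := (y - (f₂ t - Function.leftLim f₁ t)) / 2 with he
  have he0 : 0 < e := by rw [he]; linarith
  filter_upwards [h₂.eventually_lt (show f₂ t < f₂ t + e by linarith),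
    h₁.eventually_lt_leftLim (show Function.leftLim f₁ t - e < _ by linarith)] with s hs hs'
  linarith

/-- The function being maximized is upper semicontinuous because both lines jump upwards, so the
supremum over a compact interval is attained. -/
theorem exists_eq_runMax (h₁ : IsLine f₁) (h₂ : IsLine f₂) {y : ℝ} (hy : 0 ≤ y) :
    ∃ s, 0 ≤ s ∧ s ≤ y ∧ f₂ s - Function.leftLim f₁ s = runMax f₁ f₂ y ∧
      ∀ r, 0 ≤ r → r ≤ y → f₂ r - Function.leftLim f₁ r ≤ runMax f₁ f₂ y := by
  have husc : UpperSemicontinuous fun t => f₂ t - Function.leftLim f₁ t :=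
    fun t y h => eventually_sub_leftLim_lt h₁ h₂ h
  obtain ⟨s, hs, hmax⟩ := UpperSemicontinuousOn.exists_isMaxOn (nonempty_Icc.2 hy)
    isCompact_Icc (husc.upperSemicontinuousOn _)
  have h : runMax f₁ f₂ y = f₂ s - Function.leftLim f₁ s := by
    rw [runMax, if_neg hy.not_gt]
    refine IsGreatest.csSup_eq ⟨⟨s, hs, rfl⟩, ?_⟩
    rintro _ ⟨r, hr, rfl⟩
    exact hmax hr
  refine ⟨s, hs.1, hs.2, h.symm, fun r hr hr' => ?_⟩
  rw [h]
  exact hmax ⟨hr, hr'⟩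

theorem runMax_of_neg {y : ℝ} (hy : y < 0) : runMax f₁ f₂ y = 0 := if_pos hy

theorem sub_leftLim_le_runMax (h₁ : IsLine f₁) (h₂ : IsLine f₂) {s y : ℝ} (hs : 0 ≤ s)
    (hsy : s ≤ y) : f₂ s - Function.leftLim f₁ s ≤ runMax f₁ f₂ y := by
  obtain ⟨_, _, _, _, h⟩ := exists_eq_runMax h₁ h₂ (hs.trans hsy)
  exact h s hs hsy

theorem runMax_nonneg (h₁ : IsLine f₁) (h₂ : IsLine f₂) (y : ℝ) : 0 ≤ runMax f₁ f₂ y := by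
  rcases lt_or_ge y 0 with hy | hy
  · rw [runMax_of_neg hy]
  · refine le_trans ?_ (sub_leftLim_le_runMax h₁ h₂ le_rfl hy)
    have := h₂.left_le 0
    rw [h₂.leftLim_of_nonpos le_rfl] at this
    rw [h₁.leftLim_of_nonpos le_rfl]
    linarith

theorem runMax_le (h₁ : IsLine f₁) (h₂ : IsLine f₂) {y c : ℝ} (hc : 0 ≤ c)
    (h : ∀ s, 0 ≤ s → s ≤ y → f₂ s - Function.leftLim f₁ s ≤ c) : runMax f₁ f₂ y ≤ c := by
  rcases lt_or_ge y 0 with hy | hy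
  · rwa [runMax_of_neg hy]
  · obtain ⟨s, hs, hs', he, -⟩ := exists_eq_runMax h₁ h₂ hy
    rw [← he]
    exact h s hs hs'

theorem monotone_runMax (h₁ : IsLine f₁) (h₂ : IsLine f₂) : Monotone (runMax f₁ f₂) :=
  fun _ _ hxy => runMax_le h₁ h₂ (runMax_nonneg h₁ h₂ _)
    fun _ hs hs' => sub_leftLim_le_runMax h₁ h₂ hs (hs'.trans hxy)

theorem isLine_runMax (h₁ : IsLine f₁) (h₂ : IsLine f₂) : IsLine (runMax f₁ f₂) where
  zero_of_neg _ hx := runMax_of_neg hx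
  right_cont x := by
    have hm := monotone_runMax h₁ h₂
    refine tendsto_order.2 ⟨fun a ha => ?_, fun a ha => ?_⟩
    · filter_upwards [self_mem_nhdsWithin] with y hy using ha.trans_le (hm hy)
    · rcases lt_or_ge x 0 with hx | hx
      · filter_upwards [mem_nhdsWithin_of_mem_nhds (Iio_mem_nhds hx)] with y hy
        rw [runMax_of_neg hx] at ha
        rwa [runMax_of_neg hy]
      · obtain ⟨c, hc, hca⟩ := exists_between ha
        have h := eventually_sub_leftLim_lt h₁ h₂
          ((sub_leftLim_le_runMax h₁ h₂ hx le_rfl).trans_lt hc)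
        obtain ⟨δ, hδ, hball⟩ := Metric.eventually_nhds_iff.1 h
        filter_upwards [mem_nhdsWithin_of_mem_nhds (Metric.ball_mem_nhds x hδ),
          self_mem_nhdsWithin] with y hy hxy
        refine lt_of_le_of_lt (runMax_le h₁ h₂ ((runMax_nonneg h₁ h₂ x).trans hc.le) ?_) hca
        intro s hs hsy
        rcases le_total s x with hsx | hsx
        · exact (sub_leftLim_le_runMax h₁ h₂ hs hsx).trans hc.le
        · refine (hball ?_).le
          rw [Metric.mem_ball, Real.dist_eq] at hy
          rw [Real.dist_eq, abs_of_nonneg (by linarith)]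
          have := le_abs_self (y - x)
          linarith
  exists_left x := ⟨_, (monotone_runMax h₁ h₂).tendsto_leftLim x⟩
  left_le x := (monotone_runMax h₁ h₂).leftLim_le le_rfl

theorem leftLim_sub_leftLim_le (h₁ : IsLine f₁) (h₂ : IsLine f₂) (t : ℝ) :
    Function.leftLim f₂ t - Function.leftLim f₁ t ≤ Function.leftLim (runMax f₁ f₂) t := by
  rcases le_or_gt t 0 with ht | ht
  · rw [h₁.leftLim_of_nonpos ht, h₂.leftLim_of_nonpos ht,
      (isLine_runMax h₁ h₂).leftLim_of_nonpos ht, sub_zero]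
  · refine le_of_tendsto ((h₂.tendsto_left t).sub (h₁.leftLim_tendsto_left t)) ?_
    filter_upwards [Ioo_mem_nhdsLT ht] with s hs
    exact (sub_leftLim_le_runMax h₁ h₂ hs.1.le le_rfl).trans
      ((monotone_runMax h₁ h₂).le_leftLim hs.2)

theorem sub_le_runMax (h₁ : IsLine f₁) (h₂ : IsLine f₂) {t : ℝ} (ht : 0 ≤ t) :
    f₂ t - f₁ t ≤ runMax f₁ f₂ t := by
  have := sub_leftLim_le_runMax h₁ h₂ ht le_rfl
  have := h₁.left_le t
  linarith

theorem runMax_eq_or (h₁ : IsLine f₁) (h₂ : IsLine f₂) (t : ℝ) :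
    runMax f₁ f₂ t = Function.leftLim (runMax f₁ f₂) t ∨
      runMax f₁ f₂ t = f₂ t - Function.leftLim f₁ t := by
  rcases lt_or_ge t 0 with ht | ht
  · left
    rw [runMax_of_neg ht, (isLine_runMax h₁ h₂).leftLim_of_nonpos ht.le]
  · obtain ⟨s, hs, hst, he, -⟩ := exists_eq_runMax h₁ h₂ ht
    rcases hst.lt_or_eq with h | rfl
    · left
      refine le_antisymm ?_ ((isLine_runMax h₁ h₂).left_le t)
      rw [← he]
      exact (sub_leftLim_le_runMax h₁ h₂ hs le_rfl).trans
        ((monotone_runMax h₁ h₂).le_leftLim h)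
    · exact Or.inr he.symm

/-- Jumps remain positive: if the running maximum jumps at `x`, its new value is `f₂ x - f₁(x⁻)`.
The difference then equals `f₁(x⁻)`, which dominates its left limit by `leftLim_sub_leftLim_le`. -/
theorem isLine_sub_runMax (h₁ : IsLine f₁) (h₂ : IsLine f₂) :
    IsLine fun y => f₂ y - runMax f₁ f₂ y where
  zero_of_neg x hx := by rw [h₂.zero_of_neg x hx, runMax_of_neg hx, sub_zero]
  right_cont x := (h₂.right_cont x).sub ((isLine_runMax h₁ h₂).right_cont x)
  exists_left x := ⟨_, (h₂.tendsto_left x).sub ((isLine_runMax h₁ h₂).tendsto_left x)⟩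
  left_le x := by
    rw [leftLim_eq_of_tendsto ((h₂.tendsto_left x).sub ((isLine_runMax h₁ h₂).tendsto_left x))]
    have h3 := leftLim_sub_leftLim_le h₁ h₂ x
    have h4 := h₂.left_le x
    rcases runMax_eq_or h₁ h₂ x with h | h <;> rw [h] <;> linarith

/-- Data for the Pitman transform between two entrance times and two exit times. -/
structure PitmanRange (f₁ f₂ : ℝ → ℝ) (b' a b a' P Q : ℝ) : Prop where
  left : P = runMax f₁ f₂ b' - gapTerm (runMax f₁ f₂) b' a
  right : Q = Function.leftLim (runMax f₁ f₂) a' + gapTerm (runMax f₁ f₂) b a'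

namespace PitmanRange

variable {b' a b a' P Q t : ℝ}

theorem left_of_lt (hR : PitmanRange f₁ f₂ b' a b a' P Q) (h : b' < a) :
    P = Function.leftLim (runMax f₁ f₂) a := by
  rw [hR.left, gapTerm_of_lt h]; ring

theorem left_of_le (hR : PitmanRange f₁ f₂ b' a b a' P Q) (h : a ≤ b') :
    P = runMax f₁ f₂ b' := by
  rw [hR.left, gapTerm_of_le h]; ring

theorem right_of_lt (hR : PitmanRange f₁ f₂ b' a b a' P Q) (h : b < a') :
    Q = runMax f₁ f₂ b := by
  rw [hR.right, gapTerm_of_lt h]; ring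

theorem right_of_le (hR : PitmanRange f₁ f₂ b' a b a' P Q) (h : a' ≤ b) :
    Q = Function.leftLim (runMax f₁ f₂) a' := by
  rw [hR.right, gapTerm_of_le h]; ring

theorem left_nonneg (hR : PitmanRange f₁ f₂ b' a b a' P Q) (h₁ : IsLine f₁) (h₂ : IsLine f₂) :
    0 ≤ P := by
  rcases lt_or_ge b' a with h | h
  · rw [hR.left_of_lt h]
    exact (runMax_nonneg h₁ h₂ (a - 1)).trans
      ((monotone_runMax h₁ h₂).le_leftLim (by linarith))
  · rw [hR.left_of_le h]; exact runMax_nonneg h₁ h₂ _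

theorem le_left (hR : PitmanRange f₁ f₂ b' a b a' P Q) (h₁ : IsLine f₁) (h₂ : IsLine f₂) {s : ℝ}
    (hs : 0 ≤ s) (h : s < a ∨ s ≤ b') : f₂ s - Function.leftLim f₁ s ≤ P := by
  rcases lt_or_ge b' a with h' | h'
  · rw [hR.left_of_lt h']
    have hsa : s < a := h.elim id fun h => h.trans_lt h'
    exact (sub_leftLim_le_runMax h₁ h₂ hs le_rfl).trans
      ((monotone_runMax h₁ h₂).le_leftLim hsa)
  · rw [hR.left_of_le h']
    exact sub_leftLim_le_runMax h₁ h₂ hs (h.elim (fun h => h.le.trans h') id)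

theorem left_le (hR : PitmanRange f₁ f₂ b' a b a' P Q) (h₁ : IsLine f₁) (h₂ : IsLine f₂)
    (ha : a ≤ t) (hb : b' < t) : P ≤ Function.leftLim (runMax f₁ f₂) t := by
  rcases lt_or_ge b' a with h' | h'
  · rw [hR.left_of_lt h']
    exact (monotone_runMax h₁ h₂).leftLim ha
  · rw [hR.left_of_le h']
    exact (monotone_runMax h₁ h₂).le_leftLim hb

theorem le_right (hR : PitmanRange f₁ f₂ b' a b a' P Q) (h₁ : IsLine f₁) (h₂ : IsLine f₂)
    (hb : t ≤ b) (ha : t < a') : runMax f₁ f₂ t ≤ Q := by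
  rcases lt_or_ge b a' with h' | h'
  · rw [hR.right_of_lt h']
    exact monotone_runMax h₁ h₂ hb
  · rw [hR.right_of_le h']
    exact (monotone_runMax h₁ h₂).le_leftLim ha

/-- All times before the admissible window contribute at most `P` to the running maximum, so
exceeding `c ≥ P` must happen inside it. The strict bounds `b' < s` and `s < a'` make both adjacent
gaps nondegenerate. -/
theorem exists_lt (hR : PitmanRange f₁ f₂ b' a b a' P Q) (h₁ : IsLine f₁) (h₂ : IsLine f₂)
    {c : ℝ} (hP : P ≤ c) (hQ : c < Q) :
    ∃ s, a ≤ s ∧ b' < s ∧ s ≤ b ∧ s < a' ∧ c < f₂ s - Function.leftLim f₁ s := by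
  have hc : 0 ≤ c := (hR.left_nonneg h₁ h₂).trans hP
  have key : ∀ u, c < runMax f₁ f₂ u →
      ∃ s, a ≤ s ∧ b' < s ∧ s ≤ u ∧ c < f₂ s - Function.leftLim f₁ s := by
    intro u hu
    have hu0 : 0 ≤ u := by
      by_contra h
      rw [runMax_of_neg (not_le.1 h)] at hu
      linarith
    obtain ⟨s, hs, hsu, he, -⟩ := exists_eq_runMax h₁ h₂ hu0
    rw [← he] at hu
    refine ⟨s, ?_, ?_, hsu, hu⟩ <;> by_contra h
    · linarith [hR.le_left h₁ h₂ hs (Or.inl (not_le.1 h))]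
    · linarith [hR.le_left h₁ h₂ hs (Or.inr (not_lt.1 h))]
  rcases lt_or_ge b a' with h | h
  · rw [hR.right_of_lt h] at hQ
    obtain ⟨s, h3, h4, h5, h6⟩ := key b hQ
    exact ⟨s, h3, h4, h5, h5.trans_lt h, h6⟩
  · rw [hR.right_of_le h] at hQ
    obtain ⟨u, hu, hu'⟩ := ((((isLine_runMax h₁ h₂).tendsto_left a').eventually_const_lt hQ).and
      self_mem_nhdsWithin).exists
    obtain ⟨s, h3, h4, h5, h6⟩ := key u hu
    have hsa : s < a' := h5.trans_lt hu'
    exact ⟨s, h3, h4, hsa.le.trans h, hsa, h6⟩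

/-- The first time at which the running maximum exceeds its initial value. -/
theorem exists_near (hR : PitmanRange f₁ f₂ b' a b a' P Q) (h₁ : IsLine f₁) (h₂ : IsLine f₂)
    (hPQ : P < Q) {ε : ℝ} (hε : 0 < ε) :
    ∃ s, a ≤ s ∧ b' < s ∧ s ≤ b ∧ s < a' ∧
      runMax f₁ f₂ s - ε ≤ f₂ s - Function.leftLim f₁ s ∧
      Function.leftLim (runMax f₁ f₂) s ≤ P + ε := by
  set E := {s | a ≤ s ∧ b' < s ∧ s ≤ b ∧ s < a' ∧ P < f₂ s - Function.leftLim f₁ s} with hE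
  have hne : E.Nonempty := hR.exists_lt h₁ h₂ le_rfl hPQ
  have hbdd : BddBelow E := ⟨a, fun s hs => hs.1⟩
  set τ := sInf E with hτ
  have hP0 := hR.left_nonneg h₁ h₂
  have hbefore : ∀ s, 0 ≤ s → s < τ → f₂ s - Function.leftLim f₁ s ≤ P := by
    intro s hs hsτ
    by_contra hlt
    rw [not_le] at hlt
    refine absurd (csInf_le hbdd (?_ : s ∈ E)) (not_le.2 hsτ)
    obtain ⟨e, he⟩ := hne
    have hse : s < e := hsτ.trans_le (csInf_le hbdd he)
    refine ⟨?_, ?_, hse.le.trans he.2.2.1, hse.trans he.2.2.2.1, hlt⟩ <;> by_contra h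
    · linarith [hR.le_left h₁ h₂ hs (Or.inl (not_le.1 h))]
    · linarith [hR.le_left h₁ h₂ hs (Or.inr (not_lt.1 h))]
  have haτ : a ≤ τ := le_csInf hne fun s hs => hs.1
  by_cases hmem : τ ∈ E
  · refine ⟨τ, hmem.1, hmem.2.1, hmem.2.2.1, hmem.2.2.2.1, ?_, ?_⟩
    · have : runMax f₁ f₂ τ ≤ f₂ τ - Function.leftLim f₁ τ := by
        refine runMax_le h₁ h₂ (hP0.trans hmem.2.2.2.2.le) fun s hs hsτ => ?_
        rcases hsτ.lt_or_eq with h | rfl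
        · exact (hbefore s hs h).trans hmem.2.2.2.2.le
        · exact le_rfl
      linarith
    · have : Function.leftLim (runMax f₁ f₂) τ ≤ P := by
        refine le_of_tendsto ((isLine_runMax h₁ h₂).tendsto_left τ) ?_
        filter_upwards [self_mem_nhdsWithin] with s hs
        exact runMax_le h₁ h₂ hP0 fun r hr hrs => hbefore r hr (lt_of_le_of_lt hrs hs)
      linarith
  -- The infimum need not be a time of exceedance. Then the running maximum is still at most `P` at
  -- `τ`, and right continuity keeps it below `P + ε` at some later point of `E`; this is the source
  -- of the error `ε`.
  · have hlt : ∀ e ∈ E, τ < e := fun e he =>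
      lt_of_le_of_ne (csInf_le hbdd he) fun h => hmem (h ▸ he)
    have hτP : runMax f₁ f₂ τ ≤ P := by
      refine runMax_le h₁ h₂ hP0 fun s hs hsτ => ?_
      rcases hsτ.lt_or_eq with h | rfl
      · exact hbefore s hs h
      · by_contra h
        rw [not_le] at h
        obtain ⟨e, he⟩ := hne
        refine hmem ⟨haτ, ?_, (hlt e he).le.trans he.2.2.1, (hlt e he).trans he.2.2.2.1, h⟩
        by_contra h'
        linarith [hR.le_left h₁ h₂ hs (Or.inr (not_lt.1 h'))]
    obtain ⟨u, hu, hsub⟩ := mem_nhdsGT_iff_exists_Ioo_subset.1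
      (((isLine_runMax h₁ h₂).tendsto_right τ).eventually_lt_const
        (show runMax f₁ f₂ τ < P + ε by linarith))
    obtain ⟨e, he, heu⟩ := exists_lt_of_csInf_lt hne (show sInf E < u from hu)
    have h3 : runMax f₁ f₂ e < P + ε := hsub ⟨hlt e he, heu⟩
    refine ⟨e, he.1, he.2.1, he.2.2.1, he.2.2.2.1, by linarith [he.2.2.2.2], ?_⟩
    linarith [(isLine_runMax h₁ h₂).left_le e]

end PitmanRange

/-- The best jump time between two lines, before and after the Pitman transform. -/
theorem exists_le_pitman (h₁ : IsLine f₁) (h₂ : IsLine f₂) {b' a b a' t ε : ℝ} (ha : 0 ≤ a)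
    (hat : a ≤ t) (hbt : b' ≤ t) (htb : t ≤ b) (hta : t ≤ a') (hε : 0 < ε) :
    ∃ s, a ≤ s ∧ b' ≤ s ∧ s ≤ b ∧ s ≤ a' ∧
      gapTerm f₁ b' t + gapTerm f₂ t a' + gapTerm (runMax f₁ f₂) b' a ≤
        gapTerm (fun y => f₁ y + runMax f₁ f₂ y) b' s +
          gapTerm (fun y => f₂ y - runMax f₁ f₂ y) s a' + gapTerm (runMax f₁ f₂) b a' + ε := by
  have hD := isLine_runMax h₁ h₂
  have hsub : ∀ u v, gapTerm (fun y => f₂ y - runMax f₁ f₂ y) u v =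
      gapTerm f₂ u v - gapTerm (runMax f₁ f₂) u v := by
    intro u v
    have := gapTerm_add (isLine_sub_runMax h₁ h₂) hD u v
    simp only [sub_add_cancel] at this
    linarith
  simp only [gapTerm_add h₁ hD, hsub]
  -- With `D` the running maximum, `P` is `D` just before the window of jump times and `Q` is `D` at
  -- its end. Nondegenerate gaps at a jump time `s` contribute `f₂ s - f₁(s⁻)` before the transform
  -- and `f₂ s - f₁(s⁻) - D(s⁻) - D s + P + Q` after it, up to common terms.
  obtain ⟨P, hP⟩ : ∃ P, P = runMax f₁ f₂ b' - gapTerm (runMax f₁ f₂) b' a := ⟨_, rfl⟩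
  obtain ⟨Q, hQ⟩ : ∃ Q, Q = Function.leftLim (runMax f₁ f₂) a' + gapTerm (runMax f₁ f₂) b a' :=
    ⟨_, rfl⟩
  have hR : PitmanRange f₁ f₂ b' a b a' P Q := ⟨hP, hQ⟩
  have ht0 := ha.trans hat
  -- If `P < Q`, the first exceedance has `D(s⁻) ≈ P` and `f₂ s - f₁(s⁻) ≈ D s`, so the new
  -- contribution is about `Q`, an upper bound for the old one. Otherwise `D` does not grow across
  -- the window and the old jump time can be kept.
  rcases lt_or_ge P Q with hPQ | hPQ
  · obtain ⟨s, h3, h4, h5, h6, h7, h8⟩ := hR.exists_near h₁ h₂ hPQ (half_pos hε)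
    refine ⟨s, h3, h4.le, h5, h6.le, ?_⟩
    rw [gapTerm_of_lt (g := f₁) h4, gapTerm_of_lt (g := runMax f₁ f₂) h4,
      gapTerm_of_lt (g := f₂) h6, gapTerm_of_lt (g := runMax f₁ f₂) h6]
    have : gapTerm f₁ b' t + gapTerm f₂ t a' ≤ f₁ b' - Function.leftLim f₂ a' + Q := by
      rcases hbt.lt_or_eq with hbt | rfl <;> rcases hta.lt_or_eq with hta | rfl
      · rw [gapTerm_of_lt hbt, gapTerm_of_lt hta]
        linarith [sub_leftLim_le_runMax h₁ h₂ ht0 le_rfl, hR.le_right h₁ h₂ htb hta]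
      · rw [gapTerm_of_lt hbt, gapTerm_of_le le_rfl]
        linarith [hR.right_of_le htb, leftLim_sub_leftLim_le h₁ h₂ t]
      · rw [gapTerm_of_le le_rfl, gapTerm_of_lt hta]
        linarith [hR.left_of_le hat, sub_le_runMax h₁ h₂ ht0]
      · linarith [hR.left_of_le hat, hR.right_of_le htb, hD.left_le b']
    linarith
  · refine ⟨t, hat, hbt, htb, hta, ?_⟩
    rcases hbt.lt_or_eq with hbt | rfl <;> rcases hta.lt_or_eq with hta | rfl
    · rw [gapTerm_of_lt (g := runMax f₁ f₂) hbt, gapTerm_of_lt (g := runMax f₁ f₂) hta]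
      linarith [hR.left_le h₁ h₂ hat hbt, hR.le_right h₁ h₂ htb hta, hD.left_le t]
    · rw [gapTerm_of_lt (g := runMax f₁ f₂) hbt, gapTerm_of_le (g := runMax f₁ f₂) (le_refl t)]
      linarith [hR.right_of_le htb]
    · rw [gapTerm_of_le (g := runMax f₁ f₂) (le_refl b'), gapTerm_of_lt (g := runMax f₁ f₂) hta]
      linarith [hR.left_of_le hat, hR.le_right h₁ h₂ htb hta]
    · rw [gapTerm_of_le (g := runMax f₁ f₂) (le_refl b'), gapTerm_of_le (g := runMax f₁ f₂) hat,
        gapTerm_of_le (g := runMax f₁ f₂) htb]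
      linarith

/-- The converse comparison: every transformed contribution is at most `Q`, since `D(t⁻) ≥ P` and
`f₂ t - f₁(t⁻) ≤ D t` for the running maximum `D`. If `P < Q`, some `s` comes within `ε` of `Q` for
the original lines. -/
theorem exists_pitman_le (h₁ : IsLine f₁) (h₂ : IsLine f₂) {b' a b a' t ε : ℝ} (ha : 0 ≤ a)
    (hat : a ≤ t) (hbt : b' ≤ t) (htb : t ≤ b) (hta : t ≤ a') (hε : 0 < ε) :
    ∃ s, a ≤ s ∧ b' ≤ s ∧ s ≤ b ∧ s ≤ a' ∧
      gapTerm (fun y => f₁ y + runMax f₁ f₂ y) b' t +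
          gapTerm (fun y => f₂ y - runMax f₁ f₂ y) t a' + gapTerm (runMax f₁ f₂) b a' ≤
        gapTerm f₁ b' s + gapTerm f₂ s a' + gapTerm (runMax f₁ f₂) b' a + ε := by
  have hD := isLine_runMax h₁ h₂
  have hsub : ∀ u v, gapTerm (fun y => f₂ y - runMax f₁ f₂ y) u v =
      gapTerm f₂ u v - gapTerm (runMax f₁ f₂) u v := by
    intro u v
    have := gapTerm_add (isLine_sub_runMax h₁ h₂) hD u v
    simp only [sub_add_cancel] at this
    linarith
  simp only [gapTerm_add h₁ hD, hsub]
  obtain ⟨P, hP⟩ : ∃ P, P = runMax f₁ f₂ b' - gapTerm (runMax f₁ f₂) b' a := ⟨_, rfl⟩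
  obtain ⟨Q, hQ⟩ : ∃ Q, Q = Function.leftLim (runMax f₁ f₂) a' + gapTerm (runMax f₁ f₂) b a' :=
    ⟨_, rfl⟩
  have hR : PitmanRange f₁ f₂ b' a b a' P Q := ⟨hP, hQ⟩
  have ht0 := ha.trans hat
  rcases lt_or_ge P Q with hPQ | hPQ
  · obtain ⟨s, h3, h4, h5, h6, h7⟩ := hR.exists_lt h₁ h₂ (le_max_left P (Q - ε))
      (max_lt hPQ (by linarith))
    have h8 := le_max_right P (Q - ε)
    refine ⟨s, h3, h4.le, h5, h6.le, ?_⟩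
    rw [gapTerm_of_lt (g := f₁) h4, gapTerm_of_lt (g := f₂) h6]
    rcases hbt.lt_or_eq with hbt | rfl <;> rcases hta.lt_or_eq with hta | rfl
    · rw [gapTerm_of_lt (g := f₁) hbt, gapTerm_of_lt (g := runMax f₁ f₂) hbt,
        gapTerm_of_lt (g := f₂) hta, gapTerm_of_lt (g := runMax f₁ f₂) hta]
      linarith [hR.left_le h₁ h₂ hat hbt, sub_leftLim_le_runMax h₁ h₂ ht0 le_rfl]
    · rw [gapTerm_of_lt (g := f₁) hbt, gapTerm_of_lt (g := runMax f₁ f₂) hbt,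
        gapTerm_of_le (g := f₂) le_rfl, gapTerm_of_le (g := runMax f₁ f₂) (le_refl t)]
      linarith [hR.right_of_le htb, leftLim_sub_leftLim_le h₁ h₂ t]
    · rw [gapTerm_of_le (g := f₁) le_rfl, gapTerm_of_le (g := runMax f₁ f₂) (le_refl b'),
        gapTerm_of_lt (g := f₂) hta, gapTerm_of_lt (g := runMax f₁ f₂) hta]
      linarith [hR.left_of_le hat, sub_le_runMax h₁ h₂ ht0]
    · linarith [hR.left_of_le hat, hR.right_of_le htb, hD.left_le b']
  · refine ⟨t, hat, hbt, htb, hta, ?_⟩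
    rcases hbt.lt_or_eq with hbt | rfl <;> rcases hta.lt_or_eq with hta | rfl
    · rw [gapTerm_of_lt (g := runMax f₁ f₂) hbt, gapTerm_of_lt (g := runMax f₁ f₂) hta]
      linarith [hR.left_le h₁ h₂ hat hbt, hR.le_right h₁ h₂ htb hta, hD.left_le t]
    · rw [gapTerm_of_lt (g := runMax f₁ f₂) hbt, gapTerm_of_le (g := runMax f₁ f₂) (le_refl t)]
      linarith [hR.right_of_le htb, hR.left_le h₁ h₂ hat hbt]
    · rw [gapTerm_of_le (g := runMax f₁ f₂) (le_refl b'), gapTerm_of_lt (g := runMax f₁ f₂) hta]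
      linarith [hR.left_of_le hat, hR.le_right h₁ h₂ htb hta]
    · rw [gapTerm_of_le (g := runMax f₁ f₂) (le_refl b'), gapTerm_of_le (g := runMax f₁ f₂) hat,
        gapTerm_of_le (g := runMax f₁ f₂) htb]
      linarith

end runMax

end

/-! ### Isometry of the Pitman transform -/

section

/-- The contribution of line `i` to the length of an array. -/
def rowLength (g : ℝ → ℝ) (k : ℕ) (Y : ℝ) (T : ℕ → ℕ → ℝ) (i : ℕ) : ℝ :=
  ∑ j ∈ Finset.range (k + 1), gapTerm g (T j i) (T (j + 1) (i + 1)) + Function.leftLim g Y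

theorem sum_range_eq_add_two {n m : ℕ} (hm : m + 1 < n) (r : ℕ → ℝ) :
    ∑ i ∈ Finset.range n, r i =
      ∑ i ∈ Finset.range n \ {m, m + 1}, r i + (r m + r (m + 1)) := by
  rw [← Finset.sum_pair (show m ≠ m + 1 by lia), Finset.sum_sdiff]
  intro i hi
  rw [Finset.mem_insert, Finset.mem_singleton] at hi
  rw [Finset.mem_range]
  lia

/-- Replacing the jump times between two neighbouring lines, when these lines are changed. -/
theorem IsArray.exists_replace {F G : ℕ → ℝ → ℝ} {n k m : ℕ} {x y Y δ : ℝ} {T : ℕ → ℕ → ℝ}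
    {e : ℝ → ℝ → ℝ} (hT : IsArray n k x y Y T) (hx : 0 ≤ x) (hm : m + 1 < n)
    (hFG : ∀ i, i ≠ m → i ≠ m + 1 → G i = F i)
    (htop : ∀ b a, gapTerm (G m) b a = gapTerm (F m) b a + e b a)
    (hbot : ∀ b a, gapTerm (G (m + 1)) b a = gapTerm (F (m + 1)) b a - e b a)
    (hY : Function.leftLim (G m) Y + Function.leftLim (G (m + 1)) Y =
      Function.leftLim (F m) Y + Function.leftLim (F (m + 1)) Y)
    (hjump : ∀ b' a b a' t, 0 ≤ a → a ≤ t → b' ≤ t → t ≤ b → t ≤ a' → ∃ s, a ≤ s ∧ b' ≤ s ∧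
      s ≤ b ∧ s ≤ a' ∧ gapTerm (F m) b' t + gapTerm (F (m + 1)) t a' + e b' a ≤
        gapTerm (G m) b' s + gapTerm (G (m + 1)) s a' + e b a' + δ) :
    ∃ S, IsArray n k x y Y S ∧ arrayLength F n k Y T ≤ arrayLength G n k Y S + k * δ := by
  have hs : ∀ j, ∃ s, j < k → T (j + 1) (m + 2) ≤ s ∧ T j m ≤ s ∧ s ≤ T (j + 1) m ∧
      s ≤ T (j + 2) (m + 2) ∧ gapTerm (F m) (T j m) (T (j + 1) (m + 1)) +
        gapTerm (F (m + 1)) (T (j + 1) (m + 1)) (T (j + 2) (m + 2)) +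
          e (T j m) (T (j + 1) (m + 2)) ≤
        gapTerm (G m) (T j m) s + gapTerm (G (m + 1)) s (T (j + 2) (m + 2)) +
          e (T (j + 1) m) (T (j + 2) (m + 2)) + δ := by
    intro j
    by_cases hj : j < k
    · obtain ⟨s, hs⟩ := hjump (T j m) (T (j + 1) (m + 2)) (T (j + 1) m) (T (j + 2) (m + 2))
        (T (j + 1) (m + 1)) (hx.trans (hT.start_le hj (by lia))) (hT.anti j hj _ (by lia))
        (hT.interlace j hj.le m (by lia)) (hT.anti j hj m (by lia))
        (hT.interlace (j + 1) hj (m + 1) (by lia))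
      exact ⟨s, fun _ => hs⟩
    · exact ⟨0, fun h => absurd h hj⟩
  choose s hs using hs
  -- Only the jumps between the two changed lines move. Their neighbours in the array lie in
  -- unchanged columns, so the paths can be treated independently.
  set S : ℕ → ℕ → ℝ := fun j i => if i = m + 1 ∧ 1 ≤ j ∧ j ≤ k then s (j - 1) else T j i with hS
  have hS1 : ∀ j < k, S (j + 1) (m + 1) = s j := fun j hj => by
    simp [hS, show j + 1 ≤ k by lia]
  have hS2 : ∀ j i, i ≠ m + 1 → S j i = T j i := fun j i hi => by simp [hS, hi]
  have hS3 : ∀ i, S 0 i = T 0 i := fun i => by simp [hS]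
  have hS4 : ∀ i, S (k + 1) i = T (k + 1) i := fun i => by simp [hS]
  refine ⟨S, ⟨fun i hi => by rw [hS3, hT.bot i hi], fun i hi => by rw [hS4, hT.top i hi],
    fun j hj => by rw [hS2 _ _ (by lia), hT.start j hj],
    fun j hj => by rw [hS2 _ _ (by lia), hT.finish j hj], fun j hj i hi => ?_,
    fun j hj i hi => ?_⟩, ?_⟩
  · obtain ⟨h1, -, h3, -, -⟩ := hs j hj
    rcases eq_or_ne i m with rfl | him
    · rw [hS1 j hj, hS2 _ _ (by lia)]
      exact h3
    · rw [hS2 (j + 1) (i + 1) (by lia)]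
      rcases eq_or_ne i (m + 1) with rfl | him'
      · rw [hS1 j hj]
        exact h1
      · rw [hS2 _ _ him']
        exact hT.anti j hj i hi
  · rcases eq_or_ne i m with rfl | him
    · rw [hS2 _ _ (by lia)]
      rcases hj.lt_or_eq with hj | rfl
      · rw [hS1 j hj]
        exact (hs j hj).2.1
      · rw [hS4]
        exact hT.interlace j hj i hi
    · rw [hS2 (j + 1) (i + 1) (by lia)]
      rcases eq_or_ne i (m + 1) with rfl | him'
      · rcases j with _ | j
        · rw [hS3]
          exact hT.interlace 0 hj _ hi
        · rw [hS1 j hj]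
          exact (hs j hj).2.2.2.1
      · rw [hS2 _ _ him']
        exact hT.interlace j hj i hi
  · change ∑ i ∈ Finset.range n, rowLength (F i) k Y T i ≤
      ∑ i ∈ Finset.range n, rowLength (G i) k Y S i + k * δ
    rw [sum_range_eq_add_two hm (fun i => rowLength (F i) k Y T i),
      sum_range_eq_add_two hm (fun i => rowLength (G i) k Y S i)]
    have hother : ∑ i ∈ Finset.range n \ {m, m + 1}, rowLength (F i) k Y T i =
        ∑ i ∈ Finset.range n \ {m, m + 1}, rowLength (G i) k Y S i := by
      refine Finset.sum_congr rfl fun i hi => ?_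
      simp only [Finset.mem_sdiff, Finset.mem_insert, Finset.mem_singleton, not_or] at hi
      rw [hFG i hi.2.1 hi.2.2]
      unfold rowLength
      congr 1
      refine Finset.sum_congr rfl fun j _ => ?_
      rw [hS2 _ _ hi.2.2, hS2 _ _ (by lia)]
    rw [hother, add_assoc]
    refine add_le_add le_rfl ?_
    unfold rowLength
    -- The gap before a path on line `m` is paired with the gap after it on line `m + 1`, as both
    -- meet at its jump time. This leaves the last gap on line `m` and the first on line `m + 1`.
    rw [Finset.sum_range_succ (fun j => gapTerm (F m) _ _),
      Finset.sum_range_succ' (fun j => gapTerm (F (m + 1)) _ _),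
      Finset.sum_range_succ (fun j => gapTerm (G m) _ _),
      Finset.sum_range_succ' (fun j => gapTerm (G (m + 1)) _ _)]
    rw [hS2 k m (by lia), hS4, hS3, hS2 (0 + 1) (m + 1 + 1) (by lia), htop (T k m), hbot (T 0 _)]
    have hsum : ∑ j ∈ Finset.range k, (gapTerm (F m) (T j m) (T (j + 1) (m + 1)) +
          gapTerm (F (m + 1)) (T (j + 1) (m + 1)) (T (j + 1 + 1) (m + 1 + 1))) ≤
        ∑ j ∈ Finset.range k, (gapTerm (G m) (S j m) (S (j + 1) (m + 1)) +
          gapTerm (G (m + 1)) (S (j + 1) (m + 1)) (S (j + 1 + 1) (m + 1 + 1)) +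
          (e (T (j + 1) m) (T (j + 2) (m + 2)) - e (T j m) (T (j + 1) (m + 2))) + δ) := by
      refine Finset.sum_le_sum fun j hj => ?_
      rw [Finset.mem_range] at hj
      rw [hS1 j hj, hS2 _ _ (by lia), hS2 _ _ (by lia)]
      linarith [(hs j hj).2.2.2.2]
    have htel := Finset.sum_range_sub (fun j => e (T j m) (T (j + 1) (m + 2))) k
    simp only [Finset.sum_add_distrib, Finset.sum_const, Finset.card_range, nsmul_eq_mul]
      at hsum htel
    rw [htel] at hsum
    -- The end terms of the telescoping sum cancel against the two unpaired gaps because the padding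
    -- rows are constant.
    have h0 : e (T 0 (m + 1)) (T (0 + 1) (m + 1 + 1)) = e (T 0 m) (T (0 + 1) (m + 2)) := by
      rw [hT.bot _ (by lia), hT.bot _ (by lia)]
    have h1 : e (T k m) (T (k + 1) (m + 1)) = e (T k m) (T (k + 1) (m + 2)) := by
      rw [hT.top _ (by lia), hT.top _ (by lia)]
    linarith

/-- The Pitman transform of the lines `m` and `m + 1`. -/
def pitman (m : ℕ) (F : ℕ → ℝ → ℝ) (i : ℕ) : ℝ → ℝ :=
  if i = m then fun y => F m y + runMax (F m) (F (m + 1)) y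
  else if i = m + 1 then fun y => F (m + 1) y - runMax (F m) (F (m + 1)) y
  else F i

theorem pitman_left (m : ℕ) (F : ℕ → ℝ → ℝ) :
    pitman m F m = fun y => F m y + runMax (F m) (F (m + 1)) y := if_pos rfl

theorem pitman_right (m : ℕ) (F : ℕ → ℝ → ℝ) :
    pitman m F (m + 1) = fun y => F (m + 1) y - runMax (F m) (F (m + 1)) y := by
  rw [pitman, if_neg (by lia), if_pos rfl]

theorem pitman_of_ne {m i : ℕ} (F : ℕ → ℝ → ℝ) (h : i ≠ m) (h' : i ≠ m + 1) :
    pitman m F i = F i := by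
  rw [pitman, if_neg h, if_neg h']

section

variable {F : ℕ → ℝ → ℝ} {n k m : ℕ} {x y Y : ℝ}

theorem isLine_pitman (hF : ∀ i, IsLine (F i)) (m i : ℕ) : IsLine (pitman m F i) := by
  rcases eq_or_ne i m with rfl | h
  · rw [pitman_left]
    exact (hF i).add (isLine_runMax (hF i) (hF (i + 1)))
  · rcases eq_or_ne i (m + 1) with rfl | h'
    · rw [pitman_right]
      exact isLine_sub_runMax (hF m) (hF (m + 1))
    · rw [pitman_of_ne F h h']
      exact hF i

/-- The Pitman transform is an isometry. -/
theorem lpp_pitman (hF : ∀ i, IsLine (F i)) (hm : m + 1 < n) (hk : k ≤ n) (hx : 0 ≤ x)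
    (hxy : x ≤ y) : lpp (pitman m F) n k x y = lpp F n k x y := by
  have hG := isLine_pitman hF m
  have hD := isLine_runMax (hF m) (hF (m + 1))
  have hbot : ∀ b a, gapTerm (pitman m F (m + 1)) b a =
      gapTerm (F (m + 1)) b a - gapTerm (runMax (F m) (F (m + 1))) b a := by
    intro b a
    have := gapTerm_add (hG (m + 1)) hD b a
    rw [pitman_right] at this ⊢
    simp only [sub_add_cancel] at this
    linarith
  have htop : ∀ b a, gapTerm (pitman m F m) b a =
      gapTerm (F m) b a + gapTerm (runMax (F m) (F (m + 1))) b a := by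
    intro b a
    rw [pitman_left, gapTerm_add (hF m) hD]
  have hY : ∀ Y, Function.leftLim (pitman m F m) Y + Function.leftLim (pitman m F (m + 1)) Y =
      Function.leftLim (F m) Y + Function.leftLim (F (m + 1)) Y := by
    intro Y
    rw [← (hG m).leftLim_add (hG (m + 1)), ← (hF m).leftLim_add (hF (m + 1)), pitman_left,
      pitman_right]
    congr 1
    funext y
    ring
  have hle : ∀ ε > 0, lpp (pitman m F) n k x y ≤ lpp F n k x y + k * ε := by
    intro ε hε
    obtain ⟨T, hT, hT'⟩ := exists_isArray hG hk hx hxy (lt_add_one y)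
    obtain ⟨S, hS, hS'⟩ := hT.exists_replace (G := F) (δ := ε)
      (e := fun b a => -gapTerm (runMax (F m) (F (m + 1))) b a) hx hm
      (fun i h h' => (pitman_of_ne F h h').symm) (fun b a => by rw [htop]; ring)
      (fun b a => by rw [hbot]; ring) (hY _).symm (fun b' a b a' t ha hat hbt htb hta => by
        obtain ⟨s, h1, h2, h3, h4, h5⟩ :=
          exists_pitman_le (hF m) (hF (m + 1)) ha hat hbt htb hta hε
        refine ⟨s, h1, h2, h3, h4, ?_⟩
        rw [pitman_left, pitman_right]
        linarith)
    rw [← hT']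
    exact hS'.trans (add_le_add (hS.length_le_lpp hF hk hx hxy (lt_add_one y)) le_rfl)
  have hge : ∀ ε > 0, lpp F n k x y ≤ lpp (pitman m F) n k x y + k * ε := by
    intro ε hε
    obtain ⟨T, hT, hT'⟩ := exists_isArray hF hk hx hxy (lt_add_one y)
    obtain ⟨S, hS, hS'⟩ := hT.exists_replace (G := pitman m F) (δ := ε)
      (e := gapTerm (runMax (F m) (F (m + 1)))) hx hm
      (fun i h h' => pitman_of_ne F h h') htop hbot (hY _)
      (fun b' a b a' t ha hat hbt htb hta => by
        rw [pitman_left, pitman_right]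
        exact exists_le_pitman (hF m) (hF (m + 1)) ha hat hbt htb hta hε)
    rw [← hT']
    exact hS'.trans (add_le_add (hS.length_le_lpp hG hk hx hxy (lt_add_one y)) le_rfl)
  have hlim : ∀ c : ℝ, Tendsto (fun ε : ℝ => c + k * ε) (𝓝[>] 0) (𝓝 c) := by
    intro c
    have h : Tendsto (fun ε : ℝ => c + k * ε) (𝓝 0) (𝓝 (c + k * 0)) :=
      (continuous_const.add (continuous_const.mul continuous_id)).tendsto 0
    rw [mul_zero, add_zero] at h
    exact h.mono_left nhdsWithin_le_nhds
  refine le_antisymm (ge_of_tendsto (hlim _) ?_) (ge_of_tendsto (hlim _) ?_)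
  · filter_upwards [self_mem_nhdsWithin] with ε hε using hle ε hε
  · filter_upwards [self_mem_nhdsWithin] with ε hε using hge ε hε

/-! ### Chains of Pitman transforms and sorted lines -/

/-- Sequences of Pitman transforms of the first `n` lines. -/
def PitmanChain (n : ℕ) : (ℕ → ℝ → ℝ) → (ℕ → ℝ → ℝ) → Prop :=
  Relation.ReflTransGen fun F G => ∃ m, m + 1 < n ∧ G = pitman m F

theorem PitmanChain.isLine {G : ℕ → ℝ → ℝ} (h : PitmanChain n F G) (hF : ∀ i, IsLine (F i)) :
    ∀ i, IsLine (G i) := by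
  induction h with
  | refl => exact hF
  | tail _ h ih =>
    obtain ⟨m, -, rfl⟩ := h
    exact isLine_pitman ih m

theorem PitmanChain.lpp_eq {G : ℕ → ℝ → ℝ} (h : PitmanChain n F G) (hF : ∀ i, IsLine (F i))
    (hk : k ≤ n) (hx : 0 ≤ x) (hxy : x ≤ y) : lpp G n k x y = lpp F n k x y := by
  induction h with
  | refl => rfl
  | tail h' h ih =>
    obtain ⟨m, hm, rfl⟩ := h
    rw [← ih, lpp_pitman (PitmanChain.isLine h' hF) hm hk hx hxy]

/-- Adding a line on top. -/
def consLine (g : ℝ → ℝ) (F : ℕ → ℝ → ℝ) : ℕ → ℝ → ℝ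
  | 0 => g
  | i + 1 => F i

theorem consLine_pitman (g : ℝ → ℝ) (m : ℕ) (F : ℕ → ℝ → ℝ) :
    consLine g (pitman m F) = pitman (m + 1) (consLine g F) := by
  funext i
  rcases i with _ | i
  · rw [pitman_of_ne _ (by lia) (by lia)]
    rfl
  · rcases eq_or_ne i m with rfl | h
    · rw [pitman_left, consLine, pitman_left]
      rfl
    · rcases eq_or_ne i (m + 1) with rfl | h'
      · rw [pitman_right, consLine, pitman_right]
        rfl
      · rw [pitman_of_ne _ (by lia) (by lia), consLine, pitman_of_ne _ h h']
        rfl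

theorem PitmanChain.cons {G : ℕ → ℝ → ℝ} (h : PitmanChain n F G) (g : ℝ → ℝ) :
    PitmanChain (n + 1) (consLine g F) (consLine g G) := by
  refine Relation.ReflTransGen.lift (consLine g) ?_ _ _ h
  rintro _ _ ⟨m, hm, rfl⟩
  exact ⟨m + 1, by lia, consLine_pitman g m _⟩

/-- The lines are ordered. -/
def IsSorted (n : ℕ) (F : ℕ → ℝ → ℝ) : Prop :=
  ∀ i, i + 1 < n → ∀ y, 0 ≤ y → F (i + 1) y ≤ Function.leftLim (F i) y

/-- Summation along the diagonals of an array. -/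
theorem sum_diagonal (n k : ℕ) (p q : ℕ → ℕ → ℝ) :
    ∑ i ∈ Finset.range (n + 1), ∑ j ∈ Finset.range (k + 1), (p j i - q (j + 1) (i + 1)) =
      ∑ i ∈ Finset.range (n + 1), p 0 i - ∑ i ∈ Finset.range (n + 1), q (k + 1) (i + 1) +
        ∑ j ∈ Finset.range k, (p (j + 1) 0 - q (j + 1) (n + 1) +
          ∑ i ∈ Finset.range n, (p (j + 1) (i + 1) - q (j + 1) (i + 1))) := by
  rw [Finset.sum_comm]
  simp only [Finset.sum_sub_distrib, Finset.sum_add_distrib]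
  rw [Finset.sum_range_succ' (fun j => ∑ i ∈ Finset.range (n + 1), p j i),
    Finset.sum_range_succ (fun j => ∑ i ∈ Finset.range (n + 1), q (j + 1) (i + 1))]
  simp only [Finset.sum_range_succ' (fun i => p _ i) n, Finset.sum_range_succ _ n,
    Finset.sum_add_distrib]
  ring

end

end

/-! ### Last passage values of sorted lines, and sorting -/

section

variable {F : ℕ → ℝ → ℝ} {n k m : ℕ} {x y Y : ℝ} {T : ℕ → ℕ → ℝ}

/-- Disjointness near the common endpoint: interlacing propagates the value `y` along the diagonals
from column `0`. `IsArray.eq_start` is the mirror statement at the starting point. -/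
theorem IsArray.eq_finish (hT : IsArray n k x y Y T) {j i : ℕ} (hij : i ≤ j) (hj : j < k)
    (hi : i ≤ n) : T (j + 1) i = y := by
  refine le_antisymm (hT.le_finish hj hi) ?_
  induction i generalizing j with
  | zero => rw [hT.finish j hj]
  | succ i ih =>
    obtain ⟨j, rfl⟩ : ∃ l, j = l + 1 := ⟨j - 1, by lia⟩
    exact (ih (by lia) (by lia) (by lia)).trans (hT.interlace (j + 1) (by lia) i hi)

theorem IsArray.eq_start (hT : IsArray n k x y Y T) {j i : ℕ} (hij : n ≤ k - 1 - j + i)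
    (hj : j < k) (hi : i ≤ n) : T (j + 1) i = x := by
  refine le_antisymm ?_ (hT.start_le hj hi)
  obtain ⟨d, hd⟩ : ∃ d, d = n - i := ⟨_, rfl⟩
  induction d generalizing j i with
  | zero =>
    obtain rfl : i = n := by lia
    rw [hT.start j hj]
  | succ d ih =>
    exact (hT.interlace (j + 1) (by lia) i (by lia)).trans
      (ih (by lia) (by lia) (by lia) (by lia))

theorem sum_range_ite_lt (hk : k ≤ n) (r : ℕ → ℝ) :
    ∑ i ∈ Finset.range n, (if i < k then r i else 0) = ∑ i ∈ Finset.range k, r i := by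
  rw [← Finset.sum_filter]
  refine Finset.sum_congr ?_ fun _ _ => rfl
  ext i
  simp only [Finset.mem_filter, Finset.mem_range]
  lia

/-- Regrouped path by path, each jump at time `s` from line `i + 1` up to line `i` contributes `F (i
+ 1) s - F i (s⁻) ≤ 0`. What survives comes from the entries forced to equal `y` in the last row. -/
theorem IsSorted.arrayLength_le (hs : IsSorted n F) (hF : ∀ i, IsLine (F i)) (hk : k ≤ n)
    (hk0 : 0 < k) (hT : IsArray n k 0 y Y T) :
    arrayLength F n k Y T ≤ ∑ i ∈ Finset.range k, F i y := by
  obtain ⟨N, rfl⟩ : ∃ N, n = N + 1 := ⟨n - 1, by lia⟩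
  obtain ⟨K, rfl⟩ : ∃ K, k = K + 1 := ⟨k - 1, by lia⟩
  -- Gaps between two entries forced to be `y` vanish and must not be replaced by a possibly
  -- positive jump; `p` and `q` are set to `0` there. In the last row only `q` is suppressed, which
  -- leaves the values at `y` of the top lines.
  set p : ℕ → ℕ → ℝ := fun j i => if i < j ∧ j < K + 1 then 0 else F i (T j i) with hp
  set q : ℕ → ℕ → ℝ := fun j i =>
    if i < j ∧ j ≤ K + 1 then 0 else Function.leftLim (F (i - 1)) (T j i) with hq
  have h1 : arrayLength F (N + 1) (K + 1) Y T ≤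
      ∑ i ∈ Finset.range (N + 1), (∑ j ∈ Finset.range (K + 1 + 1), (p j i - q (j + 1) (i + 1)) +
        Function.leftLim (F i) Y) := by
    refine Finset.sum_le_sum fun i hi => add_le_add (Finset.sum_le_sum fun j hj => ?_) le_rfl
    rw [Finset.mem_range] at hi hj
    by_cases h : i < j ∧ j < K + 1
    · obtain ⟨l, rfl⟩ : ∃ l, j = l + 1 := ⟨j - 1, by lia⟩
      rw [hT.eq_finish (by lia) (by lia) (by lia), hT.eq_finish (by lia) (by lia) (by lia),
        gapTerm_of_le le_rfl]
      simp only [hp, hq]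
      rw [if_pos h, if_pos (by lia), sub_zero]
    · simp only [hp, hq]
      rw [if_neg h, if_neg (by lia)]
      exact (hF i).gapTerm_le (hT.interlace j (by lia) i hi)
  refine h1.trans ?_
  rw [Finset.sum_add_distrib, sum_diagonal]
  have h2 : ∑ i ∈ Finset.range (N + 1), p 0 i = 0 := by
    refine Finset.sum_eq_zero fun i hi => ?_
    rw [Finset.mem_range] at hi
    simp only [hp]
    rw [if_neg (by lia), hT.bot i (by lia), (hF i).zero_of_neg _ (by norm_num)]
  have h3 : ∑ i ∈ Finset.range (N + 1), q (K + 1 + 1) (i + 1) =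
      ∑ i ∈ Finset.range (N + 1), Function.leftLim (F i) Y := by
    refine Finset.sum_congr rfl fun i hi => ?_
    rw [Finset.mem_range] at hi
    simp only [hq]
    rw [if_neg (by lia), hT.top _ (by lia), Nat.add_sub_cancel]
  have h4 : ∀ j < K + 1, q (j + 1) (N + 1) = 0 := by
    intro j hj
    simp only [hq]
    rw [if_neg (by lia), hT.start j hj, (hF _).leftLim_of_nonpos le_rfl]
  have h5 : ∀ j < K + 1, ∀ i < N, ¬ (i + 1 < j + 1) →
      p (j + 1) (i + 1) - q (j + 1) (i + 1) ≤ 0 := by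
    intro j hj i hi hij
    simp only [hp, hq]
    rw [if_neg (by lia), if_neg (by lia), Nat.add_sub_cancel, sub_nonpos]
    exact hs i (by lia) _ (hT.start_le hj (by lia))
  rw [h2, h3, Finset.sum_range_succ _ K]
  have h6 : ∑ j ∈ Finset.range K, (p (j + 1) 0 - q (j + 1) (N + 1) +
      ∑ i ∈ Finset.range N, (p (j + 1) (i + 1) - q (j + 1) (i + 1))) ≤ 0 := by
    refine Finset.sum_nonpos fun j hj => ?_
    rw [Finset.mem_range] at hj
    rw [h4 j (by lia)]
    have : p (j + 1) 0 = 0 := if_pos (by lia)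
    rw [this, sub_zero, zero_add]
    refine Finset.sum_nonpos fun i hi => ?_
    rw [Finset.mem_range] at hi
    by_cases h : i + 1 < j + 1
    · have h7 : p (j + 1) (i + 1) = 0 := if_pos (by lia)
      have h8 : q (j + 1) (i + 1) = 0 := if_pos (by lia)
      rw [h7, h8, sub_zero]
    · exact h5 j (by lia) i hi h
  have h7 : p (K + 1) 0 = F 0 y := by
    simp only [hp]
    rw [if_neg (by lia), hT.finish K (by lia)]
  have h8 : ∑ i ∈ Finset.range N, (p (K + 1) (i + 1) - q (K + 1) (i + 1)) ≤
      ∑ i ∈ Finset.range N, (if i + 1 < K + 1 then F (i + 1) y else 0) := by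
    refine Finset.sum_le_sum fun i hi => ?_
    rw [Finset.mem_range] at hi
    split_ifs with h
    · simp only [hp, hq]
      rw [if_neg (by lia), if_pos (by lia), hT.eq_finish (by lia) (by lia) (by lia), sub_zero]
    · exact h5 K (by lia) i hi h
  have h9 := sum_range_ite_lt hk fun i => F i y
  rw [Finset.sum_range_succ', if_pos (by lia)] at h9
  rw [h4 K (by lia), h7, ← h9]
  linarith

theorem le_arrayLength_topArray (hF : ∀ i, IsLine (F i)) (hk : k ≤ n) (hk0 : 0 < k) (hy : 0 ≤ y)
    (hY : y < Y) :
    ∑ i ∈ Finset.range k, F i y ≤ arrayLength F n k Y (topArray k 0 y Y) := by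
  obtain ⟨K, rfl⟩ : ∃ K, k = K + 1 := ⟨k - 1, by lia⟩
  rw [← sum_range_ite_lt hk]
  refine Finset.sum_le_sum fun i _ => ?_
  rw [Finset.sum_range_succ, Finset.sum_range_succ']
  have h0 : topArray (K + 1) 0 y Y 0 i = -1 := rfl
  have h1 : topArray (K + 1) 0 y Y (0 + 1) (i + 1) = 0 := by simp [topArray]
  have h2 : topArray (K + 1) 0 y Y (K + 1 + 1) (i + 1) = Y := by simp [topArray]
  have h3 : topArray (K + 1) 0 y Y (K + 1) i = if i < K + 1 then y else 0 := by simp [topArray]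
  have h4 : ∀ j ∈ Finset.range K, gapTerm (F i) (topArray (K + 1) 0 y Y (j + 1) i)
      (topArray (K + 1) 0 y Y (j + 1 + 1) (i + 1)) = 0 := by
    intro j hj
    rw [Finset.mem_range] at hj
    have : topArray (K + 1) 0 y Y (j + 1) i = topArray (K + 1) 0 y Y (j + 1 + 1) (i + 1) := by
      simp [topArray, show ¬ K < j by lia, show ¬ K ≤ j by lia]
    rw [this, gapTerm_of_le le_rfl]
  rw [Finset.sum_eq_zero h4, h0, h1, h2, h3, (hF i).gapTerm_of_neg (by norm_num) le_rfl,
    (hF i).leftLim_of_nonpos le_rfl]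
  have h5 : 0 ≤ F i 0 := by
    have := (hF i).left_le 0
    rwa [(hF i).leftLim_of_nonpos le_rfl] at this
  split_ifs with h
  · rw [gapTerm_of_lt hY]
    linarith
  · rw [gapTerm_of_lt (hy.trans_lt hY)]
    linarith

/-- Last passage values from time `0` for ordered lines. -/
theorem IsSorted.lpp_eq (hs : IsSorted n F) (hF : ∀ i, IsLine (F i)) (hk : k ≤ n) (hy : 0 ≤ y) :
    lpp F n k 0 y = ∑ i ∈ Finset.range k, F i y := by
  rcases Nat.eq_zero_or_pos k with rfl | hk0
  · rw [lpp, multiLastPassage_zero, Finset.sum_range_zero]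
  · refine le_antisymm ?_ ?_
    · obtain ⟨T, hT, h⟩ := exists_isArray hF hk le_rfl hy (lt_add_one y)
      rw [← h]
      exact hs.arrayLength_le hF hk hk0 hT
    · exact (le_arrayLength_topArray hF hk hk0 hy (lt_add_one y)).trans
        ((isArray_topArray hk le_rfl hy (lt_add_one y)).length_le_lpp hF hk le_rfl hy
          (lt_add_one y))

theorem arrayLength_one (hF : ∀ i, IsLine (F i)) (hT : IsArray n 1 x y Y T) (hx : 0 ≤ x)
    (hY : y < Y) : arrayLength F n 1 Y T =
      ∑ i ∈ Finset.range n, (F i (T 1 i) - Function.leftLim (F i) (T 1 (i + 1))) := by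
  refine Finset.sum_congr rfl fun i hi => ?_
  rw [Finset.mem_range] at hi
  have h1 : x ≤ T (0 + 1) (i + 1) := hT.start_le zero_lt_one (by lia)
  have h2 : T (0 + 1) i ≤ y := hT.le_finish zero_lt_one (by lia)
  rw [zero_add] at h1 h2
  rw [Finset.sum_range_succ, Finset.sum_range_one, hT.top _ (by lia), hT.bot _ (by lia), zero_add,
    (hF i).gapTerm_of_neg (by norm_num) (hx.trans h1), gapTerm_of_lt (h2.trans_lt hY)]
  ring

theorem IsSorted.sum_le (hs : IsSorted n F) (τ : ℕ → ℝ) (hτ : ∀ i ≤ n, 0 ≤ τ i) (hm : m < n) :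
    ∑ i ∈ Finset.range (m + 1), (F i (τ i) - Function.leftLim (F i) (τ (i + 1))) ≤
      F 0 (τ 0) - Function.leftLim (F m) (τ (m + 1)) := by
  induction m with
  | zero => simp
  | succ m ih =>
    rw [Finset.sum_range_succ]
    have h1 := ih (by lia)
    have h2 := hs m hm _ (hτ (m + 1) (by lia))
    linarith

/-- By `IsSorted.sum_le`, moving among sorted lines never beats staying on the highest one. A path
therefore earns at most `F 0 s` until its jump to `g` at time `s`. -/
theorem lpp_one_cons_le {g : ℝ → ℝ} (hs : IsSorted n F) (hg : IsLine g)
    (hF : ∀ i, IsLine (F i)) (hn : 0 < n) (hy : 0 ≤ y) :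
    lpp (consLine g F) (n + 1) 1 0 y ≤ g y + runMax g (F 0) y := by
  have hG : ∀ i, IsLine (consLine g F i) := by
    rintro (_ | i)
    exacts [hg, hF i]
  obtain ⟨T, hT, h⟩ := exists_isArray hG (show 1 ≤ n + 1 by lia) le_rfl hy (lt_add_one y)
  obtain ⟨N, rfl⟩ : ∃ N, n = N + 1 := ⟨n - 1, by lia⟩
  rw [← h, arrayLength_one hG hT le_rfl (lt_add_one y), Finset.sum_range_succ']
  have h0 : ∀ i ≤ N + 1 + 1, 0 ≤ T 1 i := fun i hi => hT.start_le (j := 0) zero_lt_one hi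
  have h1 := hs.sum_le (fun i => T 1 (i + 1)) (fun i hi => h0 _ (by lia)) (Nat.lt_succ_self N)
  have h2 : T 1 (N + 1 + 1) = 0 := hT.start 0 zero_lt_one
  have h3 : T 1 0 = y := hT.finish 0 zero_lt_one
  have h4 : T 1 1 ≤ y := hT.le_finish (j := 0) zero_lt_one (by lia)
  simp only [h2, (hF N).leftLim_of_nonpos le_rfl] at h1
  have h5 := sub_leftLim_le_runMax hg (hF 0) (h0 1 (by lia)) h4
  simp only [consLine, zero_add, h3] at h1 ⊢
  linarith

/-- The test path reaches the second line at time `0`, stays there until `y`, and collects only the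
jump of the top line at `y`. -/
theorem le_lpp_one (hF : ∀ i, IsLine (F i)) (hy : 0 ≤ y) :
    F 0 y - Function.leftLim (F 0) y + F 1 y ≤ lpp F (n + 2) 1 0 y := by
  set T : ℕ → ℕ → ℝ := fun j i => if j = 0 then -1 else if 1 < j then y + 1 else
    if i ≤ 1 then y else 0 with hT
  have hA : IsArray (n + 2) 1 0 y (y + 1) T := by
    refine ⟨fun i _ => by simp [hT], fun i _ => by simp [hT], fun j hj => ?_,
      fun j hj => ?_, fun j hj i hi => ?_, fun j hj i hi => ?_⟩
    · obtain rfl : j = 0 := by lia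
      simp [hT]
    · obtain rfl : j = 0 := by lia
      simp [hT]
    · simp only [hT]
      split_ifs <;> first | lia | linarith
    · simp only [hT]
      split_ifs <;> first | lia | linarith
  refine le_trans ?_ (hA.length_le_lpp hF (by lia) le_rfl hy (lt_add_one y))
  rw [arrayLength_one hF hA le_rfl (lt_add_one y), Finset.sum_range_succ', Finset.sum_range_succ']
  have h0 : ∀ i, T 1 (i + 2) = 0 := fun i => by simp [hT]
  have h1 : T 1 1 = y := by simp [hT]
  have h2 : T 1 0 = y := by simp [hT]
  have h3 : 0 ≤ ∑ i ∈ Finset.range n, (F (i + 1 + 1) (T 1 (i + 1 + 1)) -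
      Function.leftLim (F (i + 1 + 1)) (T 1 (i + 1 + 1 + 1))) := by
    refine Finset.sum_nonneg fun i _ => ?_
    have h4 := (hF (i + 2)).left_le 0
    have h5 := h0 (i + 1)
    rw [h0 i, show i + 1 + 1 + 1 = i + 1 + 2 by ring, h0 (i + 1)]
    linarith
  have h4 := h0 0
  simp only [zero_add] at h4 ⊢
  rw [h1, h2, show 1 + 1 = 2 by rfl, h4, (hF 1).leftLim_of_nonpos le_rfl]
  linarith

/-- Every tuple of lines can be sorted by Pitman transforms. -/
theorem exists_isSorted (n : ℕ) (F : ℕ → ℝ → ℝ) (hF : ∀ i, IsLine (F i)) :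
    ∃ H, PitmanChain n F H ∧ IsSorted n H := by
  induction n generalizing F with
  | zero => exact ⟨F, Relation.ReflTransGen.refl, fun i hi => absurd hi (by lia)⟩
  | succ n ih =>
    rcases n with _ | n
    · exact ⟨F, Relation.ReflTransGen.refl, fun i hi => absurd hi (by lia)⟩
    obtain ⟨H₁, hc₁, hs₁⟩ := ih (fun i => F (i + 1)) fun i => hF (i + 1)
    have hH₁ := hc₁.isLine fun i => hF (i + 1)
    have hF₁ : ∀ i, IsLine (consLine (F 0) H₁ i) := by
      rintro (_ | i)
      exacts [hF 0, hH₁ i]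
    -- With the lower lines already sorted, one transform makes the top line an upper bound for the
    -- one-path values. Sorting the lower lines again leaves this top line and all values unchanged.
    set G := pitman 0 (consLine (F 0) H₁) with hG
    have hGl : ∀ i, IsLine (G i) := isLine_pitman hF₁ 0
    obtain ⟨H₂, hc₂, hs₂⟩ := ih (fun i => G (i + 1)) fun i => hGl (i + 1)
    have hH₂ := hc₂.isLine fun i => hGl (i + 1)
    have hcons : ∀ K : ℕ → ℝ → ℝ, consLine (K 0) (fun i => K (i + 1)) = K := by
      intro K
      funext i
      rcases i with _ | i <;> rfl
    have hH : ∀ i, IsLine (consLine (G 0) H₂ i) := by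
      rintro (_ | i)
      exacts [hGl 0, hH₂ i]
    have hc₁' := hc₁.cons (F 0)
    have hc₂' := hc₂.cons (G 0)
    rw [hcons] at hc₁' hc₂'
    have hc₃ : PitmanChain (n + 1 + 1) (consLine (F 0) H₁) (consLine (G 0) H₂) :=
      (Relation.ReflTransGen.single ⟨0, by lia, rfl⟩).trans hc₂'
    refine ⟨consLine (G 0) H₂, hc₁'.trans hc₃, ?_⟩
    rintro (_ | i) hi y hy
    · have h1 := lpp_one_cons_le hs₁ (hF 0) hH₁ (by lia) hy
      rw [← hc₃.lpp_eq hF₁ (show 1 ≤ n + 1 + 1 by lia) le_rfl hy] at h1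
      have h2 := le_lpp_one (n := n) hH hy
      have h3 : G 0 = fun y => F 0 y + runMax (F 0) (H₁ 0) y := pitman_left 0 _
      change H₂ 0 y ≤ Function.leftLim (G 0) y
      have h4 : consLine (G 0) H₂ 0 = G 0 := rfl
      have h5 : consLine (G 0) H₂ 1 = H₂ 0 := rfl
      rw [h4, h5] at h2
      have h6 : G 0 y = F 0 y + runMax (F 0) (H₁ 0) y := by rw [h3]
      linarith
    · exact hs₂ i (by lia) y hy

end

/-! ### The melon map -/

section

/-- The extension of a tuple of lines by zero lines. -/
def extendLines {n : ℕ} (f : Fin n → ℝ → ℝ) (i : ℕ) : ℝ → ℝ :=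
  if h : i < n then f ⟨i, h⟩ else fun _ => 0

theorem extendLines_coe {n : ℕ} (f : Fin n → ℝ → ℝ) : (fun i : Fin n => extendLines f i) = f := by
  funext i
  simp [extendLines]

theorem extendLines_apply {n : ℕ} (f : Fin n → ℝ → ℝ) (i : Fin n) : extendLines f i = f i :=
  congrFun (extendLines_coe f) i

theorem isLine_extendLines {n : ℕ} {f : Fin n → ℝ → ℝ} (hf : f ∈ cadlagSpace n) (i : ℕ) :
    IsLine (extendLines f i) := by
  unfold extendLines
  split_ifs with h
  · exact mem_cadlagSpace.1 hf _
  · exact isLine_zero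

theorem lpp_extendLines {n : ℕ} (f : Fin n → ℝ → ℝ) (k : ℕ) (x y : ℝ) :
    lpp (extendLines f) n k x y = multiLastPassage f k x y := by
  rw [lpp, extendLines_coe]

section melon

variable {n k : ℕ} {f : Fin n → ℝ → ℝ} {x y : ℝ}

theorem melon_eq_of_isSorted {H : ℕ → ℝ → ℝ} (hH : ∀ i, IsLine (H i)) (hs : IsSorted n H)
    (h : ∀ k ≤ n, ∀ y, 0 ≤ y → multiLastPassage f k 0 y = lpp H n k 0 y) :
    melon f = fun i : Fin n => H i := by
  funext i y
  unfold melon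
  split_ifs with hy
  · rw [(hH i).zero_of_neg y hy]
  · rw [not_lt] at hy
    rw [h _ i.2 y hy, h _ i.2.le y hy, hs.lpp_eq hH i.2 hy, hs.lpp_eq hH i.2.le hy,
      Finset.sum_range_succ]
    ring

/-- Sorting preserves values, and sorted lines are the increments in `k` of their values from time
`0`; hence the sorted lines are the melon. -/
theorem exists_melon_eq (hf : f ∈ cadlagSpace n) : ∃ H : ℕ → ℝ → ℝ, (∀ i, IsLine (H i)) ∧
    IsSorted n H ∧ (melon f = fun i : Fin n => H i) ∧
      ∀ k ≤ n, ∀ x y, 0 ≤ x → x ≤ y → lpp H n k x y = multiLastPassage f k x y := by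
  obtain ⟨H, hc, hs⟩ := exists_isSorted n _ (isLine_extendLines hf)
  have hH := hc.isLine (isLine_extendLines hf)
  have h : ∀ k ≤ n, ∀ x y, 0 ≤ x → x ≤ y → lpp H n k x y = multiLastPassage f k x y := by
    intro k hk x y hx hxy
    rw [hc.lpp_eq (isLine_extendLines hf) hk hx hxy, lpp_extendLines]
  exact ⟨H, hH, hs, melon_eq_of_isSorted hH hs fun k hk y hy => (h k hk 0 y le_rfl hy).symm, h⟩

/-- The melon map is an isometry. -/
theorem multiLastPassage_melon (hf : f ∈ cadlagSpace n) (hk : k ≤ n) (hx : 0 ≤ x) (hxy : x ≤ y) :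
    multiLastPassage (melon f) k x y = multiLastPassage f k x y := by
  obtain ⟨H, -, -, he, h⟩ := exists_melon_eq hf
  rw [he]
  exact h k hk x y hx hxy

theorem melon_mem_upSpace (hf : f ∈ cadlagSpace n) : melon f ∈ upSpace n := by
  obtain ⟨H, hH, hs, he, -⟩ := exists_melon_eq hf
  rw [he]
  refine ⟨mem_cadlagSpace.2 fun i => hH i, fun i j hij y hy => ?_⟩
  simp only [hij]
  exact hs i (by rw [← hij]; exact j.2) y hy

theorem melon_mem (hf : f ∈ cadlagSpace n) : melon f ∈ cadlagSpace n := (melon_mem_upSpace hf).1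

theorem melon_eq_self (hf : f ∈ upSpace n) : melon f = f := by
  have hs : IsSorted n (extendLines f) := by
    intro i hi y hy
    have := hf.2 ⟨i, by lia⟩ ⟨i + 1, hi⟩ rfl y hy
    simpa [extendLines, hi, show i < n by lia] using this
  rw [melon_eq_of_isSorted (isLine_extendLines hf.1) hs fun k _ y _ =>
    (lpp_extendLines f k 0 y).symm, extendLines_coe]

theorem melon_congr {g : Fin n → ℝ → ℝ}
    (h : ∀ k ≤ n, ∀ y, 0 ≤ y → multiLastPassage f k 0 y = multiLastPassage g k 0 y) :
    melon f = melon g := by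
  funext i y
  unfold melon
  split_ifs with hy
  · rfl
  · rw [not_lt] at hy
    rw [h _ i.2 y hy, h _ i.2.le y hy]

end melon

/-! ### Rotations -/

/-- The rotation of a single line. -/
def rotateLine (t : ℝ) (g : ℝ → ℝ) (x : ℝ) : ℝ :=
  if x < 0 then 0 else g t - Function.leftLim g (t - x)

theorem rotate_eq {n : ℕ} (t : ℝ) (f : Fin n → ℝ → ℝ) (i : Fin n) :
    rotate t f i = rotateLine t (f i.rev) := rfl

section rotateLine

variable {g : ℝ → ℝ} {t x : ℝ}

theorem rotateLine_of_nonneg (hx : 0 ≤ x) :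
    rotateLine t g x = g t - Function.leftLim g (t - x) := if_neg hx.not_gt

theorem tendsto_sub_nhdsGT (t x : ℝ) : Tendsto (fun z => t - z) (𝓝[<] x) (𝓝[>] (t - x)) := by
  refine tendsto_nhdsWithin_iff.2 ⟨?_, ?_⟩
  · exact ((continuous_const.sub continuous_id).tendsto x).mono_left nhdsWithin_le_nhds
  · filter_upwards [self_mem_nhdsWithin] with z hz
    exact sub_lt_sub_left hz t

theorem tendsto_sub_nhdsLE (t x : ℝ) : Tendsto (fun z => t - z) (𝓝[≥] x) (𝓝[≤] (t - x)) := by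
  refine tendsto_nhdsWithin_iff.2 ⟨?_, ?_⟩
  · exact ((continuous_const.sub continuous_id).tendsto x).mono_left nhdsWithin_le_nhds
  · filter_upwards [self_mem_nhdsWithin] with z hz
    exact sub_le_sub_left hz t

/-- Reflection exchanges the two sides, and approaching a point from the right the left limits of
`g` tend to its value. At `x = 0` both sides vanish. -/
theorem tendsto_rotateLine_left (hg : IsLine g) (hx : 0 ≤ x) :
    Tendsto (rotateLine t g) (𝓝[<] x) (𝓝 (g t - g (t - x))) := by
  rcases hx.eq_or_lt with rfl | hx
  · rw [sub_zero, sub_self]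
    refine Tendsto.congr' ?_ tendsto_const_nhds
    filter_upwards [self_mem_nhdsWithin] with z hz
    exact (if_pos hz).symm
  · have h := ((hg.leftLim_tendsto_right (t - x)).comp (tendsto_sub_nhdsGT t x)).const_sub (g t)
    refine Tendsto.congr' ?_ h
    filter_upwards [Ioo_mem_nhdsLT hx] with z hz
    exact (rotateLine_of_nonneg hz.1.le).symm

theorem leftLim_rotateLine (hg : IsLine g) (hx : 0 ≤ x) :
    Function.leftLim (rotateLine t g) x = g t - g (t - x) :=
  leftLim_eq_of_tendsto (tendsto_rotateLine_left hg hx)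

theorem isLine_rotateLine (hg : IsLine g) (t : ℝ) : IsLine (rotateLine t g) := by
  have hneg : ∀ x < 0, Tendsto (rotateLine t g) (𝓝 x) (𝓝 0) := by
    intro x hx
    refine Tendsto.congr' ?_ tendsto_const_nhds
    filter_upwards [Iio_mem_nhds hx] with z hz
    exact (if_pos hz).symm
  refine ⟨fun x hx => if_pos hx, fun x => ?_, fun x => ?_, fun x => ?_⟩
  · rcases lt_or_ge x 0 with hx | hx
    · have : rotateLine t g x = 0 := if_pos hx
      rw [ContinuousWithinAt, this]
      exact (hneg x hx).mono_left nhdsWithin_le_nhds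
    · rw [ContinuousWithinAt, rotateLine_of_nonneg hx]
      have h := (Tendsto.comp (continuousWithinAt_leftLim_Iic (hg.tendsto_left (t - x)))
        (tendsto_sub_nhdsLE t x)).const_sub (g t)
      refine Tendsto.congr' ?_ h
      filter_upwards [self_mem_nhdsWithin] with z hz
      exact (rotateLine_of_nonneg (le_trans hx hz)).symm
  · rcases lt_or_ge x 0 with hx | hx
    · exact ⟨0, (hneg x hx).mono_left nhdsWithin_le_nhds⟩
    · exact ⟨_, tendsto_rotateLine_left hg hx⟩
  · rcases lt_or_ge x 0 with hx | hx
    · rw [leftLim_eq_of_tendsto ((hneg x hx).mono_left nhdsWithin_le_nhds), rotateLine, if_pos hx]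
    · rw [leftLim_rotateLine hg hx, rotateLine_of_nonneg hx]
      linarith [hg.left_le (t - x)]

end rotateLine

theorem rotate_mem {n : ℕ} {f : Fin n → ℝ → ℝ} (hf : f ∈ cadlagSpace n) (t : ℝ) :
    rotate t f ∈ cadlagSpace n :=
  mem_cadlagSpace.2 fun i => isLine_rotateLine (mem_cadlagSpace.1 hf i.rev) t

/-- The rotation of an array of jump times. -/
def rotateArray (n k : ℕ) (t : ℝ) (T : ℕ → ℕ → ℝ) (j i : ℕ) : ℝ :=
  if j = 0 then -1 else if k < j then t + 1 else t - T (k + 1 - j) (n - i)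

section

variable {F : ℕ → ℝ → ℝ} {n k : ℕ} {x y t : ℝ} {T : ℕ → ℕ → ℝ}

theorem rotateArray_succ {j : ℕ} (hj : j < k) (i : ℕ) :
    rotateArray n k t T (j + 1) i = t - T (k - 1 - j + 1) (n - i) := by
  rw [rotateArray, if_neg (by lia), if_neg (by lia), show k + 1 - (j + 1) = k - 1 - j + 1 by lia]

theorem IsArray.rotate (hT : IsArray n k x y (t + 1) T) (hx : 0 ≤ x) (hxy : x ≤ y) (hy : y ≤ t) :
    IsArray n k (t - y) (t - x) (t + 1) (rotateArray n k t T) := by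
  refine ⟨fun i _ => rfl, fun i _ => by simp [rotateArray], fun j hj => ?_, fun j hj => ?_,
    fun j hj i hi => ?_, fun j hj i hi => ?_⟩
  · rw [rotateArray_succ hj, Nat.sub_self, hT.finish _ (by lia)]
  · rw [rotateArray_succ hj, Nat.sub_zero, hT.start _ (by lia)]
  · rw [rotateArray_succ hj, rotateArray_succ hj]
    exact sub_le_sub_left (hT.anti_le (by lia) (by lia) (by lia)) t
  · rcases j with _ | j
    · have h0 : rotateArray n k t T 0 i = -1 := rfl
      rw [h0]
      rcases Nat.eq_zero_or_pos k with rfl | hk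
      · have : rotateArray n 0 t T (0 + 1) (i + 1) = t + 1 := by simp [rotateArray]
        rw [this]
        linarith
      · rw [rotateArray_succ hk]
        have := hT.le_finish (j := k - 1 - 0) (i := n - (i + 1)) (by lia) (by lia)
        linarith
    · rw [rotateArray_succ (show j < k by lia)]
      rcases hj.lt_or_eq with hj | rfl
      · rw [rotateArray_succ hj]
        have := hT.interlace (k - 1 - (j + 1) + 1) (by lia) (n - (i + 1)) (by lia)
        rw [show k - 1 - (j + 1) + 1 + 1 = k - 1 - j + 1 by lia,
          show n - (i + 1) + 1 = n - i by lia] at this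
        linarith
      · have h1 : rotateArray n (j + 1) t T (j + 1 + 1) (i + 1) = t + 1 := by simp [rotateArray]
        have := hT.start_le (j := j + 1 - 1 - j) (i := n - i) (by lia) (by lia)
        rw [h1]
        linarith

/-- Reversing rows, columns and time turns gaps into gaps and exchanges the two padding rows. The
choice `Y = t + 1` lies beyond `t`, where the rotated line is constantly `g t`. -/
theorem arrayLength_rotate (hF : ∀ i, IsLine (F i)) (hT : IsArray n k x y (t + 1) T)
    (hk : 0 < k) (hx : 0 ≤ x) (hxy : x ≤ y) (hy : y ≤ t) :
    arrayLength (fun i => rotateLine t (F (n - 1 - i))) n k (t + 1) T =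
      arrayLength F n k (t + 1) (rotateArray n k t T) := by
  unfold arrayLength
  rw [← Finset.sum_range_reflect (fun i => ∑ j ∈ Finset.range (k + 1), gapTerm (F i)
    (rotateArray n k t T j i) (rotateArray n k t T (j + 1) (i + 1)) +
      Function.leftLim (F i) (t + 1))]
  refine Finset.sum_congr rfl fun i hi => ?_
  rw [Finset.mem_range] at hi
  beta_reduce
  have hg := hF (n - 1 - i)
  set g := F (n - 1 - i) with hgdef
  obtain ⟨K, rfl⟩ : ∃ K, k = K + 1 := ⟨k - 1, by lia⟩
  rw [← Finset.sum_range_reflect (fun j => gapTerm g _ _)]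
  rw [Finset.sum_range_succ, Finset.sum_range_succ', Finset.sum_range_succ, Finset.sum_range_succ']
  have hmid : ∑ j ∈ Finset.range K,
      gapTerm (rotateLine t g) (T (j + 1) i) (T (j + 1 + 1) (i + 1)) =
      ∑ j ∈ Finset.range K, gapTerm g
        (rotateArray n (K + 1) t T (K + 1 + 1 - 1 - (j + 1)) (n - 1 - i))
        (rotateArray n (K + 1) t T (K + 1 + 1 - 1 - (j + 1) + 1) (n - 1 - i + 1)) := by
    refine Finset.sum_congr rfl fun j hj => ?_
    rw [Finset.mem_range] at hj
    have e1 : rotateArray n (K + 1) t T (K + 1 + 1 - 1 - (j + 1)) (n - 1 - i) =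
        t - T (j + 1 + 1) (i + 1) := by
      rw [show K + 1 + 1 - 1 - (j + 1) = K - j - 1 + 1 by lia, rotateArray_succ (by lia),
        show K + 1 - 1 - (K - j - 1) = j + 1 by lia, show n - (n - 1 - i) = i + 1 by lia]
    have e2 : rotateArray n (K + 1) t T (K + 1 + 1 - 1 - (j + 1) + 1) (n - 1 - i + 1) =
        t - T (j + 1) i := by
      rw [rotateArray_succ (by lia), show K + 1 - 1 - (K + 1 + 1 - 1 - (j + 1)) = j by lia,
        show n - (n - 1 - i + 1) = i by lia]
    rw [e1, e2]
    have h1 : 0 ≤ T (j + 1) i := hx.trans (hT.start_le (by lia) (by lia))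
    rcases lt_or_ge (T (j + 1) i) (T (j + 1 + 1) (i + 1)) with h | h
    · rw [gapTerm_of_lt h, gapTerm_of_lt (by linarith), rotateLine_of_nonneg h1,
        leftLim_rotateLine hg (h1.trans h.le)]
      ring
    · rw [gapTerm_of_le h, gapTerm_of_le (by linarith)]
  rw [hmid]
  have a1 : 0 ≤ T (0 + 1) (i + 1) := hx.trans (hT.start_le (by lia) (by lia))
  have a2 : T (0 + 1) (i + 1) ≤ t := (hT.le_finish (by lia) (by lia)).trans hy
  have a3 : 0 ≤ T (K + 1) i := hx.trans (hT.start_le (by lia) (by lia))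
  have a4 : T (K + 1) i ≤ t := (hT.le_finish (by lia) (by lia)).trans hy
  have e1 : rotateArray n (K + 1) t T (K + 1 + 1 - 1 - 0) (n - 1 - i) =
      t - T (0 + 1) (i + 1) := by
    rw [show K + 1 + 1 - 1 - 0 = K + 1 by lia, rotateArray_succ (by lia),
      show K + 1 - 1 - K + 1 = 0 + 1 by lia, show n - (n - 1 - i) = i + 1 by lia]
  have e2 : rotateArray n (K + 1) t T (K + 1 + 1 - 1 - 0 + 1) (n - 1 - i + 1) = t + 1 := by
    simp [rotateArray]
  have e3 : rotateArray n (K + 1) t T (K + 1 + 1 - 1 - (K + 1)) (n - 1 - i) = -1 := by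
    simp [rotateArray]
  have e4 : rotateArray n (K + 1) t T (K + 1 + 1 - 1 - (K + 1) + 1) (n - 1 - i + 1) =
      t - T (K + 1) i := by
    rw [show K + 1 + 1 - 1 - (K + 1) + 1 = 0 + 1 by lia, rotateArray_succ (by lia),
      show K + 1 - 1 - 0 + 1 = K + 1 by lia, show n - (n - 1 - i + 1) = i by lia]
  have e5 : Function.leftLim (rotateLine t g) (t + 1) = g t := by
    rw [leftLim_rotateLine hg (by linarith), hg.zero_of_neg (t - (t + 1)) (by linarith), sub_zero]
  rw [e1, e2, e3, e4, e5, hT.bot i hi.le, hT.top (i + 1) hi,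
    (isLine_rotateLine hg t).gapTerm_of_neg (by norm_num) a1, gapTerm_of_lt (by linarith),
    gapTerm_of_lt (by linarith), hg.gapTerm_of_neg (by norm_num) (by linarith),
    leftLim_rotateLine hg a1, e5, rotateLine_of_nonneg a3]
  ring

theorem lpp_rotate (hF : ∀ i, IsLine (F i)) (hk : k ≤ n) (hx : 0 ≤ x) (hxy : x ≤ y)
    (hy : y ≤ t) : lpp (fun i => rotateLine t (F (n - 1 - i))) n k x y =
      lpp F n k (t - y) (t - x) := by
  rcases Nat.eq_zero_or_pos k with rfl | hk0
  · simp only [lpp, multiLastPassage_zero]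
  have hR : ∀ i, IsLine (rotateLine t (F (n - 1 - i))) := fun i => isLine_rotateLine (hF _) t
  refine le_antisymm ?_ ?_
  · obtain ⟨T, hT, h⟩ := exists_isArray hR hk hx hxy (show y < t + 1 by linarith)
    rw [← h, arrayLength_rotate hF hT hk0 hx hxy hy]
    exact (hT.rotate hx hxy hy).length_le_lpp hF hk (by linarith) (by linarith) (by linarith)
  · obtain ⟨S, hS, h⟩ := exists_isArray hF hk (show 0 ≤ t - y by linarith)
      (show t - y ≤ t - x by linarith) (show t - x < t + 1 by linarith)
    have hT := hS.rotate (by linarith) (by linarith) (show t - x ≤ t by linarith)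
    rw [sub_sub_cancel, sub_sub_cancel] at hT
    have hlen := arrayLength_rotate hF hT hk0 hx hxy hy
    -- Rotating an array twice gives it back, so an optimizer for `F` is the rotation of an array
    -- for the rotated lines.
    have hSS : arrayLength F n k (t + 1) (rotateArray n k t (rotateArray n k t S)) =
        arrayLength F n k (t + 1) S := by
      refine arrayLength_congr F _ fun j hj i hi => ?_
      rcases j with _ | j
      · rw [hS.bot i hi]
        rfl
      · rcases (show j < k ∨ j = k by lia) with hj | rfl
        · rw [rotateArray_succ hj, rotateArray_succ (by lia), sub_sub_cancel,
            show k - 1 - (k - 1 - j) + 1 = j + 1 by lia, show n - (n - i) = i by lia]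
        · rw [hS.top i hi]
          simp [rotateArray]
    rw [← h, ← hSS, ← hlen]
    exact hT.length_le_lpp hR hk hx hxy (by linarith)

/-- Last passage values after a rotation. -/
theorem multiLastPassage_rotate {f : Fin n → ℝ → ℝ} (hf : f ∈ cadlagSpace n) (hk : k ≤ n)
    (hx : 0 ≤ x) (hxy : x ≤ y) (hy : y ≤ t) :
    multiLastPassage (rotate t f) k x y = multiLastPassage f k (t - y) (t - x) := by
  have h := lpp_rotate (isLine_extendLines hf) hk hx hxy hy
  rw [lpp_extendLines] at h
  rw [← h, lpp]
  congr 1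
  funext i
  rw [rotate_eq, ← extendLines_apply f, Fin.val_rev, show n - (i.val + 1) = n - 1 - i.val by lia]

end

end

/-! ### Lattice structure of arrays and the quadrangle inequality -/

section

section

variable {F : ℕ → ℝ → ℝ} {n k : ℕ} {x y x' y' t t' Y : ℝ} {T S : ℕ → ℕ → ℝ}

theorem IsArray.min (hT : IsArray n k x y Y T) (hS : IsArray n k x' y' Y S) :
    IsArray n k (min x x') (min y y') Y fun j i => min (T j i) (S j i) where
  bot i hi := by rw [hT.bot i hi, hS.bot i hi, min_self]
  top i hi := by rw [hT.top i hi, hS.top i hi, min_self]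
  start j hj := by rw [hT.start j hj, hS.start j hj]
  finish j hj := by rw [hT.finish j hj, hS.finish j hj]
  anti j hj i hi := min_le_min (hT.anti j hj i hi) (hS.anti j hj i hi)
  interlace j hj i hi := min_le_min (hT.interlace j hj i hi) (hS.interlace j hj i hi)

theorem IsArray.max (hT : IsArray n k x y Y T) (hS : IsArray n k x' y' Y S) :
    IsArray n k (max x x') (max y y') Y fun j i => max (T j i) (S j i) where
  bot i hi := by rw [hT.bot i hi, hS.bot i hi, max_self]
  top i hi := by rw [hT.top i hi, hS.top i hi, max_self]
  start j hj := by rw [hT.start j hj, hS.start j hj]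
  finish j hj := by rw [hT.finish j hj, hS.finish j hj]
  anti j hj i hi := max_le_max (hT.anti j hj i hi) (hS.anti j hj i hi)
  interlace j hj i hi := max_le_max (hT.interlace j hj i hi) (hS.interlace j hj i hi)

/-- Supermodularity of the length. -/
theorem IsArray.length_add_le (hF : ∀ i, IsLine (F i)) (hT : IsArray n k x y Y T)
    (hS : IsArray n k x' y' Y S) : arrayLength F n k Y T + arrayLength F n k Y S ≤
      arrayLength F n k Y (fun j i => Min.min (T j i) (S j i)) +
        arrayLength F n k Y fun j i => Max.max (T j i) (S j i) := by
  unfold arrayLength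
  rw [← Finset.sum_add_distrib, ← Finset.sum_add_distrib]
  refine Finset.sum_le_sum fun i hi => ?_
  rw [Finset.mem_range] at hi
  have : ∑ j ∈ Finset.range (k + 1), gapTerm (F i) (T j i) (T (j + 1) (i + 1)) +
      ∑ j ∈ Finset.range (k + 1), gapTerm (F i) (S j i) (S (j + 1) (i + 1)) ≤
      ∑ j ∈ Finset.range (k + 1), gapTerm (F i) (Min.min (T j i) (S j i))
        (Min.min (T (j + 1) (i + 1)) (S (j + 1) (i + 1))) +
      ∑ j ∈ Finset.range (k + 1), gapTerm (F i) (Max.max (T j i) (S j i))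
        (Max.max (T (j + 1) (i + 1)) (S (j + 1) (i + 1))) := by
    rw [← Finset.sum_add_distrib, ← Finset.sum_add_distrib]
    refine Finset.sum_le_sum fun j hj => ?_
    rw [Finset.mem_range] at hj
    exact (hF i).gapTerm_add_le (hT.interlace j (by lia) i hi) (hS.interlace j (by lia) i hi)
  linarith

/-- The quadrangle inequality. -/
theorem lpp_quadrangle (hF : ∀ i, IsLine (F i)) (hk : k ≤ n) (hx : 0 ≤ x) (hxx : x ≤ x')
    (hxt : x' ≤ t) (htt : t ≤ t') :
    lpp F n k x t' + lpp F n k x' t ≤ lpp F n k x t + lpp F n k x' t' := by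
  have hY : t' < t' + 1 := lt_add_one t'
  obtain ⟨T, hT, h1⟩ := exists_isArray hF hk hx (show x ≤ t' by linarith) hY
  obtain ⟨S, hS, h2⟩ := exists_isArray hF hk (hx.trans hxx) hxt (show t < t' + 1 by linarith)
  have hmin := hT.min hS
  have hmax := hT.max hS
  rw [min_eq_left hxx, min_eq_right htt] at hmin
  rw [max_eq_right hxx, max_eq_left htt] at hmax
  rw [← h1, ← h2]
  exact (hT.length_add_le hF hS).trans (add_le_add
    (hmin.length_le_lpp hF hk hx (hxx.trans hxt) (by linarith))
    (hmax.length_le_lpp hF hk (hx.trans hxx) (hxt.trans htt) hY))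

/-! ### Lowest constant paths and Busemann functions -/

/-- The lowest constant paths. -/
def bottomArray (n k : ℕ) (t Y : ℝ) (j i : ℕ) : ℝ :=
  if j = 0 then -1 else if k < j then Y else if n - k + (j - 1) < i then 0 else t

theorem bottomArray_succ {j : ℕ} (hj : j < k) (i : ℕ) :
    bottomArray n k t Y (j + 1) i = if n - k + j < i then 0 else t := by
  rw [bottomArray, if_neg (by lia), if_neg (by lia), Nat.add_sub_cancel]

theorem isArray_bottomArray (hk : k ≤ n) (ht : 0 ≤ t) (hY : t < Y) :
    IsArray n k 0 t Y (bottomArray n k t Y) := by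
  refine ⟨fun i _ => rfl, fun i _ => by simp [bottomArray], fun j hj => ?_,
    fun j hj => ?_, fun j hj i hi => ?_, fun j hj i hi => ?_⟩
  · rw [bottomArray_succ hj, if_pos (by lia)]
  · rw [bottomArray_succ hj, if_neg (by lia)]
  · rw [bottomArray_succ hj, bottomArray_succ hj]
    split_ifs <;> first | lia | linarith
  · simp only [bottomArray]
    split_ifs <;> first | lia | linarith

/-- The sum of the left limits of the lowest `k` lines. -/
def bottomSum (F : ℕ → ℝ → ℝ) (n k : ℕ) (x : ℝ) : ℝ :=
  ∑ i ∈ Finset.range n, if n - k ≤ i then Function.leftLim (F i) x else 0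

/-- Following the lowest constant paths up to time `x` and a tuple of paths afterwards. -/
theorem IsArray.length_min_bottomArray (hF : ∀ i, IsLine (F i)) (hT : IsArray n k x t Y T)
    (hk : k ≤ n) (hk0 : 0 < k) (hx : 0 ≤ x) :
    arrayLength F n k Y (fun j i => Min.min (T j i) (bottomArray n k t Y j i)) =
      arrayLength F n k Y T + bottomSum F n k x := by
  unfold arrayLength bottomSum
  rw [← Finset.sum_add_distrib]
  refine Finset.sum_congr rfl fun i hi => ?_
  rw [Finset.mem_range] at hi
  rw [Finset.sum_range_succ', Finset.sum_range_succ' _ k]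
  have h1 : ∑ j ∈ Finset.range k, gapTerm (F i)
      (Min.min (T (j + 1) i) (bottomArray n k t Y (j + 1) i))
      (Min.min (T (j + 1 + 1) (i + 1)) (bottomArray n k t Y (j + 1 + 1) (i + 1))) =
      ∑ j ∈ Finset.range k, gapTerm (F i) (T (j + 1) i) (T (j + 1 + 1) (i + 1)) := by
    refine Finset.sum_congr rfl fun j hj => ?_
    rw [Finset.mem_range] at hj
    rw [bottomArray_succ hj]
    rcases (show j + 1 < k ∨ j + 1 = k by lia) with hj' | rfl
    · rw [bottomArray_succ hj']
      by_cases h : n - k + j < i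
      · rw [if_pos h, if_pos (by lia), hT.eq_start (by lia) hj (by lia),
          hT.eq_start (by lia) hj' (by lia), gapTerm_of_le le_rfl, gapTerm_of_le le_rfl]
      · rw [if_neg h, if_neg (by lia), min_eq_left (hT.le_finish hj (by lia)),
          min_eq_left (hT.le_finish hj' (by lia))]
    · have h2 : bottomArray n (j + 1) t Y (j + 1 + 1) (i + 1) = Y := by simp [bottomArray]
      rw [if_neg (by lia), min_eq_left (hT.le_finish hj (by lia)), h2, hT.top _ (by lia), min_self]
  have h2 : bottomArray n k t Y 0 i = -1 := rfl
  have h3 : (0 : ℝ) ≤ T (0 + 1) (i + 1) := hx.trans (hT.start_le hk0 (by lia))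
  beta_reduce
  rw [h1, h2, hT.bot i hi.le, min_self, bottomArray_succ hk0,
    (hF i).gapTerm_of_neg (b := -1) (a := T _ _) (by norm_num) h3]
  -- Only the first gap changes, and only on the lowest `k` lines: there the first path present on
  -- the line has entrance time `x`, which is replaced by `0`, gaining `F i (x⁻)`.
  by_cases h : n - k ≤ i
  · rw [if_pos (by lia), if_pos h, min_eq_right h3, hT.eq_start (by lia) hk0 (by lia),
      (hF i).gapTerm_of_neg (by norm_num) le_rfl, (hF i).leftLim_of_nonpos le_rfl]
    ring
  · rw [if_neg (by lia), if_neg h, min_eq_left (hT.le_finish hk0 (by lia)),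
      (hF i).gapTerm_of_neg (by norm_num) h3]
    ring

theorem bottomSum_zero_right (F : ℕ → ℝ → ℝ) (n : ℕ) (x : ℝ) : bottomSum F n 0 x = 0 := by
  refine Finset.sum_eq_zero fun i hi => if_neg ?_
  rw [Finset.mem_range] at hi
  lia

theorem lpp_zero (F : ℕ → ℝ → ℝ) (n : ℕ) (x y : ℝ) : lpp F n 0 x y = 0 :=
  multiLastPassage_zero _ x y

theorem IsArray.min_bottomArray (hT : IsArray n k x t Y T) (hk : k ≤ n) (hx : 0 ≤ x) (hxt : x ≤ t)
    (hY : t < Y) : IsArray n k 0 t Y fun j i => Min.min (T j i) (bottomArray n k t Y j i) := by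
  have h := hT.min (isArray_bottomArray hk (hx.trans hxt) hY)
  rwa [min_eq_right hx, min_self] at h

/-- Following the `k` lowest lines up to `x` and an optimizer afterwards is an admissible tuple from
`0`. -/
theorem lpp_add_bottomSum_le (hF : ∀ i, IsLine (F i)) (hk : k ≤ n) (hx : 0 ≤ x) (hxt : x ≤ t) :
    lpp F n k x t + bottomSum F n k x ≤ lpp F n k 0 t := by
  rcases Nat.eq_zero_or_pos k with rfl | hk0
  · rw [lpp_zero, lpp_zero, bottomSum_zero_right, add_zero]
  obtain ⟨T, hT, h⟩ := exists_isArray hF hk hx hxt (lt_add_one t)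
  rw [← h, ← hT.length_min_bottomArray hF hk hk0 hx]
  exact (hT.min_bottomArray hk hx hxt (lt_add_one t)).length_le_lpp hF hk le_rfl (hx.trans hxt)
    (lt_add_one t)

/-- A tuple of paths which follows the lowest constant paths up to time `x`. -/
theorem IsArray.length_le_of_le (hF : ∀ i, IsLine (F i)) (hT : IsArray n k 0 t Y T)
    (hk : k ≤ n) (hk0 : 0 < k) (hx : 0 ≤ x) (hxt : x ≤ t) (hY : t < Y)
    (h : ∀ j < k, ∀ i ≤ n - k + j, x ≤ T (j + 1) i) :
    arrayLength F n k Y T ≤ lpp F n k x t + bottomSum F n k x := by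
  -- The second array has all its paths concentrated at time `x`, so the maximum cuts `T` off at
  -- `x`. Taking the minimum with the lowest paths restores `T`.
  have hS := hT.max (isArray_topArray hk hx (le_refl x) (hxt.trans_lt hY))
  rw [max_eq_right hx, max_eq_left hxt] at hS
  refine le_trans (le_of_eq ?_) (add_le_add (hS.length_le_lpp hF hk hx hxt hY) le_rfl)
  rw [← hS.length_min_bottomArray hF hk hk0 hx]
  refine arrayLength_congr F Y fun j hj i hi => ?_
  rcases j with _ | j
  · rw [hT.bot i hi]
    simp [topArray, bottomArray]
  · rcases (show j < k ∨ j = k by lia) with hj | rfl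
    · have h1 : topArray k x x Y (j + 1) i = x := by simp [topArray, show ¬ k < j + 1 by lia]
      rw [bottomArray_succ hj, h1]
      split_ifs with h2
      · rw [hT.eq_start (by lia) hj hi, max_eq_right hx, min_eq_right hx]
      · rw [max_eq_left (h j hj i (by lia)), min_eq_left (hT.le_finish hj hi)]
    · rw [hT.top i hi]
      simp [topArray, bottomArray]

/-- The last passage value lost by starting at time `x` instead of time `0`. -/
def lppLoss (F : ℕ → ℝ → ℝ) (n k : ℕ) (x t : ℝ) : ℝ := lpp F n k 0 t - lpp F n k x t

theorem bottomSum_le_lppLoss (hF : ∀ i, IsLine (F i)) (hk : k ≤ n) (hx : 0 ≤ x) (hxt : x ≤ t) :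
    bottomSum F n k x ≤ lppLoss F n k x t := by
  have := lpp_add_bottomSum_le hF hk hx hxt
  unfold lppLoss
  linarith

theorem lppLoss_anti (hF : ∀ i, IsLine (F i)) (hk : k ≤ n) (hx : 0 ≤ x) (hxt : x ≤ t)
    (htt : t ≤ t') : lppLoss F n k x t' ≤ lppLoss F n k x t := by
  have := lpp_quadrangle hF hk le_rfl hx hxt htt
  unfold lppLoss
  linarith

/-- The quadrangle inequality makes the decrement in `t` monotone in the starting time. Convergence
at `x'` thus controls all `x ≤ x'` uniformly. -/
theorem abs_lppLoss_sub_le (hF : ∀ i, IsLine (F i)) (hk : k ≤ n) (hx : 0 ≤ x) (hxx : x ≤ x')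
    (hxt : x' ≤ t) (htt : t ≤ t') : |lppLoss F n k x t - lppLoss F n k x t'| ≤
      lppLoss F n k x' t - lppLoss F n k x' t' := by
  rw [abs_of_nonneg (sub_nonneg.2 (lppLoss_anti hF hk hx (hxx.trans hxt) htt))]
  have := lpp_quadrangle hF hk hx hxx hxt htt
  unfold lppLoss
  linarith

/-- The Busemann function of `k`-tuples of paths. -/
def busemann (F : ℕ → ℝ → ℝ) (n k : ℕ) (x : ℝ) : ℝ := limUnder atTop (lppLoss F n k x)

/-- The loss is decreasing in `t` and bounded below by `bottomSum`, but only for `t ≥ x`, whence the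
truncation of `t` at `x`. -/
theorem tendsto_busemann (hF : ∀ i, IsLine (F i)) (hk : k ≤ n) (hx : 0 ≤ x) :
    Tendsto (lppLoss F n k x) atTop (𝓝 (busemann F n k x)) := by
  refine tendsto_nhds_limUnder ⟨_, Tendsto.congr' ?_ (tendsto_atTop_ciInf
    (f := fun t => lppLoss F n k x (Max.max t x)) ?_ ⟨bottomSum F n k x, ?_⟩)⟩
  · filter_upwards [eventually_ge_atTop x] with t ht
    rw [max_eq_left ht]
  · intro t t' htt
    exact lppLoss_anti hF hk hx (le_max_right _ _) (max_le_max htt le_rfl)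
  · rintro _ ⟨t, rfl⟩
    exact bottomSum_le_lppLoss hF hk hx (le_max_right _ _)

/-- Lengths depend continuously on the lines. -/
theorem abs_arrayLength_sub_le {G : ℕ → ℝ → ℝ} {ε : ℝ} (hF : ∀ i, IsLine (F i))
    (hG : ∀ i, IsLine (G i)) (hε : 0 ≤ ε) (h : ∀ i, ∀ z < Y, |F i z - G i z| ≤ ε)
    (hT : IsArray n k x y Y T) (hy : y ≤ Y) :
    |arrayLength F n k Y T - arrayLength G n k Y T| ≤ n * ((k + 1) * (2 * ε) + ε) := by
  unfold arrayLength
  rw [← Finset.sum_sub_distrib]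
  refine (Finset.abs_sum_le_sum_abs _ _).trans ((Finset.sum_le_card_nsmul _ _
    ((k + 1) * (2 * ε) + ε) fun i hi => ?_).trans_eq (by rw [Finset.card_range, nsmul_eq_mul]))
  rw [Finset.mem_range] at hi
  rw [add_sub_add_comm, ← Finset.sum_sub_distrib]
  refine (abs_add_le _ _).trans (add_le_add ((Finset.abs_sum_le_sum_abs _ _).trans ?_)
    ((hF i).abs_leftLim_sub_le (hG i) (h i)))
  rw [show ((k : ℝ) + 1) * (2 * ε) = ∑ j ∈ Finset.range (k + 1), 2 * ε by
    rw [Finset.sum_const, Finset.card_range, nsmul_eq_mul]; push_cast; ring]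
  refine Finset.sum_le_sum fun j hj => ?_
  rw [Finset.mem_range] at hj
  have hle : T (j + 1) (i + 1) ≤ Y := by
    rcases (show j < k ∨ j = k by lia) with hj | rfl
    · exact (hT.le_finish hj (by lia)).trans hy
    · rw [hT.top _ (by lia)]
  rcases lt_or_ge (T j i) (T (j + 1) (i + 1)) with hlt | hge
  · rw [gapTerm_of_lt hlt, gapTerm_of_lt hlt, sub_sub_sub_comm]
    refine (abs_sub (F i (T j i) - G i (T j i)) _).trans ?_
    have h1 := h i _ (hlt.trans_le hle)
    have h2 := (hF i).abs_leftLim_sub_le (hG i) (x := T (j + 1) (i + 1))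
      fun z hz => h i z (hz.trans_le hle)
    linarith
  · rw [gapTerm_of_le hge, gapTerm_of_le hge, sub_self, abs_zero]
    linarith

theorem abs_lpp_sub_le {G : ℕ → ℝ → ℝ} {ε : ℝ} (hF : ∀ i, IsLine (F i))
    (hG : ∀ i, IsLine (G i)) (hk : k ≤ n) (hε : 0 ≤ ε) (h : ∀ i, ∀ z < Y, |F i z - G i z| ≤ ε)
    (hx : 0 ≤ x) (hxy : x ≤ y) (hy : y < Y) :
    |lpp F n k x y - lpp G n k x y| ≤ n * ((k + 1) * (2 * ε) + ε) := by
  obtain ⟨T, hT, h1⟩ := exists_isArray hF hk hx hxy hy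
  obtain ⟨S, hS, h2⟩ := exists_isArray hG hk hx hxy hy
  have h3 := abs_le.1 (abs_arrayLength_sub_le hF hG hε h hT hy.le)
  have h4 := abs_le.1 (abs_arrayLength_sub_le hF hG hε h hS hy.le)
  have h5 := hT.length_le_lpp hG hk hx hxy hy
  have h6 := hS.length_le_lpp hF hk hx hxy hy
  rw [abs_le]
  constructor <;> linarith [h3.1, h3.2, h4.1, h4.2]

end

/-! ### The lemon map as a locally uniform limit -/

/-- Locally uniform limits of lines. -/
theorem isLine_of_tendstoUniformlyOn {A : ℝ → ℝ → ℝ} {g : ℝ → ℝ} (hA : ∀ t, IsLine (A t))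
    (h : ∀ T, TendstoUniformlyOn A g atTop (Iio T)) :
    IsLine g ∧ ∀ x, Tendsto (fun t => Function.leftLim (A t) x) atTop
      (𝓝 (Function.leftLim g x)) := by
  have hpt : ∀ x, Tendsto (fun t => A t x) atTop (𝓝 (g x)) := fun x =>
    (h (x + 1)).tendsto_at (lt_add_one x)
  have hfilter : ∀ (x : ℝ) (s : Set ℝ), TendstoUniformlyOnFilter A g atTop (𝓝[s] x) := by
    intro x s
    refine (h (x + 1)).tendstoUniformlyOnFilter.mono_right ?_
    exact nhdsWithin_le_nhds.trans (le_principal_iff.2 (Iio_mem_nhds (lt_add_one x)))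
  have hleft : ∀ x, ∃ l, Tendsto (fun t => Function.leftLim (A t) x) atTop (𝓝 l) := by
    intro x
    refine cauchySeq_tendsto_of_complete (Metric.cauchySeq_iff.2 fun ε hε => ?_)
    obtain ⟨t₀, ht₀⟩ := eventually_atTop.1
      (Metric.tendstoUniformlyOn_iff.1 (h x) (ε / 3) (by linarith))
    refine ⟨t₀, fun t ht s hs => ?_⟩
    rw [Real.dist_eq]
    refine lt_of_le_of_lt ((hA t).abs_leftLim_sub_le (hA s) (ε := ε / 3 + ε / 3)
      fun y hy => ?_) (by linarith)
    have h1 := ht₀ t ht y hy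
    have h2 := ht₀ s hs y hy
    rw [dist_comm] at h1
    rw [← Real.dist_eq]
    exact (dist_triangle _ (g y) _).trans (add_le_add h1.le h2.le)
  choose l hl using hleft
  have hgl : ∀ x, Tendsto g (𝓝[<] x) (𝓝 (l x)) := fun x =>
    (hfilter x (Iio x)).tendsto_of_eventually_tendsto
      (Eventually.of_forall fun t => (hA t).tendsto_left x) (hl x)
  have hll : ∀ x, Function.leftLim g x = l x := fun x => leftLim_eq_of_tendsto (hgl x)
  refine ⟨⟨fun x hx => ?_, fun x => ?_, fun x => ⟨l x, hgl x⟩, fun x => ?_⟩, fun x => ?_⟩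
  · refine tendsto_nhds_unique (hpt x) ?_
    simp only [(hA _).zero_of_neg x hx]
    exact tendsto_const_nhds
  · exact (hfilter x (Ici x)).tendsto_of_eventually_tendsto
      (Eventually.of_forall fun t => (hA t).right_cont x) (hpt x)
  · rw [hll]
    exact le_of_tendsto_of_tendsto' (hl x) (hpt x) fun t => (hA t).left_le x
  · rw [hll]
    exact hl x

section lemon

variable {n k : ℕ} {f : Fin n → ℝ → ℝ} {x y t : ℝ}

theorem isLine_lemonUpTo (hf : f ∈ cadlagSpace n) (t : ℝ) (i : Fin n) :
    IsLine (lemonUpTo t f i) :=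
  mem_cadlagSpace.1 (rotate_mem (melon_mem (rotate_mem hf t)) t) i

theorem melon_rotate_apply (hf : f ∈ cadlagSpace n) (hy : 0 ≤ y) (hyt : y ≤ t) (i : Fin n) :
    melon (rotate t f) i y =
      multiLastPassage f (i + 1) (t - y) t - multiLastPassage f i (t - y) t := by
  rw [melon, if_neg hy.not_gt, multiLastPassage_rotate hf i.2 le_rfl hy hyt,
    multiLastPassage_rotate hf i.2.le le_rfl hy hyt, sub_zero]

/-- The inner rotation turns melon values from time `0` into values of `f` on final intervals ending
at `t`. The outer rotation takes their increments, which are losses from starting at `x` instead of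
`0`. -/
theorem leftLim_lemonUpTo (hf : f ∈ cadlagSpace n) (hx : 0 ≤ x) (hxt : x ≤ t) (i : Fin n) :
    Function.leftLim (lemonUpTo t f i) x =
      lppLoss (extendLines f) n (n - i) x t - lppLoss (extendLines f) n (n - (i + 1)) x t := by
  have hm := mem_cadlagSpace.1 (melon_mem (rotate_mem hf t))
  have h1 : n - (i.val + 1) + 1 = n - i := by lia
  rw [lemonUpTo, rotate_eq, leftLim_rotateLine (hm _) hx,
    melon_rotate_apply hf (hx.trans hxt) le_rfl, melon_rotate_apply hf (by linarith) (by linarith),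
    sub_self, sub_sub_cancel, Fin.val_rev, h1]
  simp only [lppLoss, lpp_extendLines]
  ring

/-- The bound depends on `T` but not on `x`, which yields local uniformity. Values at `x` are right
limits of left limits, so room to the right of `x` is needed. -/
theorem abs_lemonUpTo_sub_le (hf : f ∈ cadlagSpace n) {T s : ℝ} (hT : 0 ≤ T) (hx : x < T)
    (hTs : T ≤ s) (hst : s ≤ t) (i : Fin n) : |lemonUpTo s f i x - lemonUpTo t f i x| ≤
      (lppLoss (extendLines f) n (n - i) T s - lppLoss (extendLines f) n (n - i) T t) +
      (lppLoss (extendLines f) n (n - (i + 1)) T s -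
        lppLoss (extendLines f) n (n - (i + 1)) T t) := by
  have hF := isLine_extendLines hf
  have key : ∀ z, 0 ≤ z → z ≤ T →
      |Function.leftLim (lemonUpTo s f i) z - Function.leftLim (lemonUpTo t f i) z| ≤
      (lppLoss (extendLines f) n (n - i) T s - lppLoss (extendLines f) n (n - i) T t) +
      (lppLoss (extendLines f) n (n - (i + 1)) T s -
        lppLoss (extendLines f) n (n - (i + 1)) T t) := by
    intro z hz hzT
    rw [leftLim_lemonUpTo hf hz (hzT.trans hTs), leftLim_lemonUpTo hf hz (by linarith),
      sub_sub_sub_comm]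
    exact (abs_sub _ _).trans (add_le_add
      (abs_lppLoss_sub_le hF (by lia) hz hzT hTs hst)
      (abs_lppLoss_sub_le hF (by lia) hz hzT hTs hst))
  rcases lt_or_ge x 0 with hx0 | hx0
  · rw [(isLine_lemonUpTo hf s i).zero_of_neg x hx0, (isLine_lemonUpTo hf t i).zero_of_neg x hx0,
      sub_self, abs_zero]
    exact (abs_nonneg _).trans (key 0 le_rfl hT)
  · refine le_of_tendsto (((isLine_lemonUpTo hf s i).leftLim_tendsto_right x).sub
      ((isLine_lemonUpTo hf t i).leftLim_tendsto_right x)).abs ?_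
    filter_upwards [Ioo_mem_nhdsGT hx] with z hz
    exact key z (hx0.trans hz.1.le) hz.2.le

theorem exists_abs_lemonUpTo_sub_le (hf : f ∈ cadlagSpace n) (i : Fin n) {T ε : ℝ} (hT : 0 ≤ T)
    (hε : 0 < ε) : ∃ s₀, ∀ s ≥ s₀, ∀ t ≥ s, ∀ x < T,
      |lemonUpTo s f i x - lemonUpTo t f i x| ≤ ε := by
  have hF := isLine_extendLines hf
  have h1 := (tendsto_busemann hF (show n - i ≤ n by lia) hT).cauchySeq
  have h2 := (tendsto_busemann hF (show n - (i + 1) ≤ n by lia) hT).cauchySeq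
  obtain ⟨s₁, hs₁⟩ := Metric.cauchySeq_iff.1 h1 (ε / 2) (half_pos hε)
  obtain ⟨s₂, hs₂⟩ := Metric.cauchySeq_iff.1 h2 (ε / 2) (half_pos hε)
  refine ⟨max T (max s₁ s₂), fun s hs t ht x hx => ?_⟩
  rw [ge_iff_le, max_le_iff, max_le_iff] at hs
  refine (abs_lemonUpTo_sub_le hf hT hx hs.1 ht i).trans ?_
  have h3 := hs₁ s hs.2.1 t (hs.2.1.trans ht)
  have h4 := hs₂ s hs.2.2 t (hs.2.2.trans ht)
  rw [Real.dist_eq] at h3 h4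
  linarith [(abs_lt.1 h3).2, (abs_lt.1 h4).2]

theorem tendsto_lemonUpTo (hf : f ∈ cadlagSpace n) (i : Fin n) (x : ℝ) :
    Tendsto (fun t => lemonUpTo t f i x) atTop (𝓝 (lemon f i x)) := by
  refine tendsto_nhds_limUnder (cauchySeq_tendsto_of_complete
    (Metric.cauchySeq_iff'.2 fun ε hε => ?_))
  obtain ⟨s₀, hs₀⟩ := exists_abs_lemonUpTo_sub_le hf i (show 0 ≤ max x 0 + 1 by positivity)
    (half_pos hε)
  refine ⟨s₀, fun t ht => ?_⟩
  rw [Real.dist_eq, abs_sub_comm]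
  have := hs₀ s₀ le_rfl t ht x (by linarith [le_max_left x 0])
  linarith

/-- The limit defining the lemon map is locally uniform. -/
theorem tendstoUniformlyOn_lemonUpTo (hf : f ∈ cadlagSpace n) (i : Fin n) (T : ℝ) :
    TendstoUniformlyOn (fun t => lemonUpTo t f i) (lemon f i) atTop (Iio T) := by
  refine Metric.tendstoUniformlyOn_iff.2 fun ε hε => ?_
  obtain ⟨s₀, hs₀⟩ := exists_abs_lemonUpTo_sub_le hf i (le_max_right T 0) (half_pos hε)
  filter_upwards [eventually_ge_atTop s₀] with s hs x hx
  rw [Real.dist_eq, abs_sub_comm]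
  have h := le_of_tendsto ((tendsto_lemonUpTo hf i x).const_sub (lemonUpTo s f i x)).abs
    (b := ε / 2) (by
      filter_upwards [eventually_ge_atTop s] with t ht
      exact hs₀ s hs t ht x (lt_of_lt_of_le hx (le_max_left T 0)))
  linarith

theorem lemon_mem (hf : f ∈ cadlagSpace n) : lemon f ∈ cadlagSpace n :=
  mem_cadlagSpace.2 fun i => (isLine_of_tendstoUniformlyOn (fun t => isLine_lemonUpTo hf t i)
    (tendstoUniformlyOn_lemonUpTo hf i)).1

theorem leftLim_lemon (hf : f ∈ cadlagSpace n) (hx : 0 ≤ x) (i : Fin n) :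
    Function.leftLim (lemon f i) x =
      busemann (extendLines f) n (n - i) x - busemann (extendLines f) n (n - (i + 1)) x := by
  have hF := isLine_extendLines hf
  refine tendsto_nhds_unique ((isLine_of_tendstoUniformlyOn (fun t => isLine_lemonUpTo hf t i)
    (tendstoUniformlyOn_lemonUpTo hf i)).2 x) (Tendsto.congr' ?_
      ((tendsto_busemann hF (show n - i ≤ n by lia) hx).sub
        (tendsto_busemann hF (show n - (i + 1) ≤ n by lia) hx)))
  filter_upwards [eventually_ge_atTop x] with t ht
  exact (leftLim_lemonUpTo hf hx ht i).symm

theorem multiLastPassage_lemonUpTo (hf : f ∈ cadlagSpace n) (hk : k ≤ n) (hx : 0 ≤ x)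
    (hxy : x ≤ y) (hyt : y ≤ t) :
    multiLastPassage (lemonUpTo t f) k x y = multiLastPassage f k x y := by
  have h1 := rotate_mem hf t
  rw [lemonUpTo, multiLastPassage_rotate (melon_mem h1) hk hx hxy hyt,
    multiLastPassage_melon h1 hk (by linarith) (by linarith),
    multiLastPassage_rotate hf hk (by linarith) (by linarith) (by linarith), sub_sub_cancel,
    sub_sub_cancel]

/-- The lemon map is an isometry. -/
theorem multiLastPassage_lemon (hf : f ∈ cadlagSpace n) (hk : k ≤ n) (hx : 0 ≤ x)
    (hxy : x ≤ y) : multiLastPassage (lemon f) k x y = multiLastPassage f k x y := by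
  have hM := lemon_mem hf
  refine eq_of_abs_sub_le_all fun ε hε => ?_
  -- The factor is the Lipschitz constant of `abs_lpp_sub_le`; the values of the approximations
  -- already agree with those of `f`, so only this error enters.
  obtain ⟨δ, hδ0, hδ⟩ : ∃ δ > 0, n * ((k + 1) * (2 * δ) + δ) ≤ ε := by
    refine ⟨ε / (n * ((k + 1) * 2 + 1) + 1), by positivity, ?_⟩
    have : (n : ℝ) * ((k + 1) * (2 * (ε / (n * ((k + 1) * 2 + 1) + 1))) +
        ε / (n * ((k + 1) * 2 + 1) + 1)) =
        ε * ((n * ((k + 1) * 2 + 1)) / (n * ((k + 1) * 2 + 1) + 1)) := by ring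
    rw [this]
    refine mul_le_of_le_one_right hε.le ?_
    rw [div_le_one (by positivity)]
    linarith
  have hev : ∀ᶠ t in atTop, ∀ i : Fin n, ∀ z < y + 1, |lemon f i z - lemonUpTo t f i z| ≤ δ := by
    refine eventually_all.2 fun i => ?_
    filter_upwards [Metric.tendstoUniformlyOn_iff.1
      (tendstoUniformlyOn_lemonUpTo hf i (y + 1)) δ hδ0] with t ht z hz
    rw [← Real.dist_eq]
    exact (ht z hz).le
  obtain ⟨t, ht, hyt⟩ := (hev.and (eventually_ge_atTop y)).exists
  rw [← multiLastPassage_lemonUpTo hf hk hx hxy hyt, ← lpp_extendLines, ← lpp_extendLines]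
  refine (abs_lpp_sub_le (isLine_extendLines hM) (isLine_extendLines
    (mem_cadlagSpace.2 (isLine_lemonUpTo hf t))) hk hδ0.le (fun i z hz => ?_) hx hxy
    (lt_add_one y)).trans hδ
  unfold extendLines
  split_ifs with h
  · exact ht ⟨i, h⟩ z hz
  · rw [sub_self, abs_zero]
    exact hδ0.le

/-- The lemon map depends only on last passage values. -/
theorem lemon_congr {g : Fin n → ℝ → ℝ} (hf : f ∈ cadlagSpace n) (hg : g ∈ cadlagSpace n)
    (h : ∀ k ≤ n, ∀ x y, 0 ≤ x → x ≤ y → multiLastPassage f k x y = multiLastPassage g k x y) :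
    lemon f = lemon g := by
  have hB : ∀ k ≤ n, ∀ x, 0 ≤ x →
      busemann (extendLines f) n k x = busemann (extendLines g) n k x := by
    intro k hk x hx
    refine tendsto_nhds_unique (Tendsto.congr' ?_ (tendsto_busemann (isLine_extendLines hf) hk hx))
      (tendsto_busemann (isLine_extendLines hg) hk hx)
    filter_upwards [eventually_ge_atTop x] with t ht
    simp only [lppLoss, lpp_extendLines]
    rw [h k hk 0 t le_rfl (hx.trans ht), h k hk x t hx ht]
  funext i
  refine (mem_cadlagSpace.1 (lemon_mem hf) i).ext_leftLim (mem_cadlagSpace.1 (lemon_mem hg) i)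
    fun x hx => ?_
  rw [leftLim_lemon hf hx, leftLim_lemon hg hx, hB _ (by lia) x hx, hB _ (by lia) x hx]

end lemon

end

/-! ### Fixed points of the lemon map -/

section

section

variable {F G : ℕ → ℝ → ℝ} {n k : ℕ} {x y t Y : ℝ} {T : ℕ → ℕ → ℝ}

theorem bottomSum_succ (hk : k + 1 ≤ n) : bottomSum F n (k + 1) x =
    bottomSum F n k x + Function.leftLim (F (n - (k + 1))) x := by
  have h : Function.leftLim (F (n - (k + 1))) x = ∑ i ∈ Finset.range n,
      if i = n - (k + 1) then Function.leftLim (F i) x else 0 := by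
    rw [Finset.sum_ite_eq', if_pos (Finset.mem_range.2 (by lia))]
  rw [h, bottomSum, bottomSum, ← Finset.sum_add_distrib]
  refine Finset.sum_congr rfl fun i _ => ?_
  split_ifs <;> first | lia | simp

theorem busemann_zero (F : ℕ → ℝ → ℝ) (n : ℕ) (x : ℝ) : busemann F n 0 x = 0 := by
  have : lppLoss F n 0 x = fun _ => 0 := by
    funext t
    rw [lppLoss, lpp_zero, lpp_zero, sub_zero]
  rw [busemann, this]
  exact tendsto_const_nhds.limUnder_eq

theorem bottomSum_le_busemann (hF : ∀ i, IsLine (F i)) (hk : k ≤ n) (hx : 0 ≤ x) :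
    bottomSum F n k x ≤ busemann F n k x := by
  refine ge_of_tendsto (tendsto_busemann hF hk hx) ?_
  filter_upwards [eventually_ge_atTop x] with t ht using bottomSum_le_lppLoss hF hk hx ht

theorem arrayLength_add (hF : ∀ i, IsLine (F i)) (hG : ∀ i, IsLine (G i)) :
    arrayLength (fun i x => F i x + G i x) n k Y T =
      arrayLength F n k Y T + arrayLength G n k Y T := by
  unfold arrayLength
  rw [← Finset.sum_add_distrib]
  refine Finset.sum_congr rfl fun i _ => ?_
  simp only [gapTerm_add (hF i) (hG i), (hF i).leftLim_add (hG i), Finset.sum_add_distrib]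
  ring

end

theorem eq_of_abs_sub_le_mul {a b c : ℝ} (hc : 0 ≤ c) (h : ∀ ε > 0, |a - b| ≤ c * ε) : a = b := by
  refine eq_of_abs_sub_le_all fun ε hε => (h (ε / (c + 1)) (by positivity)).trans ?_
  rw [mul_div_left_comm]
  refine mul_le_of_le_one_right hε.le ?_
  rw [div_le_one (by positivity)]
  linarith

section fixed

variable {n k : ℕ} {f : Fin n → ℝ → ℝ} {x : ℝ}

/-- The fixed points of the lemon map. -/
theorem lemon_eq_self_iff (hf : f ∈ cadlagSpace n) : lemon f = f ↔
    ∀ k ≤ n, ∀ x, 0 ≤ x → busemann (extendLines f) n k x = bottomSum (extendLines f) n k x := by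
  constructor
  · intro h k hk x hx
    induction k with
    | zero => rw [busemann_zero, bottomSum_zero_right]
    | succ k ih =>
      have h1 := leftLim_lemon hf hx ⟨n - (k + 1), by lia⟩
      rw [h, ← extendLines_apply f] at h1
      simp only [show n - (n - (k + 1)) = k + 1 by lia,
        show n - (n - (k + 1) + 1) = k by lia] at h1
      rw [bottomSum_succ hk, ← ih (by lia), h1]
      ring
  · intro h
    funext i
    refine (mem_cadlagSpace.1 (lemon_mem hf) i).ext_leftLim (mem_cadlagSpace.1 hf i)
      fun x hx => ?_
    rw [leftLim_lemon hf hx, h _ (by lia) x hx, h _ (by lia) x hx,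
      show n - i.val = n - (i.val + 1) + 1 by lia, bottomSum_succ (by lia),
      show n - (n - (i.val + 1) + 1) = i.val by lia, extendLines_apply]
    ring

/-- Along the given sequence the optimizers eventually follow the lowest paths up to time `x`. The
loss is then at most `bottomSum`, which is always a lower bound. -/
theorem busemann_eq_of_mem_downMinusSpace (hf : f ∈ downMinusSpace n) (hk : k ≤ n)
    (hx : 0 ≤ x) :
    busemann (extendLines f) n k x = bottomSum (extendLines f) n k x := by
  have hF := isLine_extendLines hf.1
  rcases Nat.eq_zero_or_pos k with rfl | hk0
  · rw [busemann_zero, bottomSum_zero_right]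
  obtain ⟨s, t, hs, hopt, hlim⟩ := hf.2 k hk0 hk
  refine le_antisymm (le_of_tendsto ((tendsto_busemann hF hk hx).comp hs) ?_)
    (bottomSum_le_busemann hF hk hx)
  have hev : ∀ᶠ m in atTop, ∀ (j : Fin k) (i : Fin (n + 1)), i.val ≤ n - k + j.val →
      x ≤ t m j i := by
    refine eventually_all.2 fun j => eventually_all.2 fun i => ?_
    by_cases h : i.val ≤ n - k + j.val
    · filter_upwards [((hlim j i).1 h).eventually_ge_atTop x] with m hm _ using hm
    · exact Eventually.of_forall fun m h' => absurd h' h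
  filter_upwards [hev, hs.eventually_ge_atTop x] with m hm hxm
  have hsm : 0 ≤ s m := hx.trans hxm
  have hA := (hopt m).1.pad le_rfl (lt_add_one (s m)) (by linarith)
  have h1 := hA.length_le_of_le hF hk hk0 hx hxm (lt_add_one (s m)) fun j hj i hi => by
    rw [pad_succ hj (by lia)]
    exact hm ⟨j, hj⟩ ⟨i, by lia⟩ hi
  rw [← tupleLength_eq hF (hopt m).1 le_rfl hsm (lt_add_one (s m)), extendLines_coe, (hopt m).2,
    ← lpp_extendLines] at h1
  simp only [Function.comp_apply, lppLoss]
  linarith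

/-- Both sides of the fixed-point criterion are Lipschitz in the uniform norm, with constants
independent of the final time, so equality passes to the closure. -/
theorem lemon_eq_self_of_mem_downSpace (hf : f ∈ downSpace n) : lemon f = f := by
  refine (lemon_eq_self_iff hf.1).2 fun k hk x hx => ?_
  set c : ℝ := n * ((k + 1) * 2 + 1) with hc
  refine eq_of_abs_sub_le_mul (c := 2 * c + n) (by positivity) fun ε hε => ?_
  obtain ⟨g, hg, hfg⟩ := hf.2 ε hε
  have hF := isLine_extendLines hf.1
  have hG := isLine_extendLines hg.1
  have hFG : ∀ i z, |extendLines f i z - extendLines g i z| ≤ ε := by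
    intro i z
    unfold extendLines
    split_ifs with h
    · exact hfg _ _
    · rw [sub_self, abs_zero]
      exact hε.le
  have h1 : |busemann (extendLines f) n k x - busemann (extendLines g) n k x| ≤ 2 * c * ε := by
    refine le_of_tendsto ((tendsto_busemann hF hk hx).sub (tendsto_busemann hG hk hx)).abs ?_
    filter_upwards [eventually_ge_atTop x] with t ht
    have h2 := abs_lpp_sub_le hF hG hk hε.le (fun i z _ => hFG i z) le_rfl (hx.trans ht)
      (lt_add_one t)
    have h3 := abs_lpp_sub_le hF hG hk hε.le (fun i z _ => hFG i z) hx ht (lt_add_one t)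
    have hceq : (n : ℝ) * ((k + 1) * (2 * ε) + ε) = c * ε := by rw [hc]; ring
    rw [hceq] at h2 h3
    unfold lppLoss
    rw [sub_sub_sub_comm]
    refine (abs_sub _ _).trans ?_
    linarith
  have h2 : |bottomSum (extendLines f) n k x - bottomSum (extendLines g) n k x| ≤ n * ε := by
    unfold bottomSum
    rw [← Finset.sum_sub_distrib]
    refine (Finset.abs_sum_le_sum_abs _ _).trans ((Finset.sum_le_card_nsmul _ _ ε
      fun i _ => ?_).trans_eq (by rw [Finset.card_range, nsmul_eq_mul]))
    split_ifs
    · exact (hF i).abs_leftLim_sub_le (hG i) fun z _ => hFG i z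
    · rw [sub_self, abs_zero]
      exact hε.le
  rw [busemann_eq_of_mem_downMinusSpace hg hk hx] at h1
  rw [abs_sub_comm] at h2
  have h3 := abs_add_le (busemann (extendLines f) n k x - bottomSum (extendLines g) n k x)
    (bottomSum (extendLines g) n k x - bottomSum (extendLines f) n k x)
  rw [sub_add_sub_cancel] at h3
  linarith

end fixed

/-! ### Rewarding low paths -/

section perturbation

theorem isLine_of_continuous {g : ℝ → ℝ} (hg : Continuous g) (h0 : ∀ x < 0, g x = 0) :
    IsLine g where
  zero_of_neg := h0
  right_cont _ := hg.continuousWithinAt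
  exists_left x := ⟨g x, hg.continuousWithinAt⟩
  left_le x := (leftLim_eq_of_tendsto (show Tendsto g (𝓝[<] x) (𝓝 (g x)) from
    hg.continuousWithinAt)).le

theorem leftLim_of_continuous {g : ℝ → ℝ} (hg : Continuous g) (x : ℝ) :
    Function.leftLim g x = g x :=
  leftLim_eq_of_tendsto (show Tendsto g (𝓝[<] x) (𝓝 (g x)) from hg.continuousWithinAt)

/-- A bounded continuous function which increases on `[0, ∞)`. -/
def ramp (x : ℝ) : ℝ := Real.arctan (max x 0)

theorem continuous_ramp : Continuous ramp :=
  Real.continuous_arctan.comp (continuous_id.max continuous_const)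

theorem ramp_of_nonpos {x : ℝ} (hx : x ≤ 0) : ramp x = 0 := by
  rw [ramp, max_eq_right hx, Real.arctan_zero]

theorem monotone_ramp : Monotone ramp := fun _ _ h =>
  Real.arctan_strictMono.monotone (max_le_max h le_rfl)

theorem ramp_lt_ramp {x y : ℝ} (hx : 0 ≤ x) (hxy : x < y) : ramp x < ramp y := by
  rw [ramp, ramp, max_eq_left hx, max_eq_left (hx.trans hxy.le)]
  exact Real.arctan_strictMono hxy

theorem ramp_nonneg (x : ℝ) : 0 ≤ ramp x :=
  Real.arctan_nonneg.2 (le_max_right x 0)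

theorem ramp_le_two (x : ℝ) : ramp x ≤ 2 := by
  have h1 := Real.arctan_lt_pi_div_two (max x 0)
  have h2 := Real.pi_le_four
  unfold ramp
  linarith

/-- Lines which favour low paths. -/
def rampLines (δ : ℝ) (i : ℕ) (x : ℝ) : ℝ := δ * i * ramp x

theorem continuous_rampLines (δ : ℝ) (i : ℕ) : Continuous (rampLines δ i) :=
  continuous_const.mul continuous_ramp

theorem isLine_rampLines (δ : ℝ) (i : ℕ) : IsLine (rampLines δ i) :=
  isLine_of_continuous (continuous_rampLines δ i) fun x hx => by
    rw [rampLines, ramp_of_nonpos hx.le, mul_zero]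

/-- Summation by parts along each path: an interior jump crosses between lines whose slopes differ
by `δ`. The total is an increasing function of the jump times, so late jumps, that is low paths, are
rewarded. -/
theorem arrayLength_rampLines {n k : ℕ} {y Y δ : ℝ} {T : ℕ → ℕ → ℝ}
    (hT : IsArray (n + 1) k 0 y Y T) : arrayLength (rampLines δ) (n + 1) k Y T =
      δ * ∑ j ∈ Finset.range k, ∑ i ∈ Finset.range n, ramp (T (j + 1) (i + 1)) := by
  have hgap : ∀ i, ∀ b a, b ≤ a → gapTerm (rampLines δ i) b a =
      rampLines δ i b - rampLines δ i a := by
    intro i b a h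
    rcases h.lt_or_eq with h | rfl
    · rw [gapTerm_of_lt h, leftLim_of_continuous (continuous_rampLines δ i)]
    · rw [gapTerm_of_le le_rfl, sub_self]
  have h1 : arrayLength (rampLines δ) (n + 1) k Y T = ∑ i ∈ Finset.range (n + 1),
      (∑ j ∈ Finset.range (k + 1), (rampLines δ i (T j i) -
        rampLines δ (i + 1 - 1) (T (j + 1) (i + 1))) + rampLines δ i Y) := by
    refine Finset.sum_congr rfl fun i hi => ?_
    rw [Finset.mem_range] at hi
    rw [leftLim_of_continuous (continuous_rampLines δ i)]
    congr 1
    refine Finset.sum_congr rfl fun j hj => ?_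
    rw [Finset.mem_range] at hj
    exact hgap i _ _ (hT.interlace j (by lia) i hi)
  rw [h1, Finset.sum_add_distrib, sum_diagonal n k (fun j i => rampLines δ i (T j i))
    (fun j i => rampLines δ (i - 1) (T j i))]
  have h2 : ∑ i ∈ Finset.range (n + 1), rampLines δ i (T 0 i) = 0 := by
    refine Finset.sum_eq_zero fun i hi => ?_
    rw [Finset.mem_range] at hi
    rw [hT.bot i hi.le, rampLines, ramp_of_nonpos (by norm_num), mul_zero]
  have h3 : ∑ i ∈ Finset.range (n + 1), rampLines δ (i + 1 - 1) (T (k + 1) (i + 1)) =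
      ∑ i ∈ Finset.range (n + 1), rampLines δ i Y := by
    refine Finset.sum_congr rfl fun i hi => ?_
    rw [Finset.mem_range] at hi
    rw [hT.top _ (by lia), Nat.add_sub_cancel]
  rw [h2, h3, Finset.mul_sum, zero_sub, neg_add_cancel_comm]
  refine Finset.sum_congr rfl fun j hj => ?_
  rw [Finset.mem_range] at hj
  rw [hT.start j hj, Finset.mul_sum]
  have h4 : rampLines δ 0 (T (j + 1) 0) = 0 := by simp [rampLines]
  have h5 : rampLines δ (n + 1 - 1) 0 = 0 := by rw [rampLines, ramp_of_nonpos le_rfl, mul_zero]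
  rw [h4, h5, sub_zero, zero_add]
  refine Finset.sum_congr rfl fun i _ => ?_
  rw [rampLines, rampLines, Nat.add_sub_cancel]
  push_cast
  ring

variable {F : ℕ → ℝ → ℝ} {n k : ℕ} {x t u δ : ℝ} {P : ℕ → ℕ → ℝ}

/-- An optimizer for lines which favour low paths follows the lowest constant paths for as long as
they are almost optimal for the original lines. -/
theorem le_of_isOptimal (hF : ∀ i, IsLine (F i)) (hk : k ≤ n) (hδ : 0 ≤ δ) (hu : 0 ≤ u)
    (hut : u + 1 ≤ t) (hP : IsArray n k 0 t (t + 1) P)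
    (hopt : arrayLength (fun i x => F i x + rampLines δ i x) n k (t + 1) P =
      lpp (fun i x => F i x + rampLines δ i x) n k 0 t)
    (hloss : lppLoss F n k (u + 1) t < bottomSum F n k (u + 1) + δ * (ramp (u + 1) - ramp u))
    {j i : ℕ} (hj : j < k) (hi : i ≤ n - k + j) : u ≤ P (j + 1) i := by
  rcases i with _ | i
  · rw [hP.finish j hj]
    linarith
  by_contra hlt
  rw [not_le] at hlt
  have hk0 : 0 < k := by lia
  have hu1 : 0 ≤ u + 1 := by linarith
  have ht : 0 ≤ t := by linarith
  have hG : ∀ i, IsLine fun x => F i x + rampLines δ i x :=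
    fun i => (hF i).add (isLine_rampLines δ i)
  obtain ⟨N, rfl⟩ : ∃ N, n = N + 1 := ⟨n - 1, by lia⟩
  obtain ⟨q, hq, hqlen⟩ := exists_isArray hF hk hu1 hut (lt_add_one t)
  -- The competitor follows the lowest paths up to `u + 1` and is optimal for `F` afterwards. By
  -- `hloss` it misses the optimum for `F` by less than `δ * (ramp (u + 1) - ramp u)`.
  set r : ℕ → ℕ → ℝ := fun j i => min (q j i) (bottomArray (N + 1) k t (t + 1) j i) with hr
  have hrA : IsArray (N + 1) k 0 t (t + 1) r := hq.min_bottomArray hk hu1 hut (lt_add_one t)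
  have hrlen : arrayLength F (N + 1) k (t + 1) r =
      lpp F (N + 1) k (u + 1) t + bottomSum F (N + 1) k (u + 1) := by
    rw [← hqlen]
    exact hq.length_min_bottomArray hF hk hk0 hu1
  have hmin := hP.min hrA
  have hmax := hP.max hrA
  rw [min_self, min_self] at hmin
  rw [max_self, max_self] at hmax
  -- As `P` is optimal, `max P r` is not longer than `P`, so supermodularity makes `min P r` at
  -- least as long as `r` for the perturbed lines. For `F` it gains less than the defect of `r`,
  -- whereas the early jump of `P` costs at least that much reward.
  have h1 := hP.length_add_le hG hrA
  have h2 := hmax.length_le_lpp hG hk le_rfl ht (lt_add_one t)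
  have h3 := hmin.length_le_lpp hF hk le_rfl ht (lt_add_one t)
  rw [hopt] at h1
  rw [arrayLength_add hF (isLine_rampLines δ), arrayLength_add hF (isLine_rampLines δ)
      (T := fun j i => min (P j i) (r j i)),
    arrayLength_rampLines hrA, arrayLength_rampLines hmin] at h1
  have hterm : ∀ j' i', ramp (min (P (j' + 1) (i' + 1)) (r (j' + 1) (i' + 1))) ≤
      ramp (r (j' + 1) (i' + 1)) := fun j' i' => monotone_ramp (min_le_right _ _)
  have hgain : ramp (u + 1) - ramp u ≤
      ∑ j ∈ Finset.range k, ∑ i ∈ Finset.range N, (ramp (r (j + 1) (i + 1)) -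
        ramp (min (P (j + 1) (i + 1)) (r (j + 1) (i + 1)))) := by
    have hjk : j ∈ Finset.range k := Finset.mem_range.2 hj
    have hiN : i ∈ Finset.range N := Finset.mem_range.2 (by lia)
    refine le_trans ?_ (Finset.single_le_sum (f := fun j => ∑ i ∈ Finset.range N,
      (ramp (r (j + 1) (i + 1)) - ramp (min (P (j + 1) (i + 1)) (r (j + 1) (i + 1)))))
      (fun j' _ => Finset.sum_nonneg fun i' _ => sub_nonneg.2 (hterm j' i')) hjk)
    refine le_trans ?_ (Finset.single_le_sum (f := fun i =>
      ramp (r (j + 1) (i + 1)) - ramp (min (P (j + 1) (i + 1)) (r (j + 1) (i + 1))))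
      (fun i' _ => sub_nonneg.2 (hterm j i')) hiN)
    have h4 : u + 1 ≤ r (j + 1) (i + 1) := by
      simp only [hr]
      rw [bottomArray_succ hj, if_neg (by lia)]
      exact le_min (hq.start_le hj (by lia)) hut
    exact sub_le_sub (monotone_ramp h4) (monotone_ramp ((min_le_left _ _).trans hlt.le))
  simp only [Finset.sum_sub_distrib] at hgain
  have h5 := mul_le_mul_of_nonneg_left hgain hδ
  rw [mul_sub] at h5
  unfold lppLoss at hloss
  linarith

end perturbation

/-! ### The image of the lemon map and the conclusion -/

/-- Fixed points of the lemon map can be approximated by elements of `𝒟ⁿ_{↓-}`. -/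
theorem mem_downSpace_of_lemon_eq {n : ℕ} {f : Fin n → ℝ → ℝ} (hf : f ∈ cadlagSpace n)
    (h : lemon f = f) : f ∈ downSpace n := by
  refine ⟨hf, fun ε hε => ?_⟩
  have hF := isLine_extendLines hf
  obtain ⟨δ, hδ0, hδ⟩ : ∃ δ > 0, δ * n * 2 ≤ ε := by
    refine ⟨ε / (n * 2 + 1), by positivity, ?_⟩
    have : ε / (n * 2 + 1) * n * 2 = ε * ((n * 2) / (n * 2 + 1)) := by ring
    rw [this]
    refine mul_le_of_le_one_right hε.le ?_
    rw [div_le_one (by positivity)]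
    linarith
  have hG : ∀ i, IsLine fun x => extendLines f i x + rampLines δ i x :=
    fun i => (hF i).add (isLine_rampLines δ i)
  refine ⟨fun i x => extendLines f i x + rampLines δ i x, ⟨mem_cadlagSpace.2 fun i => hG i,
    fun k hk0 hk => ?_⟩, fun i x => ?_⟩
  · choose t ht using fun m : ℕ => exists_isOptimizer hG hk le_rfl (Nat.cast_nonneg (α := ℝ) m)
    have hA : ∀ m : ℕ, IsArray n k 0 (m : ℝ) (m + 1) (pad (m + 1) (t m)) := fun m =>
      (ht m).1.pad le_rfl (lt_add_one _) (by positivity)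
    refine ⟨fun m => m, t, tendsto_natCast_atTop_atTop, ht, fun j i => ⟨fun hi => ?_, fun hi => ?_⟩⟩
    · refine tendsto_atTop.2 fun b => ?_
      set u := max b 0 with hu
      have hu0 : 0 ≤ u := le_max_right b 0
      -- For a fixed point the loss at `u + 1` tends to exactly `bottomSum`. It eventually drops
      -- below any strictly larger bound, as required by `le_of_isOptimal`.
      have hB := (lemon_eq_self_iff hf).1 h k hk (u + 1) (by linarith)
      have hlim := (tendsto_busemann hF hk (show 0 ≤ u + 1 by linarith)).comp
        (tendsto_natCast_atTop_atTop (R := ℝ))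
      rw [hB] at hlim
      have hpos : 0 < δ * (ramp (u + 1) - ramp u) :=
        mul_pos hδ0 (sub_pos.2 (ramp_lt_ramp hu0 (lt_add_one u)))
      filter_upwards [hlim.eventually_lt_const (lt_add_of_pos_right _ hpos),
        tendsto_natCast_atTop_atTop.eventually_ge_atTop (u + 1)] with m hm hmu
      have h1 := le_of_isOptimal hF hk hδ0.le hu0 hmu (hA m) (by
        rw [← tupleLength_eq hG (ht m).1 le_rfl (Nat.cast_nonneg m) (lt_add_one _), (ht m).2,
          lpp]) hm j.2 hi
      rw [pad_succ j.2 i.2] at h1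
      exact (le_max_left b 0).trans h1
    -- The jump times before the arrival at the lowest lines are not merely convergent: disjointness
    -- forces them to be `0`.
    · refine Tendsto.congr (fun m => ?_) tendsto_const_nhds
      have h1 := (hA m).eq_start (j := j) (i := i) (by lia) j.2 (by lia)
      rw [pad_succ j.2 i.2] at h1
      exact h1.symm
  · beta_reduce
    rw [extendLines_apply, sub_add_cancel_left, abs_neg, rampLines, abs_of_nonneg
      (mul_nonneg (by positivity) (ramp_nonneg x))]
    have hi : (i.val : ℝ) ≤ n := by exact_mod_cast i.2.le
    refine le_trans ?_ hδ
    exact mul_le_mul (mul_le_mul_of_nonneg_left hi hδ0.le) (ramp_le_two x) (ramp_nonneg x)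
      (by positivity)

theorem lemon_lemon {n : ℕ} {f : Fin n → ℝ → ℝ} (hf : f ∈ cadlagSpace n) :
    lemon (lemon f) = lemon f :=
  lemon_congr (lemon_mem hf) hf fun _ hk _ _ hx hxy => multiLastPassage_lemon hf hk hx hxy

theorem lemon_mem_downSpace {n : ℕ} {f : Fin n → ℝ → ℝ} (hf : f ∈ cadlagSpace n) :
    lemon f ∈ downSpace n :=
  mem_downSpace_of_lemon_eq (lemon_mem hf) (lemon_lemon hf)

theorem lemon_melon {n : ℕ} {f : Fin n → ℝ → ℝ} (hf : f ∈ cadlagSpace n) :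
    lemon (melon f) = lemon f :=
  lemon_congr (melon_mem hf) hf fun _ hk _ _ hx hxy => multiLastPassage_melon hf hk hx hxy

theorem melon_lemon {n : ℕ} {f : Fin n → ℝ → ℝ} (hf : f ∈ cadlagSpace n) :
    melon (lemon f) = melon f :=
  melon_congr fun _ hk _ hy => multiLastPassage_lemon hf hk le_rfl hy

end

end

end LemonMap

theorem theorem2 (n : ℕ) (hn : 1 ≤ n) :
    -- the melon map and the lemon map are well defined from `𝒟ⁿ` to `𝒟ⁿ`; the limit defining the
    -- latter exists uniformly on compact sets
    (∀ f ∈ LemonMap.cadlagSpace n, LemonMap.melon f ∈ LemonMap.cadlagSpace n) ∧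
    (∀ f ∈ LemonMap.cadlagSpace n, LemonMap.lemon f ∈ LemonMap.cadlagSpace n ∧
      ∀ (i : Fin n) (T : ℝ), TendstoUniformlyOn (fun (t : ℝ) x => LemonMap.lemonUpTo t f i x)
        (LemonMap.lemon f i) atTop (Set.Icc 0 T)) ∧
    -- isometry
    (∀ f ∈ LemonMap.cadlagSpace n, ∀ x y : ℝ, 0 ≤ x → x ≤ y →
      LemonMap.lastPassage f x y = LemonMap.lastPassage (LemonMap.lemon f) x y) ∧
    -- idempotent property
    (∀ f ∈ LemonMap.cadlagSpace n, LemonMap.lemon (LemonMap.lemon f) = LemonMap.lemon f) ∧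
    -- image
    LemonMap.lemon '' LemonMap.cadlagSpace n = LemonMap.downSpace n ∧
    -- bijection, with inverse the melon map
    Set.BijOn LemonMap.lemon (LemonMap.upSpace n) (LemonMap.downSpace n) ∧
    Set.InvOn LemonMap.melon LemonMap.lemon (LemonMap.upSpace n) (LemonMap.downSpace n) ∧
    -- `MW = M` and `WM = W`
    (∀ f ∈ LemonMap.cadlagSpace n, LemonMap.lemon (LemonMap.melon f) = LemonMap.lemon f) ∧
    (∀ f ∈ LemonMap.cadlagSpace n, LemonMap.melon (LemonMap.lemon f) = LemonMap.melon f) := by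
  have hinv : Set.InvOn LemonMap.melon LemonMap.lemon (LemonMap.upSpace n)
      (LemonMap.downSpace n) := by
    refine ⟨fun f hf => ?_, fun f hf => ?_⟩
    · rw [LemonMap.melon_lemon hf.1, LemonMap.melon_eq_self hf]
    · rw [LemonMap.lemon_melon hf.1, LemonMap.lemon_eq_self_of_mem_downSpace hf]
  refine ⟨fun f hf => LemonMap.melon_mem hf, fun f hf => ⟨LemonMap.lemon_mem hf, fun i T => ?_⟩,
    fun f hf x y hx hxy => ?_, fun f hf => LemonMap.lemon_lemon hf, ?_, ?_, hinv,
    fun f hf => LemonMap.lemon_melon hf, fun f hf => LemonMap.melon_lemon hf⟩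
  · exact (LemonMap.tendstoUniformlyOn_lemonUpTo hf i (T + 1)).mono fun x hx =>
      lt_of_le_of_lt hx.2 (lt_add_one T)
  · rw [LemonMap.lastPassage_eq, LemonMap.lastPassage_eq,
      LemonMap.multiLastPassage_lemon hf hn hx hxy]
  · refine Set.Subset.antisymm ?_ fun f hf =>
      ⟨f, hf.1, LemonMap.lemon_eq_self_of_mem_downSpace hf⟩
    rintro _ ⟨f, hf, rfl⟩
    exact LemonMap.lemon_mem_downSpace hf
  -- The two maps are mutually inverse because `W` fixes `upSpace` pointwise and `M` fixes
  -- `downSpace` pointwise; only the ranges remain to be checked.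
  · exact hinv.bijOn (fun f hf => LemonMap.lemon_mem_downSpace hf.1)
      fun f hf => LemonMap.melon_mem_upSpace hf.1
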